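/- Let $q\in(0,1]$ and $N\in\mathbb{N}_0$. Let $C(SU_q(2))$ be the universal unital $C^*$-algebra with generators $a,b$ and relations $$ba=q\,ab,\quad b^*a=q\,ab^*,\quad bb^*=b^*b,\quad a^*a+q^2bb^*=1=aa^*+bb^*.$$ Let $\Delta\colon C(SU_q(2))\to C(SU_q(2))\otimes_{\min}C(SU_q(2))$ be its comultiplication, $\Delta(a)=a\otimes a-q\,b^*\otimes b$, $\Delta(b)=b\otimes a+a^*\otimes b$; let $\epsilon$ be the counit (the character with $\epsilon(a)=1$, $\epsilon(b)=0$), $h$ the Haar state, and $\rho$, $\Lambda\colon C(SU_q(2))\to L^2(SU_q(2))$ the GNS representation and the canonical map associated with $h$. The Podleś sphere $C(S_q^2)$ is the fixed point algebra of the circle action $\sigma_z(a)=za$, $\sigma_z(b)=zb$ on $C(SU_q(2))$. Let $\mathcal{O}(SU_q(2))$ be the unital $*$-subalgebra generated by $a,b$, put $\mathcal{A}_n=\{x\in\mathcal{O}(SU_q(2)) : \sigma_z(x)=z^nx\ \text{for all } z\in S^1\}$, and let $H_{\pm}$ be the closure of $\Lambda(\mathcal{A}_{\pm1})$ in $L^2(SU_q(2))$.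 By restriction of $\rho$, $C(S_q^2)$ acts on $H_+\oplus H_-$. Let $\partial_e,\partial_f,\partial_k$ be the endomorphisms $\partial_\eta=(1\otimes\langle\eta,\cdot\rangle)\Delta$ of $\mathcal{O}(SU_q(2))$ given by the generators $e,f,k$ of the quantum enveloping algebra $\mathcal{U}_q(\mathfrak{su}(2))$; explicitly, $\partial_k$ is the algebra automorphism with $\partial_k(a)=q^{1/2}a$, $\partial_k(b)=q^{1/2}b$, $\partial_k(a^*)=q^{-1/2}a^*$, $\partial_k(b^*)=q^{-1/2}b^*$, and for $\eta\in\{e,f\}$ one has $\partial_\eta(xy)=\partial_\eta(x)\partial_k(y)+\partial_k^{-1}(x)\partial_\eta(y)$ with $$\partial_e(a)=b^*,\ \ \partial_e(b)=-q^{-1}a^*,\ \ \partial_e(a^*)=\partial_e(b^*)=0,\qquad \partial_f(a^*)=-q\,b,\ \ \partial_f(b^*)=a,\ \ \partial_f(a)=\partial_f(b)=0.$$ Let $E$ and $F$ be the closures of the densely defined operators $\Lambda(x)\mapsto\Lambda(\partial_e(x))$, $x\in\mathcal{A}_1$, from $H_+$ to $H_-$ and $\Lambda(x)\mapsto\Lambda(\partial_f(x))$,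 $x\in\mathcal{A}_{-1}$, from $H_-$ to $H_+$. The Dąbrowski–Sitarz Dirac operator is $D_q=\begin{pmatrix}0&F\\E&0\end{pmatrix}$ on $H_+\oplus H_-$, with domain $\mathrm{Dom}(E)\oplus\mathrm{Dom}(F)$. Let $C^{\mathrm{Lip}}(S_q^2)$ be the set of all $x\in C(S_q^2)$ that preserve $\mathrm{Dom}(D_q)$ and for which $[D_q,x]$ extends to a bounded operator on $H_+\oplus H_-$, and let $L_{D_q}^{\max}(x)$ be the operator norm of this extension. For states $\mu,\nu$ of $C(S_q^2)$ let $$d_q^{\max}(\mu,\nu)=\sup\{|\mu(x)-\nu(x)| : x\in C^{\mathrm{Lip}}(S_q^2),\ L_{D_q}^{\max}(x)\le1\}\in[0,\infty]$$ be the Monge–Kantorovič metric. Finally put $h_N(x)=\langle N+1\rangle\, h\big((a^*)^N x\,a^N\big)$ with $\langle N+1\rangle=\sum_{k=0}^N q^{2k}$, and let $\beta_N(x)=(1\otimes h_N)\Delta(x)$ for $x\in C(S_q^2)$ (the quantum Berezin transform). Then for every $x\in C^{\mathrm{Lip}}(S_q^2)$, $$\|x-\beta_N(x)\|\le d_q^{\max}(h_N,\epsilon)\cdot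 L_{D_q}^{\max}(x),$$ where $h_N$ and $\epsilon$ on the right are restricted to $C(S_q^2)$ and $\infty\cdot 0=0$. -/

import Mathlib

open scoped TensorProduct InnerProductSpace ENNReal ComplexOrder

noncomputable section

namespace QuantumSU2

/-- The defining relations of quantum `SU(2)`, together with their adjoints, for a quadruple
`(a, a', b, b')` in a complex algebra; `a'` and `b'` play the role of `a*` and `b*`. -/
structure Relations {B : Type*} [Ring B] [Algebra ℂ B] (q : ℝ) (a a' b b' : B) : Prop where
  ba : b * a = (q : ℂ) • (a * b)
  b'a : b' * a = (q : ℂ) • (a * b')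
  bb' : b * b' = b' * b
  a'b' : a' * b' = (q : ℂ) • (b' * a')
  a'b : a' * b = (q : ℂ) • (b * a')
  a'a : a' * a + (q : ℂ) ^ 2 • (b * b') = 1
  aa' : a * a' + b * b' = 1

theorem Relations.map {B C : Type*} [Ring B] [Algebra ℂ B] [Ring C] [Algebra ℂ C] {q : ℝ}
    {a a' b b' : B} (h : Relations q a a' b b') (f : B →ₐ[ℂ] C) :
    Relations q (f a) (f a') (f b) (f b') where
  ba := by simpa only [map_mul, map_smul, map_add, map_one] using congrArg f h.ba
  b'a := by simpa only [map_mul, map_smul, map_add, map_one] using congrArg f h.b'a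
  bb' := by simpa only [map_mul, map_smul, map_add, map_one] using congrArg f h.bb'
  a'b' := by simpa only [map_mul, map_smul, map_add, map_one] using congrArg f h.a'b'
  a'b := by simpa only [map_mul, map_smul, map_add, map_one] using congrArg f h.a'b
  a'a := by simpa only [map_mul, map_smul, map_add, map_one] using congrArg f h.a'a
  aa' := by simpa only [map_mul, map_smul, map_add, map_one] using congrArg f h.aa'

theorem Relations.tensor {B C : Type*} [Ring B] [Algebra ℂ B] [Ring C] [Algebra ℂ C] {q : ℝ}
    {a a' b b' : B} {c c' d d' : C} (h : Relations q a a' b b') (k : Relations q c c' d d') :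
    Relations (B := B ⊗[ℂ] C) q
      (a ⊗ₜ c - (q : ℂ) • (b' ⊗ₜ d)) (a' ⊗ₜ c' - (q : ℂ) • (b ⊗ₜ d'))
      (b ⊗ₜ c + a' ⊗ₜ d) (b' ⊗ₜ c' + a ⊗ₜ d') := by
  have h1 : a' * a = 1 - (q : ℂ) ^ 2 • (b * b') := eq_sub_of_add_eq h.a'a
  have h2 : a * a' = 1 - (b * b') := eq_sub_of_add_eq h.aa'
  have k1 : c' * c = 1 - (q : ℂ) ^ 2 • (d * d') := eq_sub_of_add_eq k.a'a
  have k2 : c * c' = 1 - (d * d') := eq_sub_of_add_eq k.aa'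
  constructor <;>
  · simp only [mul_add, mul_sub, add_mul, sub_mul, Algebra.TensorProduct.tmul_mul_tmul,
      smul_mul_assoc, mul_smul_comm, h1, h2, k1, k2, h.ba, k.ba, h.b'a, k.b'a, ← h.bb', ← k.bb', h.a'b', k.a'b', h.a'b, k.a'b,
      TensorProduct.sub_tmul, TensorProduct.tmul_sub, ← TensorProduct.smul_tmul',
      TensorProduct.tmul_smul, Algebra.TensorProduct.one_def]
    module

/-- A representation of the relations of quantum `SU(2)` by bounded operators on some (nonzero)
Hilbert space. -/
structure Rep (q : ℝ) where
  H : Type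
  [instNACG : NormedAddCommGroup H]
  [instIPS : InnerProductSpace ℂ H]
  [instComplete : CompleteSpace H]
  [instNontrivial : Nontrivial H]
  a : H →L[ℂ] H
  b : H →L[ℂ] H
  rel : Relations q a (star a) b (star b)

attribute [instance] Rep.instNACG Rep.instIPS Rep.instComplete Rep.instNontrivial

theorem norm_le_one_of_rel {H : Type*} [NormedAddCommGroup H] [InnerProductSpace ℂ H]
    [CompleteSpace H] {x y : H →L[ℂ] H} (h : x * star x + y * star y = 1) : ‖x‖ ≤ 1 := by
  rw [← norm_star]
  refine ContinuousLinearMap.opNorm_le_bound _ zero_le_one fun v => ?_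
  have h1 : ‖star x v‖ ^ 2 + ‖star y v‖ ^ 2 = ‖v‖ ^ 2 := by
    have := congrArg (fun T : H →L[ℂ] H => RCLike.re ⟪v, T v⟫_ℂ) h
    simp only [add_apply, mul_apply_eq_comp, inner_add_right, one_apply_eq_self, map_add] at this
    rw [← ContinuousLinearMap.adjoint_inner_left, ← ContinuousLinearMap.adjoint_inner_left y] at this
    simpa only [ContinuousLinearMap.star_eq_adjoint, inner_self_eq_norm_sq] using this
  rw [one_mul]
  exact le_of_sq_le_sq (by nlinarith [sq_nonneg ‖star y v‖]) (norm_nonneg _) 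

/-- The unital C*-algebra structure on an `ℓ^∞`-product of C*-algebras. -/
instance instCStarAlgebraLp {I : Type*} {A : I → Type*} [∀ i, Nontrivial (A i)]
    [∀ i, CStarAlgebra (A i)] : CStarAlgebra (lp A ∞) where

/-- The C*-algebra of bounded families of operators on a family of Hilbert spaces, with the
supremum norm and pointwise operations. -/
def OpFamily {I : Type*} (H : I → Type*) [∀ i, NormedAddCommGroup (H i)]
    [∀ i, InnerProductSpace ℂ (H i)] [∀ i, CompleteSpace (H i)] [∀ i, Nontrivial (H i)] : Type _ :=
  lp (fun i => H i →L[ℂ] H i) ∞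

namespace OpFamily

variable {I J : Type*} {H : I → Type*} [∀ i, NormedAddCommGroup (H i)]
  [∀ i, InnerProductSpace ℂ (H i)] [∀ i, CompleteSpace (H i)] [∀ i, Nontrivial (H i)]

instance instCStarAlgebra : CStarAlgebra (OpFamily H) :=
  inferInstanceAs (CStarAlgebra (lp (fun i => H i →L[ℂ] H i) ∞))

/-- A bounded family, given by its members. -/
def mk (f : ∀ i, H i →L[ℂ] H i) (C : ℝ) (hC : ∀ i, ‖f i‖ ≤ C) : OpFamily H :=
  (⟨f, memℓp_infty ⟨C, by rintro _ ⟨i, rfl⟩; exact hC i⟩⟩ : lp (fun i => H i →L[ℂ] H i) ∞)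

/-- The member of the family at an index. -/
def eval (i : I) : OpFamily H →⋆ₐ[ℂ] (H i →L[ℂ] H i) where
  toFun x := (show lp (fun i => H i →L[ℂ] H i) ∞ from x) i
  map_one' := rfl
  map_mul' _ _ := rfl
  map_zero' := rfl
  map_add' _ _ := rfl
  commutes' _ := rfl
  map_star' _ := rfl

@[simp] theorem eval_mk (f : ∀ i, H i →L[ℂ] H i) (C : ℝ) (hC : ∀ i, ‖f i‖ ≤ C) (i : I) :
    eval i (mk f C hC) = f i := rfl

theorem ext {x y : OpFamily H} (h : ∀ i, eval i x = eval i y) : x = y :=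
  Subtype.ext (funext h)

theorem norm_eval_le (x : OpFamily H) (i : I) : ‖eval i x‖ ≤ ‖x‖ :=
  lp.norm_apply_le_norm ENNReal.top_ne_zero (show lp (fun i => H i →L[ℂ] H i) ∞ from x) i

theorem norm_le {x : OpFamily H} {C : ℝ} (hC : 0 ≤ C) (h : ∀ i, ‖eval i x‖ ≤ C) : ‖x‖ ≤ C :=
  lp.norm_le_of_forall_le (f := (show lp (fun i => H i →L[ℂ] H i) ∞ from x)) hC h

/-- Reindexing of bounded families. -/
def reindex (f : J → I) : OpFamily H →⋆ₐ[ℂ] OpFamily (fun j => H (f j)) where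
  toFun x := mk (fun j => eval (f j) x) ‖x‖ fun j => norm_eval_le x (f j)
  map_one' := rfl
  map_mul' _ _ := rfl
  map_zero' := rfl
  map_add' _ _ := rfl
  commutes' _ := rfl
  map_star' _ := rfl

theorem continuous_reindex (f : J → I) : Continuous (reindex f : OpFamily H →⋆ₐ[ℂ] _) :=
  ((reindex f : OpFamily H →⋆ₐ[ℂ] _).toAlgHom.toLinearMap.mkContinuous 1 fun x => by
    rw [one_mul]
    exact norm_le (norm_nonneg _) fun j => norm_eval_le x (f j)).continuous

end OpFamily

open OpFamily

/-- Bounded families of operators indexed by all representations of the relations. -/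
abbrev Ambient (q : ℝ) : Type 1 := OpFamily (fun r : Rep q => r.H)

section HilbertTensor

/-- The Hilbert space tensor product: the completion of the algebraic tensor product for the
inner product `⟪v ⊗ w, v' ⊗ w'⟫ = ⟪v, v'⟫ ⟪w, w'⟫`. -/
def HTensor (H K : Type*) [NormedAddCommGroup H] [InnerProductSpace ℂ H]
    [NormedAddCommGroup K] [InnerProductSpace ℂ K] : Type _ :=
  UniformSpace.Completion (H ⊗[ℂ] K)

variable {H K : Type*} [NormedAddCommGroup H] [InnerProductSpace ℂ H]
  [NormedAddCommGroup K] [InnerProductSpace ℂ K]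

instance : NormedAddCommGroup (HTensor H K) :=
  inferInstanceAs (NormedAddCommGroup (UniformSpace.Completion (H ⊗[ℂ] K)))

instance : InnerProductSpace ℂ (HTensor H K) :=
  inferInstanceAs (InnerProductSpace ℂ (UniformSpace.Completion (H ⊗[ℂ] K)))

instance : CompleteSpace (HTensor H K) :=
  inferInstanceAs (CompleteSpace (UniformSpace.Completion (H ⊗[ℂ] K)))

/-- The inclusion of the algebraic tensor product into the Hilbert space tensor product. -/
def HTensor.incl : H ⊗[ℂ] K →ₗᵢ[ℂ] HTensor H K :=
  UniformSpace.Completion.toComplₗᵢ (𝕜 := ℂ) (E := H ⊗[ℂ] K)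

theorem HTensor.induction {p : HTensor H K → Prop} (v : HTensor H K) (hp : IsClosed {v | p v})
    (h : ∀ v : H ⊗[ℂ] K, p (HTensor.incl v)) : p v :=
  UniformSpace.Completion.induction_on v hp h

/-- The operator `S ⊗ T` on the Hilbert space tensor product. -/
def opTensor (S : H →L[ℂ] H) (T : K →L[ℂ] K) : HTensor H K →L[ℂ] HTensor H K :=
  (TensorProduct.mapL S T).completion

theorem opTensor_incl (S : H →L[ℂ] H) (T : K →L[ℂ] K) (v : H ⊗[ℂ] K) :
    opTensor S T (HTensor.incl v) = HTensor.incl (TensorProduct.mapL S T v) :=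
  ContinuousLinearMap.completion_apply_coe _ _

theorem op_ext {S T : HTensor H K →L[ℂ] HTensor H K}
    (h : ∀ v : H ⊗[ℂ] K, S (HTensor.incl v) = T (HTensor.incl v)) : S = T :=
  ContinuousLinearMap.ext fun v =>
    HTensor.induction v (isClosed_eq S.continuous T.continuous) h

theorem opTensor_mul (S S' : H →L[ℂ] H) (T T' : K →L[ℂ] K) :
    opTensor (S * S') (T * T') = opTensor S T * opTensor S' T' :=
  op_ext fun v => by
    rw [mul_apply_eq_comp, opTensor_incl, opTensor_incl, opTensor_incl, TensorProduct.mapL_mul,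
      mul_apply_eq_comp]

theorem opTensor_one : opTensor (1 : H →L[ℂ] H) (1 : K →L[ℂ] K) = 1 :=
  op_ext fun v => by
    rw [opTensor_incl, ContinuousLinearMap.one_def, ContinuousLinearMap.one_def,
      TensorProduct.mapL_id_id]; rfl

theorem norm_opTensor_le (S : H →L[ℂ] H) (T : K →L[ℂ] K) : ‖opTensor S T‖ ≤ ‖S‖ * ‖T‖ := by
  refine ContinuousLinearMap.opNorm_le_bound _ (by positivity) fun v => ?_
  refine HTensor.induction v
    (isClosed_le (opTensor S T).continuous.norm (continuous_const.mul continuous_norm)) fun v => ?_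
  change ‖opTensor S T (HTensor.incl v)‖ ≤ ‖S‖ * ‖T‖ * ‖HTensor.incl v‖
  rw [opTensor_incl, LinearIsometry.norm_map, LinearIsometry.norm_map]
  exact (ContinuousLinearMap.le_opNorm _ _).trans
    (mul_le_mul_of_nonneg_right (TensorProduct.norm_mapL_le S T) (norm_nonneg _))

/-- `S ⊗ T` as a bilinear map of `S` and `T`. -/
def opTensorₗ : (H →L[ℂ] H) →ₗ[ℂ] (K →L[ℂ] K) →ₗ[ℂ] (HTensor H K →L[ℂ] HTensor H K) :=
  LinearMap.mk₂ ℂ opTensor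
    (fun S S' T => op_ext fun v => by
      simp only [opTensor_incl, TensorProduct.mapL_add_left, add_apply, map_add])
    (fun c S T => op_ext fun v => by
      simp only [opTensor_incl, TensorProduct.mapL_smul_left, smul_apply, map_smul])
    (fun S T T' => op_ext fun v => by
      simp only [opTensor_incl, TensorProduct.mapL_add_right, add_apply, map_add])
    (fun c S T => op_ext fun v => by
      simp only [opTensor_incl, TensorProduct.mapL_smul_right, smul_apply, map_smul])

/-- The algebra map `B(H) ⊗ B(K) → B(H ⊗ K)`. -/
def opTensorHom : (H →L[ℂ] H) ⊗[ℂ] (K →L[ℂ] K) →ₐ[ℂ] (HTensor H K →L[ℂ] HTensor H K) :=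
  Algebra.TensorProduct.algHomOfLinearMapTensorProduct (TensorProduct.lift opTensorₗ)
    (fun S S' T T' => opTensor_mul S S' T T') opTensor_one

theorem star_opTensor [CompleteSpace H] [CompleteSpace K] (S : H →L[ℂ] H) (T : K →L[ℂ] K) :
    star (opTensor S T) = opTensor (star S) (star T) := by
  symm
  rw [ContinuousLinearMap.star_eq_adjoint (opTensor S T), ContinuousLinearMap.eq_adjoint_iff]
  intro v w
  refine HTensor.induction v (isClosed_eq
    (Continuous.inner (opTensor (star S) (star T)).continuous continuous_const)
    (Continuous.inner continuous_id continuous_const)) fun v => ?_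
  refine HTensor.induction w (isClosed_eq
    (Continuous.inner continuous_const continuous_id)
    (Continuous.inner continuous_const (opTensor S T).continuous)) fun w => ?_
  rw [opTensor_incl, opTensor_incl, id, id, LinearIsometry.inner_map_map, LinearIsometry.inner_map_map]
  induction v with
  | zero => simp
  | add v v' hv hv' => rw [map_add, inner_add_left, inner_add_left, hv, hv']
  | tmul v₁ v₂ =>
    induction w with
    | zero => simp
    | add w w' hw hw' => rw [map_add, inner_add_right, inner_add_right, hw, hw']
    | tmul w₁ w₂ =>
      simp [ContinuousLinearMap.star_eq_adjoint, ContinuousLinearMap.adjoint_inner_left]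

instance [Nontrivial H] [Nontrivial K] : Nontrivial (HTensor H K) := by
  obtain ⟨v, hv⟩ := exists_ne (0 : H)
  obtain ⟨w, hw⟩ := exists_ne (0 : K)
  refine ⟨⟨HTensor.incl (v ⊗ₜ[ℂ] w), 0, fun h => ?_⟩⟩
  have := congrArg norm h
  simp [hv, hw] at this

/-- The operator `K → H ⊗ K`, `v ↦ ξ ⊗ v`. -/
def insertL (ξ : H) : K →L[ℂ] HTensor H K :=
  HTensor.incl.toContinuousLinearMap.comp (TensorProduct.mkL ℂ H K ξ)

theorem insertL_apply (ξ : H) (v : K) : (insertL ξ v : HTensor H K) = HTensor.incl (ξ ⊗ₜ[ℂ] v) :=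
  rfl

theorem insertL_add (ξ ξ' : H) :
    (insertL (ξ + ξ') : K →L[ℂ] HTensor H K) = insertL ξ + insertL ξ' := by
  ext v
  rw [add_apply, insertL_apply, insertL_apply, insertL_apply, TensorProduct.add_tmul, map_add]

theorem insertL_smul (c : ℂ) (ξ : H) :
    (insertL (c • ξ) : K →L[ℂ] HTensor H K) = c • insertL ξ := by
  ext v
  rw [smul_apply, insertL_apply, insertL_apply, ← TensorProduct.smul_tmul', map_smul]

theorem norm_insertL_le (ξ : H) : ‖(insertL ξ : K →L[ℂ] HTensor H K)‖ ≤ ‖ξ‖ :=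
  ContinuousLinearMap.opNorm_le_bound _ (norm_nonneg _) fun v => by
    rw [insertL_apply, LinearIsometry.norm_map, TensorProduct.norm_tmul]

variable [CompleteSpace K]

/-- The slice of an operator on `H ⊗ K` by the functional `⟪ξ, · η⟫` in the first leg. -/
def sliceVec (ξ η : H) (Z : HTensor H K →L[ℂ] HTensor H K) : K →L[ℂ] K :=
  (ContinuousLinearMap.adjoint (insertL ξ)).comp (Z.comp (insertL η))

theorem inner_sliceVec (ξ η : H) (Z : HTensor H K →L[ℂ] HTensor H K) (v w : K) :
    ⟪v, sliceVec ξ η Z w⟫_ℂ = ⟪(insertL ξ v : HTensor H K), Z (insertL η w)⟫_ℂ :=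
  ContinuousLinearMap.adjoint_inner_right (insertL ξ) v (Z (insertL η w))

theorem norm_sliceVec_le (ξ η : H) (Z : HTensor H K →L[ℂ] HTensor H K) :
    ‖sliceVec ξ η Z‖ ≤ ‖ξ‖ * ‖η‖ * ‖Z‖ := by
  have h1 : ‖ContinuousLinearMap.adjoint (insertL ξ : K →L[ℂ] HTensor H K)‖ ≤ ‖ξ‖ := by
    rw [LinearIsometryEquiv.norm_map]; exact norm_insertL_le ξ
  have h2 : ‖Z.comp (insertL η : K →L[ℂ] HTensor H K)‖ ≤ ‖Z‖ * ‖η‖ :=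
    (ContinuousLinearMap.opNorm_comp_le _ _).trans (by gcongr; exact norm_insertL_le η)
  calc ‖sliceVec ξ η Z‖ ≤ _ := ContinuousLinearMap.opNorm_comp_le _ _
    _ ≤ ‖ξ‖ * (‖Z‖ * ‖η‖) := by gcongr
    _ = ‖ξ‖ * ‖η‖ * ‖Z‖ := by ring

theorem sliceVec_opTensor (ξ η : H) (S : H →L[ℂ] H) (T : K →L[ℂ] K) :
    sliceVec ξ η (opTensor S T) = ⟪ξ, S η⟫_ℂ • T := by
  ext w
  refine ext_inner_left ℂ fun v => ?_
  rw [inner_sliceVec, insertL_apply, insertL_apply, opTensor_incl, LinearIsometry.inner_map_map,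
    TensorProduct.mapL_tmul, TensorProduct.inner_tmul, smul_apply, inner_smul_right]

theorem sliceVec_add (ξ η : H) (Z Z' : HTensor H K →L[ℂ] HTensor H K) :
    sliceVec ξ η (Z + Z') = sliceVec ξ η Z + sliceVec ξ η Z' := by
  rw [sliceVec, ContinuousLinearMap.add_comp, ContinuousLinearMap.comp_add]; rfl

theorem sliceVec_smul (c : ℂ) (ξ η : H) (Z : HTensor H K →L[ℂ] HTensor H K) :
    sliceVec ξ η (c • Z) = c • sliceVec ξ η Z := by
  rw [sliceVec, ContinuousLinearMap.smul_comp, ContinuousLinearMap.comp_smul]; rfl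

theorem sliceVec_add_left (ξ ξ' η : H) (Z : HTensor H K →L[ℂ] HTensor H K) :
    sliceVec (ξ + ξ') η Z = sliceVec ξ η Z + sliceVec ξ' η Z := by
  rw [sliceVec, insertL_add, map_add, ContinuousLinearMap.add_comp]; rfl

theorem sliceVec_smul_left (c : ℂ) (ξ η : H) (Z : HTensor H K →L[ℂ] HTensor H K) :
    sliceVec (c • ξ) η Z = star c • sliceVec ξ η Z := by
  rw [sliceVec, insertL_smul, map_smulₛₗ, ContinuousLinearMap.smul_comp]; rfl

theorem sliceVec_add_right (ξ η η' : H) (Z : HTensor H K →L[ℂ] HTensor H K) :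
    sliceVec ξ (η + η') Z = sliceVec ξ η Z + sliceVec ξ η' Z := by
  rw [sliceVec, insertL_add, ContinuousLinearMap.comp_add, ContinuousLinearMap.comp_add]; rfl

theorem sliceVec_smul_right (c : ℂ) (ξ η : H) (Z : HTensor H K →L[ℂ] HTensor H K) :
    sliceVec ξ (c • η) Z = c • sliceVec ξ η Z := by
  rw [sliceVec, insertL_smul, ContinuousLinearMap.comp_smul, ContinuousLinearMap.comp_smul]; rfl

end HilbertTensor

/-- The tensor product of two representations, with
`a ↦ a ⊗ a - q b* ⊗ b` and `b ↦ b ⊗ a + a* ⊗ b`. -/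
def Rep.prod {q : ℝ} (r s : Rep q) : Rep q where
  H := HTensor r.H s.H
  a := opTensor r.a s.a - (q : ℂ) • opTensor (star r.b) s.b
  b := opTensor r.b s.a + opTensor (star r.a) s.b
  rel := by
    have h := (r.rel.tensor s.rel).map opTensorHom
    simp only [map_add, map_sub, map_smul] at h
    change Relations q (opTensor r.a s.a - (q : ℂ) • opTensor (star r.b) s.b)
      (opTensor (star r.a) (star s.a) - (q : ℂ) • opTensor r.b (star s.b))
      (opTensor r.b s.a + opTensor (star r.a) s.b)
      (opTensor (star r.b) (star s.a) + opTensor r.a (star s.b)) at h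
    simpa only [star_add, star_sub, star_smul, star_opTensor, star_star, Complex.star_def,
      Complex.conj_ofReal] using h

/-- The generator `a` as a family. -/
def genA (q : ℝ) : Ambient q :=
  .mk (fun r => r.a) 1 fun r => norm_le_one_of_rel r.rel.aa'

/-- The generator `b` as a family. -/
def genB (q : ℝ) : Ambient q :=
  .mk (fun r => r.b) 1 fun r => norm_le_one_of_rel ((add_comm _ _).trans r.rel.aa')

/-- The universal unital C*-algebra generated by `a` and `b` subject to the relations. It is
realised in the universal way: the norm of a *-polynomial in `a` and `b` is the supremum of its
norms over all representations of the relations on Hilbert spaces. -/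
def suqAlg (q : ℝ) : StarSubalgebra ℂ (Ambient q) :=
  (StarAlgebra.adjoin ℂ {genA q, genB q}).topologicalClosure

instance (q : ℝ) : IsClosed (suqAlg q : Set (Ambient q)) :=
  StarSubalgebra.isClosed_topologicalClosure _

/-- The C*-algebra `C(SU_q(2))`. -/
abbrev CSUq (q : ℝ) : Type 1 := suqAlg q

/-- The generator `a` of `C(SU_q(2))`. -/
def gena (q : ℝ) : CSUq q := ⟨genA q, StarSubalgebra.le_topologicalClosure _
  (StarAlgebra.subset_adjoin ℂ _ (by simp))⟩

/-- The generator `b` of `C(SU_q(2))`. -/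
def genb (q : ℝ) : CSUq q := ⟨genB q, StarSubalgebra.le_topologicalClosure _
  (StarAlgebra.subset_adjoin ℂ _ (by simp))⟩

theorem suqAlg_le {q : ℝ} {S : StarSubalgebra ℂ (Ambient q)} (hS : IsClosed (S : Set (Ambient q)))
    (ha : genA q ∈ S) (hb : genB q ∈ S) : suqAlg q ≤ S :=
  StarSubalgebra.topologicalClosure_minimal
    (StarAlgebra.adjoin_le (by rintro _ (rfl | rfl) <;> assumption)) hS

/-- Bounded families of operators on `H_r ⊗ H_s`, indexed by pairs `(r, s)` of representations. -/
abbrev AmbientTensor (q : ℝ) : Type 1 :=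
  OpFamily (fun p : Rep q × Rep q => (p.1.prod p.2).H)

/-- The elementary tensor `x ⊗ y`, acting on `H_r ⊗ H_s` by `x(r) ⊗ y(s)`. -/
def elemTensor {q : ℝ} (x y : CSUq q) : AmbientTensor q :=
  .mk (fun p => (opTensor (eval p.1 x.1) (eval p.2 y.1) :)) (‖x‖ * ‖y‖) fun p =>
    (norm_opTensor_le _ _).trans
      (mul_le_mul (norm_eval_le x.1 p.1) (norm_eval_le y.1 p.2) (norm_nonneg _) (norm_nonneg _))

/-- The minimal (spatial) tensor product `C(SU_q(2)) ⊗_min C(SU_q(2))`, formed in the faithful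
representation of `C(SU_q(2))` given by the family of all representations. -/
def minTensor (q : ℝ) : StarSubalgebra ℂ (AmbientTensor q) :=
  (StarAlgebra.adjoin ℂ
    (Set.range fun p : CSUq q × CSUq q => elemTensor p.1 p.2)).topologicalClosure

instance (q : ℝ) : IsClosed (minTensor q : Set (AmbientTensor q)) :=
  StarSubalgebra.isClosed_topologicalClosure _

theorem elemTensor_mem {q : ℝ} (x y : CSUq q) : elemTensor x y ∈ minTensor q :=
  StarSubalgebra.le_topologicalClosure _ (StarAlgebra.subset_adjoin ℂ _ ⟨(x, y), rfl⟩)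

/-- Evaluation of a family at tensor products of representations. -/
def comulAmbient (q : ℝ) : Ambient q →⋆ₐ[ℂ] AmbientTensor q :=
  reindex fun p : Rep q × Rep q => p.1.prod p.2

theorem comulAmbient_mem {q : ℝ} (x : CSUq q) : comulAmbient q x ∈ minTensor q := by
  suffices h : suqAlg q ≤ (minTensor q).comap (comulAmbient q) from h x.2
  refine suqAlg_le ((StarSubalgebra.isClosed_topologicalClosure _).preimage
    (continuous_reindex _)) ?_ ?_
  · have : comulAmbient q (genA q) = elemTensor (gena q) (gena q) -
        (q : ℂ) • elemTensor (star (genb q)) (genb q) := rfl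
    rw [StarSubalgebra.mem_comap, this]
    exact sub_mem (elemTensor_mem _ _) (SMulMemClass.smul_mem _ (elemTensor_mem _ _))
  · have : comulAmbient q (genB q) = elemTensor (genb q) (gena q) +
        elemTensor (star (gena q)) (genb q) := rfl
    rw [StarSubalgebra.mem_comap, this]
    exact add_mem (elemTensor_mem _ _) (elemTensor_mem _ _)

/-- The comultiplication `Δ : C(SU_q(2)) → C(SU_q(2)) ⊗_min C(SU_q(2))`, the unital
*-homomorphism with `Δ(a) = a ⊗ a - q b* ⊗ b` and `Δ(b) = b ⊗ a + a* ⊗ b`. -/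
def comul (q : ℝ) : CSUq q →⋆ₐ[ℂ] minTensor q :=
  ((comulAmbient q).comp (suqAlg q).subtype).codRestrict (minTensor q) comulAmbient_mem

/-- The representation `(z a, z b)`. -/
def Rep.rotate {q : ℝ} (z : Circle) (r : Rep q) : Rep q where
  H := r.H
  a := (z : ℂ) • r.a
  b := (z : ℂ) • r.b
  rel := by
    have hz : (z : ℂ) * star (z : ℂ) = 1 := by
      rw [Complex.star_def, Complex.mul_conj, Circle.normSq_coe, Complex.ofReal_one]
    have hz' : star (z : ℂ) * (z : ℂ) = 1 := by rw [mul_comm, hz]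
    have h := r.rel
    constructor <;> simp only [star_smul, smul_mul_smul_comm, hz, hz', one_smul] 
    · rw [h.ba, smul_comm]
    · exact h.b'a
    · exact h.bb'
    · rw [h.a'b', smul_comm]
    · exact h.a'b
    · exact h.a'a
    · exact h.aa'

/-- Evaluation of a family at rotated representations. -/
def rotateAmbient (q : ℝ) (z : Circle) : Ambient q →⋆ₐ[ℂ] Ambient q :=
  reindex fun r : Rep q => r.rotate z

theorem rotateAmbient_mem {q : ℝ} (z : Circle) (x : CSUq q) : rotateAmbient q z x ∈ suqAlg q := by
  suffices h : suqAlg q ≤ (suqAlg q).comap (rotateAmbient q z) from h x.2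
  have hc : Continuous (rotateAmbient q z) := continuous_reindex fun r : Rep q => r.rotate z
  refine suqAlg_le ((StarSubalgebra.isClosed_topologicalClosure _).preimage hc) ?_ ?_
  · have : rotateAmbient q z (genA q) = (z : ℂ) • genA q := rfl
    rw [StarSubalgebra.mem_comap, this]
    exact SMulMemClass.smul_mem _ (gena q).2
  · have : rotateAmbient q z (genB q) = (z : ℂ) • genB q := rfl
    rw [StarSubalgebra.mem_comap, this]
    exact SMulMemClass.smul_mem _ (genb q).2

/-- The circle action `σ_z` on `C(SU_q(2))`, with `σ_z(a) = z a` and `σ_z(b) = z b`. -/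
def circleAction (q : ℝ) (z : Circle) : CSUq q →⋆ₐ[ℂ] CSUq q :=
  ((rotateAmbient q z).comp (suqAlg q).subtype).codRestrict (suqAlg q) (rotateAmbient_mem z)

/-- The Podleś sphere `C(S_q^2)`: the fixed point algebra of the circle action. -/
def sphere (q : ℝ) : StarSubalgebra ℂ (CSUq q) :=
  ⨅ z : Circle, StarAlgHom.equalizer (circleAction q z) (StarAlgHom.id ℂ (CSUq q))

/-- The one-dimensional representation `a ↦ 1`, `b ↦ 0`. -/
def Rep.triv (q : ℝ) : Rep q where
  H := ℂ
  a := 1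
  b := 0
  rel := by constructor <;> simp

/-- Evaluation at the one-dimensional representation `a ↦ 1`, `b ↦ 0`. -/
def evalTriv {q : ℝ} (x : CSUq q) : ℂ →L[ℂ] ℂ := eval (Rep.triv q) x.1

/-- The counit, the character of `C(SU_q(2))` with `ε(a) = 1` and `ε(b) = 0`. -/
def counit (q : ℝ) : CSUq q →⋆ₐ[ℂ] ℂ where
  toFun x := evalTriv x 1
  map_one' := rfl
  map_mul' x y := by
    have h : evalTriv (x * y) = evalTriv x * evalTriv y := rfl
    rw [h, mul_apply_eq_comp]
    conv_lhs => rw [← mul_one (evalTriv y 1), ← smul_eq_mul, map_smul]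
    rw [smul_eq_mul, mul_comm]
  map_zero' := rfl
  map_add' _ _ := rfl
  commutes' c := by
    have h : evalTriv (algebraMap ℂ (CSUq q) c) = c • (1 : ℂ →L[ℂ] ℂ) := rfl
    simp [h]
  map_star' x := by
    have h : evalTriv (star x) = ContinuousLinearMap.adjoint (evalTriv x) := rfl
    have h' := congrArg star (ContinuousLinearMap.adjoint_inner_left (evalTriv x) 1 1)
    rw [h]
    simpa using h'



/-- The slice by the vector functional `x ↦ ⟪ξ, x(r) η⟫` in the first leg. -/
def sliceAmbient {q : ℝ} (r : Rep q) (ξ η : r.H) : AmbientTensor q →L[ℂ] Ambient q :=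
  LinearMap.mkContinuous
    { toFun := fun z => OpFamily.mk (fun s => sliceVec (K := s.H) ξ η (eval (r, s) z))
        (‖ξ‖ * ‖η‖ * ‖z‖) fun s => (norm_sliceVec_le ξ η _).trans
          (mul_le_mul_of_nonneg_left (norm_eval_le z (r, s)) (by positivity))
      map_add' := fun z w => OpFamily.ext fun s => by
        rw [map_add, eval_mk, eval_mk, eval_mk, map_add]
        exact sliceVec_add (K := s.H) ξ η _ _
      map_smul' := fun c z => OpFamily.ext fun s => by
        rw [map_smul, eval_mk, eval_mk, map_smul]
        exact sliceVec_smul (K := s.H) c ξ η _ }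
    (‖ξ‖ * ‖η‖) fun z => OpFamily.norm_le (by positivity) fun s =>
      (norm_sliceVec_le ξ η _).trans
          (mul_le_mul_of_nonneg_left (norm_eval_le z (r, s)) (by positivity))

theorem norm_sliceAmbient_le {q : ℝ} (r : Rep q) (ξ η : r.H) :
    ‖sliceAmbient r ξ η‖ ≤ ‖ξ‖ * ‖η‖ := LinearMap.mkContinuous_norm_le _ (by positivity) _

theorem sliceAmbient_elem {q : ℝ} (r : Rep q) (ξ η : r.H) (x y : CSUq q) :
    sliceAmbient r ξ η (elemTensor x y) = ⟪ξ, eval r x.1 η⟫_ℂ • (y : Ambient q) :=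
  OpFamily.ext fun s => sliceVec_opTensor (K := s.H) ξ η (eval r x.1) (eval s y.1)

theorem minTensor_induction {q : ℝ} (M : Submodule ℂ (AmbientTensor q))
    (hM : IsClosed (M : Set (AmbientTensor q))) (h : ∀ x y : CSUq q, elemTensor x y ∈ M)
    {z : AmbientTensor q} (hz : z ∈ minTensor q) : z ∈ M := by
  have key : ∀ w ∈ StarAlgebra.adjoin ℂ
      (Set.range fun p : CSUq q × CSUq q => elemTensor p.1 p.2), w ∈ M := by
    intro w hw
    let N : Submonoid (AmbientTensor q) :=
      { carrier := Set.range fun p : CSUq q × CSUq q => elemTensor p.1 p.2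
        one_mem' := ⟨(1, 1), OpFamily.ext fun p => opTensor_one⟩
        mul_mem' := by
          rintro _ _ ⟨p, rfl⟩ ⟨p', rfl⟩
          exact ⟨(p.1 * p'.1, p.2 * p'.2), OpFamily.ext fun i => opTensor_mul _ _ _ _⟩ }
    rw [← StarSubalgebra.mem_toSubalgebra, ← Subalgebra.mem_toSubmodule,
      StarAlgebra.adjoin_eq_span] at hw
    refine Submodule.span_le.2 (fun u hu => ?_) hw
    have hu' : u ∈ N := by
      refine (Submonoid.closure_le.2 ?_ : _ ≤ N) hu
      rintro v (hv | ⟨p, hp⟩)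
      · exact hv
      · refine ⟨(star p.1, star p.2), ?_⟩
        rw [← star_star v, ← hp]
        exact OpFamily.ext fun i => (star_opTensor _ _).symm
    obtain ⟨p, rfl⟩ := hu'
    exact h p.1 p.2
  exact closure_minimal key hM hz

theorem sliceAmbient_mem {q : ℝ} (r : Rep q) (ξ η : r.H) (z : minTensor q) :
    sliceAmbient r ξ η z ∈ suqAlg q := by
  refine minTensor_induction ((suqAlg q).toSubalgebra.toSubmodule.comap
    (sliceAmbient r ξ η).toLinearMap) ?_ ?_ z.2
  · exact (StarSubalgebra.isClosed_topologicalClosure _ : IsClosed (suqAlg q : Set (Ambient q))).preimage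
      (sliceAmbient r ξ η).continuous
  · intro x y
    change sliceAmbient r ξ η (elemTensor x y) ∈ suqAlg q
    rw [sliceAmbient_elem]
    exact SMulMemClass.smul_mem _ y.2

/-- The slice `(⟪ξ, · η⟫ ⊗ 1)(z) ∈ C(SU_q(2))` by a vector functional of the representation `r`. -/
def vecSlice {q : ℝ} (r : Rep q) (ξ η : r.H) (z : minTensor q) : CSUq q :=
  ⟨sliceAmbient r ξ η z, sliceAmbient_mem r ξ η z⟩

theorem norm_vecSlice_le {q : ℝ} (r : Rep q) (ξ η : r.H) (z : minTensor q) :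
    ‖vecSlice r ξ η z‖ ≤ ‖ξ‖ * ‖η‖ * ‖z‖ :=
  ContinuousLinearMap.le_of_opNorm_le _ (norm_sliceAmbient_le r ξ η) _

/-- The sesquilinear form `(ξ, η) ↦ φ((⟪ξ, · η⟫ ⊗ 1)(z))` on `H_r`. -/
def sliceForm {q : ℝ} (φ : CSUq q →L[ℂ] ℂ) (z : minTensor q) (r : Rep q) :
    r.H →L⋆[ℂ] r.H →L[ℂ] ℂ :=
  LinearMap.mkContinuous₂
    (LinearMap.mk₂'ₛₗ (starRingEnd ℂ) (RingHom.id ℂ) (fun ξ η => φ (vecSlice r ξ η z))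
      (fun ξ ξ' η => by
        rw [← map_add]
        exact congrArg φ (Subtype.ext (OpFamily.ext fun s => sliceVec_add_left (K := s.H) ξ ξ' η _)))
      (fun c ξ η => by
        rw [← map_smul]
        exact congrArg φ (Subtype.ext (OpFamily.ext fun s => sliceVec_smul_left (K := s.H) c ξ η _)))
      (fun ξ η η' => by
        rw [← map_add]
        exact congrArg φ (Subtype.ext (OpFamily.ext fun s => sliceVec_add_right (K := s.H) ξ η η' _)))
      (fun c ξ η => by
        rw [← map_smul]
        exact congrArg φ (Subtype.ext (OpFamily.ext fun s => sliceVec_smul_right (K := s.H) c ξ η _))))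
    (‖φ‖ * ‖z‖) fun ξ η => by
      calc ‖φ (vecSlice r ξ η z)‖ ≤ ‖φ‖ * ‖vecSlice r ξ η z‖ := φ.le_opNorm _
        _ ≤ ‖φ‖ * (‖ξ‖ * ‖η‖ * ‖z‖) := by
          gcongr; exact norm_vecSlice_le r ξ η z
        _ = ‖φ‖ * ‖z‖ * ‖ξ‖ * ‖η‖ := by ring

/-- The operator on `H_r` with `⟪ξ, sliceOp φ z r η⟫ = φ((⟪ξ, · η⟫ ⊗ 1)(z))`. -/
def sliceOp {q : ℝ} (φ : CSUq q →L[ℂ] ℂ) (z : minTensor q) (r : Rep q) : r.H →L[ℂ] r.H :=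
  ContinuousLinearMap.adjoint (InnerProductSpace.continuousLinearMapOfBilin (sliceForm φ z r))

theorem inner_sliceOp {q : ℝ} (φ : CSUq q →L[ℂ] ℂ) (z : minTensor q) (r : Rep q) (ξ η : r.H) :
    ⟪ξ, sliceOp φ z r η⟫_ℂ = φ (vecSlice r ξ η z) := by
  rw [sliceOp, ContinuousLinearMap.adjoint_inner_right,
    InnerProductSpace.continuousLinearMapOfBilin_apply]
  rfl

theorem norm_sliceOp_le {q : ℝ} (φ : CSUq q →L[ℂ] ℂ) (z : minTensor q) (r : Rep q) :
    ‖sliceOp φ z r‖ ≤ ‖φ‖ * ‖z‖ := by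
  refine ContinuousLinearMap.opNorm_le_bound _ (by positivity) fun v => ?_
  rcases eq_or_ne (sliceOp φ z r v) 0 with h | h
  · rw [h, norm_zero]; positivity
  refine le_of_mul_le_mul_left ?_ (norm_pos_iff.2 h)
  calc ‖sliceOp φ z r v‖ * ‖sliceOp φ z r v‖ = ‖⟪sliceOp φ z r v, sliceOp φ z r v⟫_ℂ‖ := by
        rw [inner_self_eq_norm_sq_to_K]; simp [sq]
    _ = ‖φ (vecSlice r (sliceOp φ z r v) v z)‖ := by rw [inner_sliceOp]
    _ ≤ ‖φ‖ * ‖vecSlice r (sliceOp φ z r v) v z‖ := φ.le_opNorm _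
    _ ≤ ‖φ‖ * (‖sliceOp φ z r v‖ * ‖v‖ * ‖z‖) := by gcongr; exact norm_vecSlice_le r _ _ z
    _ = ‖sliceOp φ z r v‖ * (‖φ‖ * ‖z‖ * ‖v‖) := by ring

theorem sliceOp_add {q : ℝ} (φ : CSUq q →L[ℂ] ℂ) (z w : minTensor q) (r : Rep q) :
    sliceOp φ (z + w) r = sliceOp φ z r + sliceOp φ w r := by
  ext v
  refine ext_inner_left ℂ fun u => ?_
  rw [add_apply, inner_add_right, inner_sliceOp, inner_sliceOp, inner_sliceOp, ← map_add]
  exact congrArg φ (Subtype.ext (map_add (sliceAmbient r u v) (z : AmbientTensor q) w))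

theorem sliceOp_smul {q : ℝ} (φ : CSUq q →L[ℂ] ℂ) (c : ℂ) (z : minTensor q) (r : Rep q) :
    sliceOp φ (c • z) r = c • sliceOp φ z r := by
  ext v
  refine ext_inner_left ℂ fun u => ?_
  rw [smul_apply, inner_smul_right, inner_sliceOp, inner_sliceOp, ← smul_eq_mul, ← map_smul]
  exact congrArg φ (Subtype.ext (map_smul (sliceAmbient r u v) c (z : AmbientTensor q)))

/-- The slice map `1 ⊗ φ` with values in families of operators. -/
def sliceMapAmbient {q : ℝ} (φ : CSUq q →L[ℂ] ℂ) : minTensor q →L[ℂ] Ambient q :=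
  LinearMap.mkContinuous
    { toFun := fun z => OpFamily.mk (sliceOp φ z) (‖φ‖ * ‖z‖) (norm_sliceOp_le φ z)
      map_add' := fun z w => OpFamily.ext fun r => sliceOp_add φ z w r
      map_smul' := fun c z => OpFamily.ext fun r => sliceOp_smul φ c z r }
    ‖φ‖ fun z => OpFamily.norm_le (by positivity) (norm_sliceOp_le φ z)

theorem sliceMapAmbient_elem {q : ℝ} (φ : CSUq q →L[ℂ] ℂ) (x y : CSUq q) :
    sliceMapAmbient φ ⟨elemTensor x y, elemTensor_mem x y⟩ = φ y • (x : Ambient q) := by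
  refine OpFamily.ext fun r => ?_
  rw [map_smul]
  ext v
  refine ext_inner_left ℂ fun u => ?_
  refine (inner_sliceOp φ _ r u v).trans ?_
  rw [smul_apply, inner_smul_right, mul_comm, ← smul_eq_mul, ← map_smul]
  exact congrArg φ (Subtype.ext (sliceAmbient_elem r u v x y))

theorem sliceMapAmbient_mem {q : ℝ} (φ : CSUq q →L[ℂ] ℂ) (z : minTensor q) :
    sliceMapAmbient φ z ∈ suqAlg q := by
  let P : Submodule ℂ (minTensor q) := (suqAlg q).toSubalgebra.toSubmodule.comap
    (sliceMapAmbient φ).toLinearMap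
  have hP : IsClosed (P : Set (minTensor q)) :=
    (StarSubalgebra.isClosed_topologicalClosure _ : IsClosed (suqAlg q : Set (Ambient q))).preimage
      (sliceMapAmbient φ).continuous
  have hz : (z : AmbientTensor q) ∈ P.map (minTensor q).toSubalgebra.toSubmodule.subtype := by
    refine minTensor_induction _ ?_ ?_ z.2
    · rw [Submodule.map_coe]
      exact (StarSubalgebra.isClosed_topologicalClosure _ :
        IsClosed (minTensor q : Set (AmbientTensor q))).isClosedMap_subtype_val _ hP
    · intro x y
      refine ⟨⟨elemTensor x y, elemTensor_mem x y⟩, ?_, rfl⟩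
      change sliceMapAmbient φ ⟨elemTensor x y, elemTensor_mem x y⟩ ∈ suqAlg q
      rw [sliceMapAmbient_elem]
      exact SMulMemClass.smul_mem _ x.2
  obtain ⟨w, hw, hwz⟩ := hz
  rwa [show z = w from Subtype.ext hwz.symm]

/-- The slice map `1 ⊗ φ : C(SU_q(2)) ⊗_min C(SU_q(2)) → C(SU_q(2))`, the bounded linear map
with `x ⊗ y ↦ φ(y) x`. -/
def slice {q : ℝ} (φ : CSUq q →L[ℂ] ℂ) : minTensor q →L[ℂ] CSUq q :=
  (sliceMapAmbient φ).codRestrict (suqAlg q).toSubalgebra.toSubmodule (sliceMapAmbient_mem φ)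

theorem slice_elem {q : ℝ} (φ : CSUq q →L[ℂ] ℂ) (x y : CSUq q) :
    slice φ ⟨elemTensor x y, elemTensor_mem x y⟩ = φ y • x :=
  Subtype.ext (sliceMapAmbient_elem φ x y)



instance (q : ℝ) : PartialOrder (CSUq q) := CStarAlgebra.spectralOrder (CSUq q)

instance (q : ℝ) : StarOrderedRing (CSUq q) := CStarAlgebra.spectralOrderedRing (CSUq q)

/-- A positive linear functional as a continuous linear functional. -/
def toCLM {q : ℝ} (h : CSUq q →ₚ[ℂ] ℂ) : CSUq q →L[ℂ] ℂ :=
  ⟨h.toLinearMap, map_continuous h⟩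

/-- A Haar state: a state `h` with `(1 ⊗ h)Δ(x) = h(x) 1 = (h ⊗ 1)Δ(x)`; both identities are
stated after applying an arbitrary bounded functional `ψ`, and `ψ ∘ (h ⊗ 1) = h ∘ (1 ⊗ ψ)`. -/
def IsHaarState {q : ℝ} (h : CSUq q →ₚ[ℂ] ℂ) : Prop :=
  h 1 = 1 ∧ ∀ (ψ : CSUq q →L[ℂ] ℂ) (x : CSUq q),
    ψ (slice (toCLM h) (comul q x)) = h x * ψ 1 ∧ h (slice ψ (comul q x)) = h x * ψ 1

instance (q : ℝ) : Nonempty (CSUq q →ₚ[ℂ] ℂ) := ⟨PositiveLinearMap.mk₀ 0 fun _ _ => le_rfl⟩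

/-- The Haar state of `C(SU_q(2))`: the (unique) bi-invariant state. -/
def haar (q : ℝ) : CSUq q →ₚ[ℂ] ℂ := Classical.epsilon IsHaarState

/-- The GNS Hilbert space `L²(SU_q(2))` of the Haar state. -/
def L2 (q : ℝ) : Type 1 := (haar q).GNS

instance (q : ℝ) : NormedAddCommGroup (L2 q) := inferInstanceAs (NormedAddCommGroup (haar q).GNS)

instance (q : ℝ) : InnerProductSpace ℂ (L2 q) := inferInstanceAs (InnerProductSpace ℂ (haar q).GNS)

instance (q : ℝ) : CompleteSpace (L2 q) := inferInstanceAs (CompleteSpace (haar q).GNS)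

/-- The canonical map `Λ : C(SU_q(2)) → L²(SU_q(2))`. -/
def gnsVec (q : ℝ) : CSUq q →ₗ[ℂ] L2 q :=
  (UniformSpace.Completion.toComplL (𝕜 := ℂ) (E := (haar q).PreGNS)).toLinearMap ∘ₗ
    (haar q).toPreGNS.toLinearMap

/-- The GNS representation of `C(SU_q(2))` on `L²(SU_q(2))`. -/
def gnsRep (q : ℝ) : CSUq q →⋆ₐ[ℂ] (L2 q →L[ℂ] L2 q) := (haar q).gnsStarAlgHom

theorem gnsRep_gnsVec (q : ℝ) (x y : CSUq q) : gnsRep q x (gnsVec q y) = gnsVec q (x * y) :=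
  (haar q).gnsNonUnitalStarAlgHom_apply_coe

/-- The generators `a, a*, b, b*` of the coordinate algebra. -/
inductive Gen : Type
  | a | a' | b | b'

open FreeAlgebra in
/-- The relations of the coordinate algebra. -/
inductive CoordRel (q : ℝ) : FreeAlgebra ℂ Gen → FreeAlgebra ℂ Gen → Prop
  | ba : CoordRel q (ι ℂ Gen.b * ι ℂ Gen.a) ((q : ℂ) • (ι ℂ Gen.a * ι ℂ Gen.b))
  | b'a : CoordRel q (ι ℂ Gen.b' * ι ℂ Gen.a) ((q : ℂ) • (ι ℂ Gen.a * ι ℂ Gen.b'))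
  | bb' : CoordRel q (ι ℂ Gen.b * ι ℂ Gen.b') (ι ℂ Gen.b' * ι ℂ Gen.b)
  | a'b' : CoordRel q (ι ℂ Gen.a' * ι ℂ Gen.b') ((q : ℂ) • (ι ℂ Gen.b' * ι ℂ Gen.a'))
  | a'b : CoordRel q (ι ℂ Gen.a' * ι ℂ Gen.b) ((q : ℂ) • (ι ℂ Gen.b * ι ℂ Gen.a'))
  | a'a : CoordRel q (ι ℂ Gen.a' * ι ℂ Gen.a + (q : ℂ) ^ 2 • (ι ℂ Gen.b * ι ℂ Gen.b')) 1
  | aa' : CoordRel q (ι ℂ Gen.a * ι ℂ Gen.a' + ι ℂ Gen.b * ι ℂ Gen.b') 1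

/-- The coordinate algebra `𝒪(SU_q(2))`, presented by generators and relations. -/
def Coord (q : ℝ) : Type := RingQuot (CoordRel q)

instance (q : ℝ) : Ring (Coord q) := inferInstanceAs (Ring (RingQuot (CoordRel q)))

instance (q : ℝ) : Algebra ℂ (Coord q) := inferInstanceAs (Algebra ℂ (RingQuot (CoordRel q)))

/-- The generators of the coordinate algebra. -/
def Coord.gen (q : ℝ) (g : Gen) : Coord q :=
  RingQuot.mkAlgHom ℂ (CoordRel q) (FreeAlgebra.ι ℂ g)

theorem Coord.relations (q : ℝ) :
    Relations q (Coord.gen q .a) (Coord.gen q .a') (Coord.gen q .b) (Coord.gen q .b') where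
  ba := by have h := RingQuot.mkAlgHom_rel ℂ (CoordRel.ba (q := q)); simp only [map_mul, map_smul] at h; exact h
  b'a := by have h := RingQuot.mkAlgHom_rel ℂ (CoordRel.b'a (q := q)); simp only [map_mul, map_smul] at h; exact h
  bb' := by have h := RingQuot.mkAlgHom_rel ℂ (CoordRel.bb' (q := q)); simp only [map_mul] at h; exact h
  a'b' := by have h := RingQuot.mkAlgHom_rel ℂ (CoordRel.a'b' (q := q)); simp only [map_mul, map_smul] at h; exact h
  a'b := by have h := RingQuot.mkAlgHom_rel ℂ (CoordRel.a'b (q := q)); simp only [map_mul, map_smul] at h; exact h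
  a'a := by
    have h := RingQuot.mkAlgHom_rel ℂ (CoordRel.a'a (q := q))
    simp only [map_mul, map_smul, map_add, map_one] at h; exact h
  aa' := by
    have h := RingQuot.mkAlgHom_rel ℂ (CoordRel.aa' (q := q))
    simp only [map_mul, map_add, map_one] at h; exact h

/-- A function on the four generators. -/
def genMap {B : Type*} (a a' b b' : B) : Gen → B
  | .a => a
  | .a' => a'
  | .b => b
  | .b' => b'

/-- The algebra map out of the coordinate algebra determined by a quadruple satisfying the
relations. -/
def Coord.lift {q : ℝ} {B : Type*} [Ring B] [Algebra ℂ B] {a a' b b' : B}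
    (h : Relations q a a' b b') : Coord q →ₐ[ℂ] B :=
  RingQuot.liftAlgHom ℂ ⟨FreeAlgebra.lift ℂ (genMap a a' b b'), by
    intro x y hxy
    cases hxy <;> simp only [map_mul, map_smul, map_add, map_one, FreeAlgebra.lift_ι_apply, genMap]
    exacts [h.ba, h.b'a, h.bb', h.a'b', h.a'b, h.a'a, h.aa']⟩

theorem CSUq_relations (q : ℝ) :
    Relations q (gena q) (star (gena q)) (genb q) (star (genb q)) := by
  constructor <;> refine Subtype.ext (OpFamily.ext fun r => ?_)
  exacts [r.rel.ba, r.rel.b'a, r.rel.bb', r.rel.a'b', r.rel.a'b, r.rel.a'a, r.rel.aa']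

/-- The map `𝒪(SU_q(2)) → C(SU_q(2))`; its image is the unital *-subalgebra generated by `a`
and `b`. -/
def Coord.toCSUq (q : ℝ) : Coord q →ₐ[ℂ] CSUq q := Coord.lift (CSUq_relations q)

/-- The comultiplication of the coordinate algebra. -/
def Coord.comul (q : ℝ) : Coord q →ₐ[ℂ] Coord q ⊗[ℂ] Coord q :=
  Coord.lift ((Coord.relations q).tensor (Coord.relations q))

theorem sqrt_facts (q : Set.Ioc (0 : ℝ) 1) : ((√(q : ℝ) : ℝ) : ℂ) ≠ 0 ∧
    ((q : ℝ) : ℂ) = ((√(q : ℝ) : ℝ) : ℂ) ^ 2 := by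
  refine ⟨Complex.ofReal_ne_zero.2 (Real.sqrt_pos.2 q.2.1).ne', ?_⟩
  rw [← Complex.ofReal_pow, Real.sq_sqrt q.2.1.le]

/-- The algebra map `x ↦ (⟨k⁻¹, x⟩, ⟨e, x⟩; 0, ⟨k, x⟩)`. It encodes the pairing with the elements
`k` and `e` of the quantum enveloping algebra, whose coproducts are `Δ(k) = k ⊗ k` and
`Δ(e) = e ⊗ k + k⁻¹ ⊗ e`, with `⟨k, a⟩ = q^{1/2}`, `⟨k, a*⟩ = q^{-1/2}`, `⟨e, b⟩ = -q⁻¹`, the other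
values on generators being zero. -/
def pairMatE (q : Set.Ioc (0 : ℝ) 1) : Coord q →ₐ[ℂ] Matrix (Fin 2) (Fin 2) ℂ :=
  Coord.lift (a := !![((√(q : ℝ) : ℝ) : ℂ)⁻¹, 0; 0, (√(q : ℝ) : ℝ)])
    (a' := !![((√(q : ℝ) : ℝ) : ℂ), 0; 0, ((√(q : ℝ) : ℝ) : ℂ)⁻¹])
    (b := !![0, -((q : ℝ) : ℂ)⁻¹; 0, 0]) (b' := 0) (by
      obtain ⟨h0, hq⟩ := sqrt_facts q
      constructor <;> ext i j <;> fin_cases i <;> fin_cases j <;> simp [hq, h0] <;> field_simp)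

/-- The algebra map `x ↦ (⟨k⁻¹, x⟩, ⟨f, x⟩; 0, ⟨k, x⟩)`. It encodes the pairing with `k` and `f`,
where `Δ(f) = f ⊗ k + k⁻¹ ⊗ f` and `⟨f, b*⟩ = 1`, the values of `f` on the other generators
being zero. -/
def pairMatF (q : Set.Ioc (0 : ℝ) 1) : Coord q →ₐ[ℂ] Matrix (Fin 2) (Fin 2) ℂ :=
  Coord.lift (a := !![((√(q : ℝ) : ℝ) : ℂ)⁻¹, 0; 0, (√(q : ℝ) : ℝ)])
    (a' := !![((√(q : ℝ) : ℝ) : ℂ), 0; 0, ((√(q : ℝ) : ℝ) : ℂ)⁻¹])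
    (b := 0) (b' := !![0, 1; 0, 0]) (by
      obtain ⟨h0, hq⟩ := sqrt_facts q
      constructor <;> ext i j <;> fin_cases i <;> fin_cases j <;> simp [hq, h0] <;> field_simp)

/-- The linear functional `⟨e, ·⟩` on the coordinate algebra. -/
def pairE (q : Set.Ioc (0 : ℝ) 1) : Coord q →ₗ[ℂ] ℂ :=
  (Matrix.entryLinearMap ℂ ℂ 0 1).comp (pairMatE q).toLinearMap

/-- The linear functional `⟨f, ·⟩` on the coordinate algebra. -/
def pairF (q : Set.Ioc (0 : ℝ) 1) : Coord q →ₗ[ℂ] ℂ :=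
  (Matrix.entryLinearMap ℂ ℂ 0 1).comp (pairMatF q).toLinearMap

/-- The endomorphism `∂_η = (1 ⊗ ⟨η, ·⟩)Δ` of the coordinate algebra. -/
def leftAction {q : ℝ} (η : Coord q →ₗ[ℂ] ℂ) : Coord q →ₗ[ℂ] Coord q :=
  (TensorProduct.rid ℂ (Coord q)).toLinearMap ∘ₗ LinearMap.lTensor (Coord q) η ∘ₗ
    (Coord.comul q).toLinearMap

/-- The spectral subspaces `𝒜_n = {x ∈ 𝒪(SU_q(2)) | σ_z(x) = z^n x for all z}`. -/
def spectral (q : ℝ) (n : ℤ) : Submodule ℂ (Coord q) where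
  carrier := {x | ∀ z : Circle, circleAction q z (Coord.toCSUq q x) =
    (z : ℂ) ^ n • Coord.toCSUq q x}
  add_mem' hx hy z := by rw [map_add, map_add, hx z, hy z, smul_add]
  zero_mem' z := by rw [map_zero, map_zero, smul_zero]
  smul_mem' c x hx z := by rw [map_smul, map_smul, hx z, smul_comm]

/-- The closure `H_n` of `Λ(𝒜_n)` in `L²(SU_q(2))`; `H_+ = H_1` and `H_- = H_{-1}`. -/
def Hspec (q : ℝ) (n : ℤ) : Submodule ℂ (L2 q) :=
  ((spectral q n).map (gnsVec q ∘ₗ (Coord.toCSUq q).toLinearMap)).topologicalClosure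


theorem gnsVec_norm_le (q : ℝ) : ∃ C : ℝ, ∀ x : CSUq q, ‖gnsVec q x‖ ≤ C * ‖x‖ :=
  ⟨‖gnsVec q 1‖, fun x => by
    have h := gnsRep_gnsVec q x 1
    rw [mul_one] at h
    rw [← h, mul_comm]
    exact (ContinuousLinearMap.le_opNorm _ _).trans
      (mul_le_mul_of_nonneg_right (NonUnitalStarAlgHom.norm_apply_le (gnsRep q) x) (norm_nonneg _))⟩

theorem gnsVec_continuous (q : ℝ) : Continuous (gnsVec q) :=
  (LinearMap.mkContinuousOfExistsBound (gnsVec q) (gnsVec_norm_le q)).continuous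

theorem spectral_mul {q : ℝ} {n m : ℤ} {x y : Coord q} (hx : x ∈ spectral q n)
    (hy : y ∈ spectral q m) : x * y ∈ spectral q (n + m) := fun z => by
  rw [map_mul, map_mul, hx z, hy z, smul_mul_smul_comm, zpow_add₀ (Circle.coe_ne_zero z)]

theorem circleAction_a (q : ℝ) (z : Circle) : circleAction q z (gena q) = (z : ℂ) • gena q := rfl

theorem circleAction_b (q : ℝ) (z : Circle) : circleAction q z (genb q) = (z : ℂ) • genb q := rfl

theorem Coord.toCSUq_gen (q : ℝ) (g : Gen) : Coord.toCSUq q (Coord.gen q g) =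
    genMap (gena q) (star (gena q)) (genb q) (star (genb q)) g := by
  have : Coord.toCSUq q (Coord.gen q g) = FreeAlgebra.lift ℂ
      (genMap (gena q) (star (gena q)) (genb q) (star (genb q))) (FreeAlgebra.ι ℂ g) :=
    RingQuot.liftAlgHom_mkAlgHom_apply ..
  rw [this, FreeAlgebra.lift_ι_apply]

theorem gen_mem (q : ℝ) (g : Gen) : ∃ n, Coord.gen q g ∈ spectral q n := by
  have hs : ∀ z : Circle, star (z : ℂ) = (z : ℂ) ^ (-1 : ℤ) := fun z => by
    rw [zpow_neg_one, ← Circle.coe_inv, Circle.coe_inv_eq_conj]; rfl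
  cases g
  · exact ⟨1, fun z => by rw [Coord.toCSUq_gen, zpow_one]; exact circleAction_a q z⟩
  · exact ⟨-1, fun z => by
      rw [Coord.toCSUq_gen, genMap, map_star, circleAction_a, star_smul, hs]⟩
  · exact ⟨1, fun z => by rw [Coord.toCSUq_gen, zpow_one]; exact circleAction_b q z⟩
  · exact ⟨-1, fun z => by
      rw [Coord.toCSUq_gen, genMap, map_star, circleAction_b, star_smul, hs]⟩

theorem iSup_spectral_mul {q : ℝ} {u v : Coord q} (hu : u ∈ ⨆ n, spectral q n)
    (hv : v ∈ ⨆ n, spectral q n) : u * v ∈ ⨆ n, spectral q n := by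
  induction hu using Submodule.iSup_induction' with
  | mem n u hu =>
    induction hv using Submodule.iSup_induction' with
    | mem m v hv => exact Submodule.mem_iSup_of_mem _ (spectral_mul hu hv)
    | zero => rw [mul_zero]; exact zero_mem _
    | add v v' _ _ h h' => rw [mul_add]; exact add_mem h h'
  | zero => rw [zero_mul]; exact zero_mem _
  | add u u' _ _ h h' => rw [add_mul]; exact add_mem h h'

theorem iSup_spectral (q : ℝ) : ⨆ n, spectral q n = ⊤ := by
  rw [eq_top_iff]
  rintro x -
  obtain ⟨p, rfl⟩ := RingQuot.mkAlgHom_surjective ℂ (CoordRel q) x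
  induction p using FreeAlgebra.induction with
  | grade0 r =>
    refine Submodule.mem_iSup_of_mem 0 fun z => ?_
    rw [AlgHom.commutes, zpow_zero, one_smul]
    have : Coord.toCSUq q (algebraMap ℂ (Coord q) r) = algebraMap ℂ (CSUq q) r :=
      AlgHom.commutes _ r
    exact (congrArg _ this).trans ((AlgHomClass.commutes (circleAction q z) r).trans this.symm)
  | grade1 g =>
    obtain ⟨n, hn⟩ := gen_mem q g
    exact Submodule.mem_iSup_of_mem n hn
  | add x y hx hy => rw [map_add]; exact add_mem hx hy
  | mul x y hx hy =>
    rw [map_mul]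
    exact iSup_spectral_mul hx hy


/-- The discrete Fourier average `m⁻¹ ∑_{j < m} ζ^{-jn} σ_{ζ^j}`. -/
def average (q : ℝ) (m : ℕ) (ζ : Circle) (n : ℤ) : CSUq q →ₗ[ℂ] CSUq q :=
  (m : ℂ)⁻¹ • ∑ j ∈ Finset.range m, ((ζ ^ j : Circle) : ℂ) ^ (-n) •
    (circleAction q (ζ ^ j)).toAlgHom.toLinearMap

theorem average_apply (q : ℝ) (m : ℕ) (ζ : Circle) (n : ℤ) (x : CSUq q) :
    average q m ζ n x = (m : ℂ)⁻¹ • ∑ j ∈ Finset.range m, ((ζ ^ j : Circle) : ℂ) ^ (-n) •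
      circleAction q (ζ ^ j) x := by
  simp [average]

theorem norm_average_le (q : ℝ) (m : ℕ) (ζ : Circle) (n : ℤ) (x : CSUq q) :
    ‖average q m ζ n x‖ ≤ ‖x‖ := by
  rw [average_apply, norm_smul]
  have h : ‖∑ j ∈ Finset.range m, ((ζ ^ j : Circle) : ℂ) ^ (-n) • circleAction q (ζ ^ j) x‖ ≤
      m * ‖x‖ := by
    refine (norm_sum_le_of_le _ (n := fun _ => ‖x‖) fun j _ => ?_).trans (by simp)
    rw [norm_smul, norm_zpow, Circle.norm_coe, one_zpow, one_mul]
    exact NonUnitalStarAlgHom.norm_apply_le (circleAction q (ζ ^ j)) x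
  rcases Nat.eq_zero_or_pos m with rfl | hm
  · simp
  · have hm' : (0 : ℝ) < m := by exact_mod_cast hm
    rw [norm_inv, Complex.norm_natCast]
    calc (m : ℝ)⁻¹ * _ ≤ (m : ℝ)⁻¹ * (m * ‖x‖) := by gcongr
      _ = ‖x‖ := by field_simp

theorem average_eq {q : ℝ} {m : ℕ} {ζ : Circle} (n k : ℤ) {x : CSUq q}
    (hx : ∀ z : Circle, circleAction q z x = (z : ℂ) ^ k • x) :
    average q m ζ n x = ((m : ℂ)⁻¹ * ∑ j ∈ Finset.range m, (((ζ : ℂ) ^ (k - n)) ^ j)) • x := by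
  rw [average_apply, mul_smul, Finset.sum_smul]
  congr 1
  refine Finset.sum_congr rfl fun j _ => ?_
  rw [hx, smul_smul, ← zpow_add₀ (Circle.coe_ne_zero _), Circle.coe_pow, ← zpow_natCast,
    ← zpow_mul, ← zpow_natCast, ← zpow_mul]
  congr 2
  ring

theorem dense_coord {q : ℝ} (x : CSUq q) : x ∈ closure (Set.range (Coord.toCSUq q)) := by
  let f : Coord q →ₐ[ℂ] Ambient q := (suqAlg q).toSubalgebra.val.comp (Coord.toCSUq q)
  have hle : (StarAlgebra.adjoin ℂ {genA q, genB q} : Set (Ambient q)) ⊆ Set.range f := by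
    have h : (StarAlgebra.adjoin ℂ {genA q, genB q}).toSubalgebra ≤ f.range := by
      rw [StarAlgebra.adjoin_toSubalgebra, Algebra.adjoin_le_iff]
      have hf : ∀ g, f (Coord.gen q g) =
          (genMap (gena q) (star (gena q)) (genb q) (star (genb q)) g : CSUq q) :=
        fun g => congrArg Subtype.val (Coord.toCSUq_gen q g)
      rintro y ((rfl | rfl) | (hy | hy))
      · exact ⟨_, hf .a⟩
      · exact ⟨_, hf .b⟩
      · exact ⟨_, (hf .a').trans (by rw [← star_star y, hy]; rfl)⟩
      · exact ⟨_, (hf .b').trans (by rw [← star_star y, hy]; rfl)⟩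
    exact h
  rw [closure_subtype]
  refine closure_mono ?_ x.2
  intro y hy
  obtain ⟨p, rfl⟩ := hle hy
  exact ⟨_, ⟨p, rfl⟩, rfl⟩

theorem mem_closure_spectral {q : ℝ} {n : ℤ} {x : CSUq q}
    (hx : ∀ z : Circle, circleAction q z x = (z : ℂ) ^ n • x) :
    x ∈ closure (Coord.toCSUq q '' (spectral q n : Set (Coord q))) := by
  rw [Metric.mem_closure_iff]
  intro ε hε
  obtain ⟨_, ⟨p, rfl⟩, hp⟩ := Metric.mem_closure_iff.1 (dense_coord x) ε hε
  have hp' : p ∈ ⨆ k, spectral q k := by rw [iSup_spectral]; trivial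
  obtain ⟨f, hf, rfl⟩ := (Submodule.mem_iSup_iff_exists_finsupp _ _).1 hp'
  refine ⟨Coord.toCSUq q (f n), ⟨f n, hf n, rfl⟩, ?_⟩
  set m : ℕ := (∑ k ∈ f.support, (k - n).natAbs) + 1 with hm
  have hm0 : m ≠ 0 := by omega
  have hmC : (m : ℂ) ≠ 0 := by exact_mod_cast hm0
  set ζ : Circle := Circle.exp (2 * Real.pi / m) with hζ
  have hprim : IsPrimitiveRoot (ζ : ℂ) m := by
    have h := Complex.isPrimitiveRoot_exp m hm0
    rw [hζ, Circle.coe_exp]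
    convert h using 2
    push_cast
    ring
  have hdiag : ∀ y : CSUq q, (∀ z : Circle, circleAction q z y = (z : ℂ) ^ n • y) →
      average q m ζ n y = y := fun y hy => by
    rw [average_eq n n hy]
    simp [hmC]
  have hoff : ∀ k ∈ f.support, k ≠ n → average q m ζ n (Coord.toCSUq q (f k)) = 0 := by
    intro k hk hkn
    rw [average_eq n k (hf k)]
    have h1 : (ζ : ℂ) ^ (k - n) ≠ 1 := by
      rw [Ne, hprim.zpow_eq_one_iff_dvd]
      intro hdvd
      have h2 : (k - n).natAbs ≤ ∑ k ∈ f.support, (k - n).natAbs :=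
        Finset.single_le_sum (f := fun k : ℤ => (k - n).natAbs) (fun _ _ => Nat.zero_le _) hk
      have h3 := Nat.le_of_dvd (by omega) (Int.natCast_dvd.1 hdvd)
      omega
    rw [geom_sum_eq h1, ← zpow_natCast, ← zpow_mul, mul_comm (k - n), zpow_mul, zpow_natCast,
      hprim.pow_eq_one, one_zpow, sub_self, zero_div, mul_zero, zero_smul]
  have hsum : average q m ζ n (Coord.toCSUq q (f.sum fun _ y => y)) = Coord.toCSUq q (f n) := by
    rw [Finsupp.sum, map_sum, map_sum, Finset.sum_eq_single n (fun k hk hkn => hoff k hk hkn)]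
    · exact hdiag _ (hf n)
    · intro h
      rw [Finsupp.notMem_support_iff.1 h, map_zero, map_zero]
  rw [dist_eq_norm] at hp ⊢
  have hfin := norm_average_le q m ζ n (x - Coord.toCSUq q (f.sum fun _ y => y))
  rw [map_sub, hsum, hdiag x hx] at hfin
  exact hfin.trans_lt hp

theorem gnsRep_mem_Hspec {q : ℝ} (n : ℤ) (x : sphere q) {v : L2 q} (hv : v ∈ Hspec q n) :
    gnsRep q x v ∈ Hspec q n := by
  refine closure_minimal (t := (gnsRep q x) ⁻¹' (Hspec q n : Set (L2 q))) ?_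
    (IsClosed.preimage (gnsRep q x).continuous (Submodule.isClosed_topologicalClosure _)) hv
  rintro _ ⟨y, hy, rfl⟩
  change gnsRep q x (gnsVec q (Coord.toCSUq q y)) ∈ closure _
  rw [gnsRep_gnsVec]
  have hxy : ∀ z : Circle, circleAction q z (x * Coord.toCSUq q y) =
      (z : ℂ) ^ n • (x * Coord.toCSUq q y) := fun z => by
    have hxz : circleAction q z x = x := (StarSubalgebra.mem_iInf.1 x.2 z : _)
    rw [map_mul, hy z, hxz, mul_smul_comm]
  refine closure_mono ?_ (image_closure_subset_closure_image (gnsVec_continuous q)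
    ⟨_, mem_closure_spectral hxy, rfl⟩)
  rintro _ ⟨_, ⟨w, hw, rfl⟩, rfl⟩
  exact ⟨w, hw, rfl⟩

/-- The Hilbert space `H_+ ⊕ H_-`. -/
abbrev Spinor (q : ℝ) : Type 1 := WithLp 2 (Hspec q 1 × Hspec q (-1))

/-- The action of `C(S_q^2)` on `H_n` obtained by restricting the GNS representation. -/
def restrictRep {q : ℝ} (n : ℤ) (x : sphere q) : Hspec q n →L[ℂ] Hspec q n :=
  (gnsRep q x).restrict fun _ hv => gnsRep_mem_Hspec n x hv

/-- The representation `π` of `C(S_q^2)` on `H_+ ⊕ H_-`. -/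
def spinorRep {q : ℝ} (x : sphere q) : Spinor q →L[ℂ] Spinor q :=
  (WithLp.prodContinuousLinearEquiv 2 ℂ (Hspec q 1) (Hspec q (-1))).symm.toContinuousLinearMap.comp
    (((restrictRep 1 x).prodMap (restrictRep (-1) x)).comp
      (WithLp.prodContinuousLinearEquiv 2 ℂ (Hspec q 1) (Hspec q (-1))).toContinuousLinearMap)

/-- The densely defined operator `Λ(y) ↦ Λ(T y)`, `y ∈ 𝒜_n`, from `H_n` to `H_m`. -/
def ladder (q : ℝ) (n m : ℤ) (T : Coord q →ₗ[ℂ] Coord q) : Hspec q n →ₗ.[ℂ] Hspec q m :=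
  (((spectral q n).map ((gnsVec q ∘ₗ (Coord.toCSUq q).toLinearMap).prod
    (gnsVec q ∘ₗ (Coord.toCSUq q).toLinearMap ∘ₗ T))).comap
      ((Hspec q n).subtype.prodMap (Hspec q m).subtype)).toLinearPMap

/-- The operator `E`: the closure of `∂_e` from `Λ(𝒜_1)` to `H_-`. -/
def opE (q : Set.Ioc (0 : ℝ) 1) : Hspec q 1 →ₗ.[ℂ] Hspec q (-1) :=
  (ladder q 1 (-1) (leftAction (pairE q))).closure

/-- The operator `F`: the closure of `∂_f` from `Λ(𝒜_{-1})` to `H_+`. -/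
def opF (q : Set.Ioc (0 : ℝ) 1) : Hspec q (-1) →ₗ.[ℂ] Hspec q 1 :=
  (ladder q (-1) 1 (leftAction (pairF q))).closure

/-- The projection of `H_+ ⊕ H_-` to `H_+`. -/
def spinorFst (q : ℝ) : Spinor q →ₗ[ℂ] Hspec q 1 :=
  LinearMap.fst ℂ _ _ ∘ₗ (WithLp.linearEquiv 2 ℂ (Hspec q 1 × Hspec q (-1))).toLinearMap

/-- The projection of `H_+ ⊕ H_-` to `H_-`. -/
def spinorSnd (q : ℝ) : Spinor q →ₗ[ℂ] Hspec q (-1) :=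
  LinearMap.snd ℂ _ _ ∘ₗ (WithLp.linearEquiv 2 ℂ (Hspec q 1 × Hspec q (-1))).toLinearMap

/-- The domain `Dom(E) ⊕ Dom(F)` of the Dirac operator. -/
def diracDomain (q : Set.Ioc (0 : ℝ) 1) : Submodule ℂ (Spinor q) :=
  (opE q).domain.comap (spinorFst q) ⊓ (opF q).domain.comap (spinorSnd q)

/-- The Dąbrowski–Sitarz Dirac operator `D_q (v₊, v₋) = (F v₋, E v₊)`. -/
def dirac (q : Set.Ioc (0 : ℝ) 1) : Spinor q →ₗ.[ℂ] Spinor q where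
  domain := diracDomain q
  toFun := (WithLp.linearEquiv 2 ℂ (Hspec q 1 × Hspec q (-1))).symm.toLinearMap ∘ₗ
    (((opF q).toFun ∘ₗ (spinorSnd q).restrict (p := diracDomain q) fun _ h => h.2).prod
      ((opE q).toFun ∘ₗ (spinorFst q).restrict (p := diracDomain q) fun _ h => h.1))

/-- `π(x)` preserves the domain of `D_q`, and the bounded operator `T` extends `[D_q, π(x)]`. -/
def IsCommutator (q : Set.Ioc (0 : ℝ) 1) (x : sphere q) (T : Spinor q →L[ℂ] Spinor q) : Prop :=
  ∀ v : (dirac q).domain, ∃ h : spinorRep x v ∈ (dirac q).domain,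
    T v = dirac q ⟨spinorRep x v, h⟩ - spinorRep x (dirac q v)

/-- The Lipschitz algebra `C^Lip(S_q^2)`. -/
def lipAlgebra (q : Set.Ioc (0 : ℝ) 1) : Set (sphere q) := {x | ∃ T, IsCommutator q x T}

open Classical in
/-- The bounded extension `∂(x)` of `[D_q, π(x)]` for `x` in the Lipschitz algebra. -/
def derivation (q : Set.Ioc (0 : ℝ) 1) (x : sphere q) : Spinor q →L[ℂ] Spinor q :=
  if h : ∃ T, IsCommutator q x T then h.choose else 0

/-- The seminorm `L_{D_q}^max(x) = ‖∂(x)‖` (meaningful on the Lipschitz algebra). -/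
def lipSeminorm (q : Set.Ioc (0 : ℝ) 1) (x : sphere q) : ℝ := ‖derivation q x‖

/-- The Monge–Kantorovič metric of `L_{D_q}^max`, as an extended metric:
`sup {|μ(x) - ν(x)| : x ∈ C^Lip(S_q^2), L_{D_q}^max(x) ≤ 1}`. -/
def dMax (q : Set.Ioc (0 : ℝ) 1) (μ ν : sphere q →ₗ[ℂ] ℂ) : ℝ≥0∞ :=
  ⨆ x ∈ {x | x ∈ lipAlgebra q ∧ lipSeminorm q x ≤ 1}, ‖μ x - ν x‖ₑ

/-- The functional `x ↦ ⟨N+1⟩ h((a*)^N x a^N)` on `C(SU_q(2))`, where `⟨N+1⟩ = ∑_{k ≤ N} q^{2k}`. -/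
def berezinFunctional (q : ℝ) (N : ℕ) : CSUq q →L[ℂ] ℂ :=
  (∑ k ∈ Finset.range (N + 1), (q : ℂ) ^ (2 * k)) • (toCLM (haar q)).comp
    (((ContinuousLinearMap.mul ℂ (CSUq q)).flip (gena q ^ N)).comp
      (ContinuousLinearMap.mul ℂ (CSUq q) (star (gena q) ^ N)))

theorem berezinFunctional_apply (q : ℝ) (N : ℕ) (x : CSUq q) : berezinFunctional q N x =
    (∑ k ∈ Finset.range (N + 1), (q : ℂ) ^ (2 * k)) *
      haar q (star (gena q) ^ N * x * gena q ^ N) := rfl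

/-- The Berezin state `h_N` on `C(S_q^2)`. -/
def berezinState (q : ℝ) (N : ℕ) : sphere q →ₗ[ℂ] ℂ :=
  (berezinFunctional q N).toLinearMap ∘ₗ (sphere q).subtype.toLinearMap

/-- The restriction of the counit to `C(S_q^2)`. -/
def counitState (q : ℝ) : sphere q →ₗ[ℂ] ℂ :=
  (counit q).toAlgHom.toLinearMap ∘ₗ (sphere q).subtype.toLinearMap

/-- The quantum Berezin transform `β_N(x) = (1 ⊗ h_N)Δ(x)` for `x ∈ C(S_q^2)`. -/
def berezin (q : ℝ) (N : ℕ) (x : sphere q) : CSUq q :=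
  slice (berezinFunctional q N) (comul q x)

end QuantumSU2

end

/-! Fix a representation `r`, vectors `ξ, ζ`, and let `y = (⟪ξ, · ζ⟫ ⊗ 1)Δ(x)`. The counit axiom
gives `ε(y) = ⟪ξ, x(r) ζ⟫`, and exchanging the two slices gives `h_N(y) = ⟪ξ, β_N(x)(r) ζ⟫`. So the
matrix coefficients of `x - β_N(x)` are the numbers `ε(y) - h_N(y)`, and the norm of `C(SU_q(2))` is
read off from matrix coefficients over all representations. Two facts remain: `y` is again a
Lipschitz element of the sphere with `L(y) ≤ ‖ξ‖ ‖ζ‖ L(x)`, and `|h_N(y) - ε(y)| ≤ d(h_N, ε) L(y)`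
with the convention `∞ · 0 = 0`.

The Lipschitz bound (`sphereSlice_mem_lipAlgebra`) rests on invariance. The operators `∂_e, ∂_f` and
the circle action use the second leg of `Δ`, so they commute with operations on the first leg. On
`H_r ⊗ L²` the map `W(ζ ⊗ Λ(w)) = Δ(w)(ζ ⊗ 1)` is isometric by invariance of the Haar state,
satisfies `W(1 ⊗ x) = Δ(x)W`, commutes with `1 ⊗ ∂_η` by coassociativity, and maps `H_r ⊗ 𝒜_n` onto
`H_r ⊗ 𝒜_n` (`spectral_le_covered`). If `B` is the commutator of `∂_η` with `x`, then that of `1 ⊗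
∂_η` with `Δ(x)` is `W(1 ⊗ B)W⁻¹`. Compressing by `ξ` and `ζ` bounds the commutator with `y`.

If `L(y) > 0`, the second fact is homogeneity. If `L(y) = 0`, one needs `h_N(y) = ε(y)`, since the
distance is not known to be finite. Integrating `[∂_e, y] = 0` against test elements gives a
recursion for `h((bb*)^m y)`, the same as for the moments `h((bb*)^m)`; hence `h(P(bb*) y) =
h(P(bb*)) h(y)` for polynomials `P`. The modular rule `h(x a) = q⁻² h(a x)` turns `h((a*)^N y a^N)`
into such an expression, so `h_N(y) = h(y)` for every `N`. As `h_N → ε` on the sphere, also `ε(y) =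
h(y)`.

The groundwork: the coordinate algebra embeds in `C(SU_q(2))` (`toCSUq_injective`, via a normal form
and the torus action); a Haar state exists (`exists_isHaarState`, Cesàro means of convolution powers
of a faithful state); its moments and modular rule follow from `h ∘ ∂_e = 0`; and `∂_e, ∂_f` are
closable, so everything can be phrased with closed graphs in `L² ⊕ L²`. -/

noncomputable section

namespace QuantumSU2

open OpFamily

/-! ### The coordinate algebra: coassociativity, left and right actions of functionals, torus
scalings. -/

section CoordinateAlgebra

variable {q : ℝ}

@[simp] theorem Coord.lift_gen {B : Type*} [Ring B] [Algebra ℂ B] {a a' b b' : B}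
    (h : Relations q a a' b b') (g : Gen) :
    Coord.lift h (Coord.gen q g) = genMap a a' b b' g := by
  have : Coord.lift h (Coord.gen q g) = FreeAlgebra.lift ℂ (genMap a a' b b')
      (FreeAlgebra.ι ℂ g) := RingQuot.liftAlgHom_mkAlgHom_apply ..
  rw [this, FreeAlgebra.lift_ι_apply]

theorem Coord.hom_ext {B : Type*} [Ring B] [Algebra ℂ B] {f g : Coord q →ₐ[ℂ] B}
    (h : ∀ i, f (Coord.gen q i) = g (Coord.gen q i)) : f = g :=
  RingQuot.ringQuot_ext' (S := ℂ) (s := CoordRel q) f g (FreeAlgebra.hom_ext (funext h))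

/-- The quotient map from noncommutative polynomials to the coordinate algebra. -/
def Coord.mk (q : ℝ) : FreeAlgebra ℂ Gen →ₐ[ℂ] Coord q := RingQuot.mkAlgHom ℂ (CoordRel q)

/-- Induction on words: a submodule containing `1` and stable under left multiplication by the
generators is everything. -/
theorem Coord.mem_of_gen_mul_mem (M : Submodule ℂ (Coord q)) (h1 : 1 ∈ M)
    (hg : ∀ g, ∀ x ∈ M, Coord.gen q g * x ∈ M) (x : Coord q) : x ∈ M := by
  suffices h : ∀ p : FreeAlgebra ℂ Gen, ∀ y ∈ M, Coord.mk q p * y ∈ M by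
    obtain ⟨p, rfl⟩ : ∃ p, Coord.mk q p = x := RingQuot.mkAlgHom_surjective ℂ (CoordRel q) x
    have := h p 1 h1
    rwa [mul_one] at this
  intro p
  induction p using FreeAlgebra.induction with
  | grade0 c =>
    intro y hy
    rw [AlgHom.commutes]
    have := M.smul_mem c hy
    rwa [Algebra.smul_def] at this
  | grade1 g => exact hg g
  | add x y hx hy => intro w hw; rw [map_add, add_mul]; exact M.add_mem (hx w hw) (hy w hw)
  | mul x y hx hy => intro w hw; rw [map_mul, mul_assoc]; exact hx _ (hy w hw)

theorem Coord.comul_gen (g : Gen) : Coord.comul q (Coord.gen q g) =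
    genMap
      (Coord.gen q .a ⊗ₜ[ℂ] Coord.gen q .a - (q : ℂ) • (Coord.gen q .b' ⊗ₜ[ℂ] Coord.gen q .b))
      (Coord.gen q .a' ⊗ₜ[ℂ] Coord.gen q .a' - (q : ℂ) • (Coord.gen q .b ⊗ₜ[ℂ] Coord.gen q .b'))
      (Coord.gen q .b ⊗ₜ[ℂ] Coord.gen q .a + Coord.gen q .a' ⊗ₜ[ℂ] Coord.gen q .b)
      (Coord.gen q .b' ⊗ₜ[ℂ] Coord.gen q .a' + Coord.gen q .a ⊗ₜ[ℂ] Coord.gen q .b') g :=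
  Coord.lift_gen _ g

/-- Coassociativity of the comultiplication of the coordinate algebra. -/
theorem Coord.coassoc (x : Coord q) :
    Algebra.TensorProduct.assoc ℂ ℂ ℂ (Coord q) (Coord q) (Coord q)
      (Algebra.TensorProduct.map (Coord.comul q) (AlgHom.id ℂ (Coord q)) (Coord.comul q x)) =
    Algebra.TensorProduct.map (AlgHom.id ℂ (Coord q)) (Coord.comul q) (Coord.comul q x) := by
  have h : ((Algebra.TensorProduct.assoc ℂ ℂ ℂ (Coord q) (Coord q) (Coord q)).toAlgHom.comp
      (Algebra.TensorProduct.map (Coord.comul q) (AlgHom.id ℂ (Coord q)))).comp (Coord.comul q) =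
    (Algebra.TensorProduct.map (AlgHom.id ℂ (Coord q)) (Coord.comul q)).comp (Coord.comul q) := by
    refine Coord.hom_ext fun g => ?_
    cases g <;>
    · simp [-Complex.coe_smul, Coord.comul_gen, genMap, TensorProduct.add_tmul, TensorProduct.tmul_add,
        TensorProduct.sub_tmul, TensorProduct.tmul_sub, ← TensorProduct.smul_tmul',
        TensorProduct.tmul_smul]
      abel_nf
  exact congrArg (fun f => f x) h

/-- The endomorphism `(⟨η, ·⟩ ⊗ 1)Δ` of the coordinate algebra. -/
def rightAction (η : Coord q →ₗ[ℂ] ℂ) : Coord q →ₗ[ℂ] Coord q :=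
  (TensorProduct.lid ℂ (Coord q)).toLinearMap ∘ₗ LinearMap.rTensor (Coord q) η ∘ₗ
    (Coord.comul q).toLinearMap

theorem leftAction_apply (η : Coord q →ₗ[ℂ] ℂ) (x : Coord q) : leftAction η x =
    TensorProduct.rid ℂ (Coord q) (LinearMap.lTensor (Coord q) η (Coord.comul q x)) := rfl

theorem rightAction_apply (η : Coord q →ₗ[ℂ] ℂ) (x : Coord q) : rightAction η x =
    TensorProduct.lid ℂ (Coord q) (LinearMap.rTensor (Coord q) η (Coord.comul q x)) := rfl

theorem leftAction_gen (η : Coord q →ₗ[ℂ] ℂ) (g : Gen) : leftAction η (Coord.gen q g) =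
    genMap
      (η (.gen q .a) • Coord.gen q .a - ((q : ℂ) * η (.gen q .b)) • Coord.gen q .b')
      (η (.gen q .a') • Coord.gen q .a' - ((q : ℂ) * η (.gen q .b')) • Coord.gen q .b)
      (η (.gen q .a) • Coord.gen q .b + η (.gen q .b) • Coord.gen q .a')
      (η (.gen q .a') • Coord.gen q .b' + η (.gen q .b') • Coord.gen q .a) g := by
  rw [leftAction_apply, Coord.comul_gen]
  cases g <;> simp [-Complex.coe_smul, genMap, mul_smul]

theorem rightAction_gen (η : Coord q →ₗ[ℂ] ℂ) (g : Gen) : rightAction η (Coord.gen q g) =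
    genMap
      (η (.gen q .a) • Coord.gen q .a - ((q : ℂ) * η (.gen q .b')) • Coord.gen q .b)
      (η (.gen q .a') • Coord.gen q .a' - ((q : ℂ) * η (.gen q .b)) • Coord.gen q .b')
      (η (.gen q .b) • Coord.gen q .a + η (.gen q .a') • Coord.gen q .b)
      (η (.gen q .b') • Coord.gen q .a' + η (.gen q .a) • Coord.gen q .b') g := by
  rw [rightAction_apply, Coord.comul_gen]
  cases g <;> simp [-Complex.coe_smul, genMap, mul_smul]

theorem leftAction_one (η : Coord q →ₗ[ℂ] ℂ) : leftAction η 1 = η 1 • (1 : Coord q) := by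
  rw [leftAction_apply, map_one, Algebra.TensorProduct.one_def]; simp

theorem rightAction_one (η : Coord q →ₗ[ℂ] ℂ) : rightAction η 1 = η 1 • (1 : Coord q) := by
  rw [rightAction_apply, map_one, Algebra.TensorProduct.one_def]; simp

/-- A twisted product rule for a functional gives one for its left action. -/
theorem leftAction_mul {η κ κ' : Coord q →ₗ[ℂ] ℂ}
    (h : ∀ x y, η (x * y) = η x * κ y + κ' x * η y) (x y : Coord q) :
    leftAction η (x * y) = leftAction η x * leftAction κ y + leftAction κ' x * leftAction η y := by
  simp only [leftAction_apply, map_mul]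
  generalize Coord.comul q x = s
  generalize Coord.comul q y = t
  induction s with
  | zero => simp
  | add s s' hs hs' => simp only [add_mul, map_add, hs, hs']; abel
  | tmul u v =>
    induction t with
    | zero => simp
    | add t t' ht ht' => simp only [mul_add, map_add, ht, ht']; abel
    | tmul u' v' =>
      simp only [Algebra.TensorProduct.tmul_mul_tmul, LinearMap.lTensor_tmul, h,
        TensorProduct.rid_tmul, add_smul, smul_mul_smul_comm]

theorem leftAction_algHom_mul (χ : Coord q →ₐ[ℂ] ℂ) (x y : Coord q) :
    leftAction χ.toLinearMap (x * y) =
      leftAction χ.toLinearMap x * leftAction χ.toLinearMap y := by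
  have h := leftAction_mul (η := χ.toLinearMap) (κ := χ.toLinearMap) (κ' := 0)
    (fun x y => by simp) x y
  rw [h]
  simp [leftAction_apply]

theorem rightAction_algHom_mul (χ : Coord q →ₐ[ℂ] ℂ) (x y : Coord q) :
    rightAction χ.toLinearMap (x * y) =
      rightAction χ.toLinearMap x * rightAction χ.toLinearMap y := by
  simp only [rightAction_apply, map_mul]
  generalize Coord.comul q x = s
  generalize Coord.comul q y = t
  induction s with
  | zero => simp
  | add s s' hs hs' => simp only [add_mul, map_add, hs, hs']
  | tmul u v =>
    induction t with
    | zero => simp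
    | add t t' ht ht' => simp only [mul_add, map_add, ht, ht']
    | tmul u' v' => simp [mul_smul, smul_comm (χ u)]

/-- Left and right actions commute. -/
theorem comul_leftAction (η : Coord q →ₗ[ℂ] ℂ) (x : Coord q) :
    Coord.comul q (leftAction η x) =
      LinearMap.lTensor (Coord q) (leftAction η) (Coord.comul q x) := by
  have h := congrArg (fun t => LinearMap.lTensor (Coord q) ((TensorProduct.rid ℂ (Coord q)).toLinearMap ∘ₗ
    LinearMap.lTensor (Coord q) η) t) (Coord.coassoc x)
  have h2 : ∀ s : Coord q ⊗[ℂ] Coord q, LinearMap.lTensor (Coord q)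
      ((TensorProduct.rid ℂ (Coord q)).toLinearMap ∘ₗ LinearMap.lTensor (Coord q) η)
      (Algebra.TensorProduct.map (AlgHom.id ℂ (Coord q)) (Coord.comul q) s) =
      LinearMap.lTensor (Coord q) (leftAction η) s := fun s => by
    induction s with
    | zero => simp
    | add s t hs ht => simp only [map_add, hs, ht]
    | tmul u v => simp [leftAction_apply]
  have h1 : ∀ s : Coord q ⊗[ℂ] Coord q, LinearMap.lTensor (Coord q)
      ((TensorProduct.rid ℂ (Coord q)).toLinearMap ∘ₗ LinearMap.lTensor (Coord q) η)
      (Algebra.TensorProduct.assoc ℂ ℂ ℂ (Coord q) (Coord q) (Coord q)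
        (Algebra.TensorProduct.map (Coord.comul q) (AlgHom.id ℂ (Coord q)) s)) =
      Coord.comul q (TensorProduct.rid ℂ (Coord q) (LinearMap.lTensor (Coord q) η s)) := fun s => by
    induction s with
    | zero => simp
    | add s t hs ht => simp only [map_add, hs, ht]
    | tmul u v =>
      simp only [Algebra.TensorProduct.map_tmul, AlgHom.id_apply, LinearMap.lTensor_tmul,
        TensorProduct.rid_tmul, map_smul]
      generalize Coord.comul q u = t
      induction t with
      | zero => simp
      | add s t hs ht => simp only [map_add, hs, ht, TensorProduct.add_tmul, smul_add]
      | tmul u u' => simp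
  rw [leftAction_apply, ← h1, ← h2]
  exact h

theorem rightAction_leftAction (ψ η : Coord q →ₗ[ℂ] ℂ) (x : Coord q) :
    rightAction ψ (leftAction η x) = leftAction η (rightAction ψ x) := by
  rw [rightAction_apply, comul_leftAction, rightAction_apply]
  generalize Coord.comul q x = s
  induction s with
  | zero => simp
  | add s t hs ht => simp only [map_add, hs, ht]
  | tmul u v => simp

/-- The character `a ↦ z`, `b ↦ 0` of the coordinate algebra. -/
def torusChar (q : ℝ) (z : ℂˣ) : Coord q →ₐ[ℂ] ℂ :=
  Coord.lift (a := (z : ℂ)) (a' := ((z⁻¹ : ℂˣ) : ℂ)) (b := 0) (b' := 0) (by constructor <;> simp)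

/-- The automorphism `a ↦ z a`, `b ↦ w b` of the coordinate algebra. -/
def scale (q : ℝ) (z w : ℂˣ) : Coord q →ₐ[ℂ] Coord q :=
  Coord.lift (a := (z : ℂ) • Coord.gen q .a) (a' := ((z⁻¹ : ℂˣ) : ℂ) • Coord.gen q .a')
    (b := (w : ℂ) • Coord.gen q .b) (b' := ((w⁻¹ : ℂˣ) : ℂ) • Coord.gen q .b') (by
      have h := Coord.relations q
      constructor <;> simp only [smul_mul_smul_comm, Units.mul_inv, Units.inv_mul, one_smul]
      · rw [h.ba, smul_comm, mul_comm]
      · rw [h.b'a, smul_comm, mul_comm]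
      · exact h.bb'
      · rw [h.a'b', smul_comm, mul_comm]
      · rw [h.a'b, smul_comm, mul_comm]
      · exact h.a'a
      · exact h.aa')

theorem leftAction_torusChar (z : ℂˣ) :
    leftAction (torusChar q z).toLinearMap = (scale q z z).toLinearMap := by
  have : AlgHom.ofLinearMap (leftAction (torusChar q z).toLinearMap)
      (by rw [leftAction_one]; simp) (leftAction_algHom_mul _) = scale q z z := by
    refine Coord.hom_ext fun g => ?_
    rw [AlgHom.ofLinearMap_apply, leftAction_gen]
    cases g <;> simp [torusChar, scale, genMap]
  rw [← this]; rfl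

/-- The diagonal torus acts through either leg of `Δ`: through the second it scales `a, b` by `(z,
z)`, through the first by `(z, z⁻¹)`. Together the two actions separate all bidegrees, which is how
the Haar state is shown to vanish away from bidegree `(0, 0)`. -/
theorem rightAction_torusChar (z : ℂˣ) :
    rightAction (torusChar q z).toLinearMap = (scale q z z⁻¹).toLinearMap := by
  have : AlgHom.ofLinearMap (rightAction (torusChar q z).toLinearMap)
      (by rw [rightAction_one]; simp) (rightAction_algHom_mul _) = scale q z z⁻¹ := by
    refine Coord.hom_ext fun g => ?_
    rw [AlgHom.ofLinearMap_apply, rightAction_gen]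
    cases g <;> simp [torusChar, scale, genMap]
  rw [← this]; rfl

end CoordinateAlgebra

/-! ### The functionals `e` and `f` as skew derivations. -/

section Derivations

variable (q : Set.Ioc (0 : ℝ) 1)

/-- `q^{1/2}` as an invertible complex number. -/
def sqrtUnit : ℂˣ := Units.mk0 ((√(q : ℝ) : ℝ) : ℂ) (sqrt_facts q).1

theorem sqrtUnit_sq : ((sqrtUnit q : ℂˣ) : ℂ) ^ 2 = ((q : ℝ) : ℂ) := (sqrt_facts q).2.symm

/-- Triangularity with the characters of `k⁻¹` and `k` on the diagonal makes multiplicativity of the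
upper right entry the twisted product rule of `e`. -/
theorem pairMatE_entries (x : Coord q) : pairMatE q x 1 0 = 0 ∧
    pairMatE q x 0 0 = torusChar q (sqrtUnit q)⁻¹ x ∧ pairMatE q x 1 1 = torusChar q (sqrtUnit q) x := by
  let M : Submodule ℂ (Coord q) :=
    { carrier := {x | pairMatE q x 1 0 = 0 ∧ pairMatE q x 0 0 = torusChar q (sqrtUnit q)⁻¹ x ∧
        pairMatE q x 1 1 = torusChar q (sqrtUnit q) x}
      add_mem' := fun h h' => by
        simp only [Set.mem_ofPred_eq, map_add, Matrix.add_apply] at *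
        simp [h, h']
      zero_mem' := by simp
      smul_mem' := fun c x h => by
        simp only [Set.mem_ofPred_eq, map_smul, Matrix.smul_apply] at *
        simp [h] }
  refine Coord.mem_of_gen_mul_mem M ⟨by simp, by simp, by simp⟩ (fun g x hx => ?_) x
  obtain ⟨h1, h2, h3⟩ := hx
  change _ ∧ _ ∧ _
  simp only [map_mul, Matrix.mul_apply, Fin.sum_univ_two, h1, h2, h3]
  cases g <;> simp [pairMatE, torusChar, genMap, sqrtUnit]

theorem pairMatF_entries (x : Coord q) : pairMatF q x 1 0 = 0 ∧
    pairMatF q x 0 0 = torusChar q (sqrtUnit q)⁻¹ x ∧ pairMatF q x 1 1 = torusChar q (sqrtUnit q) x := by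
  let M : Submodule ℂ (Coord q) :=
    { carrier := {x | pairMatF q x 1 0 = 0 ∧ pairMatF q x 0 0 = torusChar q (sqrtUnit q)⁻¹ x ∧
        pairMatF q x 1 1 = torusChar q (sqrtUnit q) x}
      add_mem' := fun h h' => by
        simp only [Set.mem_ofPred_eq, map_add, Matrix.add_apply] at *
        simp [h, h']
      zero_mem' := by simp
      smul_mem' := fun c x h => by
        simp only [Set.mem_ofPred_eq, map_smul, Matrix.smul_apply] at *
        simp [h] }
  refine Coord.mem_of_gen_mul_mem M ⟨by simp, by simp, by simp⟩ (fun g x hx => ?_) x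
  obtain ⟨h1, h2, h3⟩ := hx
  change _ ∧ _ ∧ _
  simp only [map_mul, Matrix.mul_apply, Fin.sum_univ_two, h1, h2, h3]
  cases g <;> simp [pairMatF, torusChar, genMap, sqrtUnit]

/-- A functional that is a skew derivation for `k`, as the pairings with `e` and `f`. -/
def IsSkew (η : Coord q →ₗ[ℂ] ℂ) : Prop :=
  ∀ x y, η (x * y) = η x * torusChar q (sqrtUnit q) y + torusChar q (sqrtUnit q)⁻¹ x * η y

theorem isSkew_pairE : IsSkew q (pairE q) := fun x y => by
  have h : ∀ z, pairE q z = pairMatE q z 0 1 := fun _ => rfl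
  simp only [h, map_mul, Matrix.mul_apply, Fin.sum_univ_two, (pairMatE_entries q _).2]
  ring

theorem isSkew_pairF : IsSkew q (pairF q) := fun x y => by
  have h : ∀ z, pairF q z = pairMatF q z 0 1 := fun _ => rfl
  simp only [h, map_mul, Matrix.mul_apply, Fin.sum_univ_two, (pairMatF_entries q _).2]
  ring

variable {q}

theorem IsSkew.map_one {η : Coord q →ₗ[ℂ] ℂ} (h : IsSkew q η) : η 1 = 0 := by
  have := h 1 1
  simpa using this

theorem IsSkew.leftAction_mul {η : Coord q →ₗ[ℂ] ℂ} (h : IsSkew q η) (x y : Coord q) :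
    leftAction η (x * y) = leftAction η x * scale q (sqrtUnit q) (sqrtUnit q) y +
      scale q (sqrtUnit q)⁻¹ (sqrtUnit q)⁻¹ x * leftAction η y := by
  rw [QuantumSU2.leftAction_mul (κ := (torusChar q (sqrtUnit q)).toLinearMap)
    (κ' := (torusChar q (sqrtUnit q)⁻¹).toLinearMap) h, leftAction_torusChar, leftAction_torusChar]
  rfl

variable (q)

theorem pairE_gen (g : Gen) : pairE q (Coord.gen q g) = genMap 0 0 (-((q : ℝ) : ℂ)⁻¹) 0 g := by
  have h : ∀ z, pairE q z = pairMatE q z 0 1 := fun _ => rfl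
  rw [h, pairMatE, Coord.lift_gen]
  cases g <;> simp [genMap]

theorem pairF_gen (g : Gen) : pairF q (Coord.gen q g) = genMap 0 0 0 1 g := by
  have h : ∀ z, pairF q z = pairMatF q z 0 1 := fun _ => rfl
  rw [h, pairMatF, Coord.lift_gen]
  cases g <;> simp [genMap]

theorem leftAction_pairE_gen (g : Gen) : leftAction (pairE q) (Coord.gen q g) =
    genMap (Coord.gen q .b') 0 (-((q : ℝ) : ℂ)⁻¹ • Coord.gen q .a') 0 g := by
  have hq : ((q : ℝ) : ℂ) ≠ 0 := Complex.ofReal_ne_zero.2 q.2.1.ne'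
  rw [leftAction_gen]
  cases g <;> simp [pairE_gen, genMap, hq]

theorem leftAction_pairF_gen (g : Gen) : leftAction (pairF q) (Coord.gen q g) =
    genMap 0 (-((q : ℝ) : ℂ) • Coord.gen q .b) 0 (Coord.gen q .a) g := by
  rw [leftAction_gen]
  cases g <;> simp [pairF_gen, genMap]

end Derivations

/-! ### Explicit representations, and algebraic independence of `bb*`. -/

section Representations

/-- The operator `(W v)(n) = c(n) v(σ n)` on `ℓ²(ℕ)`. -/
def weighted (c : ℕ → ℝ) (σ : ℕ → ℕ) (hc : ∀ n, |c n| ≤ 1)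
    (hσ : Set.InjOn σ {n | c n ≠ 0}) : lp (fun _ : ℕ => ℂ) 2 →L[ℂ] lp (fun _ : ℕ => ℂ) 2 :=
  have key : ∀ (v : lp (fun _ : ℕ => ℂ) 2) (s : Finset ℕ),
      ∑ n ∈ s, ‖(c n : ℂ) * v (σ n)‖ ^ (2 : ℝ≥0∞).toReal ≤ ‖v‖ ^ (2 : ℝ≥0∞).toReal := fun v s => by
    classical
    calc ∑ n ∈ s, ‖(c n : ℂ) * v (σ n)‖ ^ (2 : ℝ≥0∞).toReal
        = ∑ n ∈ s with c n ≠ 0, ‖(c n : ℂ) * v (σ n)‖ ^ (2 : ℝ≥0∞).toReal := by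
          refine (Finset.sum_filter_of_ne (p := fun n => c n ≠ 0) fun n _ hn h0 => hn ?_).symm
          simp [h0]
      _ ≤ ∑ n ∈ s with c n ≠ 0, ‖v (σ n)‖ ^ (2 : ℝ≥0∞).toReal := by
          refine Finset.sum_le_sum fun n _ => ?_
          refine Real.rpow_le_rpow (norm_nonneg _) ?_ (by simp)
          rw [norm_mul, Complex.norm_real, Real.norm_eq_abs]
          exact mul_le_of_le_one_left (norm_nonneg _) (hc n)
      _ = ∑ n ∈ (s.filter fun n => c n ≠ 0).image σ, ‖v n‖ ^ (2 : ℝ≥0∞).toReal := by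
          rw [Finset.sum_image]
          intro m hm n hn h
          exact hσ (Finset.mem_filter.1 hm).2 (Finset.mem_filter.1 hn).2 h
      _ ≤ _ := lp.sum_rpow_le_norm_rpow (by simp) v _
  LinearMap.mkContinuous
    { toFun := fun v => ⟨fun n => (c n : ℂ) * v (σ n), memℓp_gen' (key v)⟩
      map_add' := fun v w => lp.ext (funext fun n => mul_add _ _ _)
      map_smul' := fun k v => lp.ext (funext fun n => mul_left_comm _ _ _) }
    1 fun v => by
      rw [one_mul]
      exact lp.norm_le_of_forall_sum_le (by simp) (norm_nonneg _) (key v)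

theorem abs_sqrt_one_sub_pow_le {q : ℝ} (h0 : 0 ≤ q) (n : ℕ) :
    |√(1 - q ^ (2 * n))| ≤ 1 := by
  rw [abs_of_nonneg (Real.sqrt_nonneg _)]
  exact Real.sqrt_le_one.2 (by linarith [pow_nonneg h0 (2 * n)])

section Shift

variable (q : ℝ) (h0 : 0 ≤ q) (h1 : q ≤ 1)

/-- The weighted shift `e_n ↦ (1 - q^{2n+2})^{1/2} e_{n+1}`. -/
def shiftA : lp (fun _ : ℕ => ℂ) 2 →L[ℂ] lp (fun _ : ℕ => ℂ) 2 :=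
  weighted (fun n => √(1 - q ^ (2 * n))) (fun n => n - 1) (abs_sqrt_one_sub_pow_le h0)
    (fun m hm n hn h => by
      -- The weight vanishes at `0`, so the truncated `n - 1` only has to be injective on positive
      -- indices.
      have hm0 : m ≠ 0 := by rintro rfl; simp at hm
      have hn0 : n ≠ 0 := by rintro rfl; simp at hn
      simp only at h; omega)

/-- The adjoint of the weighted shift. -/
def shiftA' : lp (fun _ : ℕ => ℂ) 2 →L[ℂ] lp (fun _ : ℕ => ℂ) 2 :=
  weighted (fun n => √(1 - q ^ (2 * (n + 1)))) (fun n => n + 1)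
    (fun n => abs_sqrt_one_sub_pow_le h0 (n + 1)) (fun m _ n _ h => by simpa using h)

/-- The diagonal operator `e_n ↦ q^n e_n`. -/
def shiftB : lp (fun _ : ℕ => ℂ) 2 →L[ℂ] lp (fun _ : ℕ => ℂ) 2 :=
  weighted (fun n => q ^ n) id
    (fun n => by rw [abs_of_nonneg (pow_nonneg h0 n)]; exact pow_le_one₀ h0 h1)
    Function.injective_id.injOn

theorem shiftA_zero (v : lp (fun _ : ℕ => ℂ) 2) : shiftA q h0 v 0 = 0 := by
  change ((√(1 - q ^ (2 * 0)) : ℝ) : ℂ) * v (0 - 1) = 0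
  simp

theorem shiftA_succ (v : lp (fun _ : ℕ => ℂ) 2) (n : ℕ) :
    shiftA q h0 v (n + 1) = (√(1 - q ^ (2 * (n + 1))) : ℝ) * v n := rfl

theorem shiftA'_apply (v : lp (fun _ : ℕ => ℂ) 2) (n : ℕ) :
    shiftA' q h0 v n = (√(1 - q ^ (2 * (n + 1))) : ℝ) * v (n + 1) := rfl

theorem shiftB_apply (v : lp (fun _ : ℕ => ℂ) 2) (n : ℕ) :
    shiftB q h0 h1 v n = (q ^ n : ℝ) * v n := rfl

theorem star_shiftB : star (shiftB q h0 h1) = shiftB q h0 h1 := by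
  symm
  rw [ContinuousLinearMap.star_eq_adjoint, ContinuousLinearMap.eq_adjoint_iff]
  intro v w
  rw [lp.inner_eq_tsum, lp.inner_eq_tsum]
  refine tsum_congr fun n => ?_
  rw [shiftB_apply, shiftB_apply, RCLike.inner_apply, RCLike.inner_apply, map_mul,
    Complex.conj_ofReal]
  ring

theorem star_shiftA : star (shiftA q h0) = shiftA' q h0 := by
  symm
  rw [ContinuousLinearMap.star_eq_adjoint, ContinuousLinearMap.eq_adjoint_iff]
  intro v w
  have h : HasSum (fun n => ⟪v (n + 1), shiftA q h0 w (n + 1)⟫_ℂ) ⟪v, shiftA q h0 w⟫_ℂ := by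
    let f : ℕ → ℂ := fun n => ⟪v n, shiftA q h0 w n⟫_ℂ
    have hf : HasSum f ⟪v, shiftA q h0 w⟫_ℂ := lp.hasSum_inner v (shiftA q h0 w)
    have hf0 : f 0 = 0 := by
      change ⟪v 0, shiftA q h0 w 0⟫_ℂ = 0
      rw [shiftA_zero, inner_zero_right]
    have h1 := (hasSum_nat_add_iff' (f := f) 1).2 hf
    rwa [Finset.sum_range_one, hf0, sub_zero] at h1
  refine (lp.hasSum_inner (shiftA' q h0 v) w).unique ?_
  convert! h using 2 with n
  rw [shiftA_succ, shiftA'_apply, RCLike.inner_apply, RCLike.inner_apply, map_mul,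
    Complex.conj_ofReal]
  ring

theorem ofReal_sqrt_mul_self {x : ℝ} (hx : 0 ≤ x) : ((√x : ℝ) : ℂ) * (√x : ℝ) = x := by
  rw [← Complex.ofReal_mul, Real.mul_self_sqrt hx]

theorem shift_relations :
    Relations q (shiftA q h0) (shiftA' q h0) (shiftB q h0 h1) (shiftB q h0 h1) := by
  have hs : ∀ n, ((√(1 - q ^ (2 * n)) : ℝ) : ℂ) * (√(1 - q ^ (2 * n)) : ℝ) =
      1 - (q : ℂ) ^ (2 * n) := fun n => by
    rw [ofReal_sqrt_mul_self (by linarith [pow_le_one₀ (n := 2 * n) h0 h1])]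
    push_cast; ring
  have hBA : shiftB q h0 h1 * shiftA q h0 = (q : ℂ) • (shiftA q h0 * shiftB q h0 h1) := by
    refine ContinuousLinearMap.ext fun v => lp.ext (funext fun n => ?_)
    change shiftB q h0 h1 (shiftA q h0 v) n = (q : ℂ) * shiftA q h0 (shiftB q h0 h1 v) n
    rcases n with - | n
    · rw [shiftB_apply, shiftA_zero, shiftA_zero, mul_zero, mul_zero]
    · rw [shiftB_apply, shiftA_succ, shiftA_succ, shiftB_apply]; push_cast; ring
  have hAB : shiftA' q h0 * shiftB q h0 h1 = (q : ℂ) • (shiftB q h0 h1 * shiftA' q h0) := by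
    refine ContinuousLinearMap.ext fun v => lp.ext (funext fun n => ?_)
    change shiftA' q h0 (shiftB q h0 h1 v) n = (q : ℂ) * shiftB q h0 h1 (shiftA' q h0 v) n
    rw [shiftB_apply, shiftA'_apply, shiftA'_apply, shiftB_apply]; push_cast; ring
  refine ⟨hBA, hBA, rfl, hAB, hAB, ?_, ?_⟩ <;>
    refine ContinuousLinearMap.ext fun v => lp.ext (funext fun n => ?_)
  · change shiftA' q h0 (shiftA q h0 v) n +
      (q : ℂ) ^ 2 * shiftB q h0 h1 (shiftB q h0 h1 v) n = v n
    rw [shiftA'_apply, shiftA_succ, shiftB_apply, shiftB_apply, ← mul_assoc, hs]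
    push_cast; ring
  · change shiftA q h0 (shiftA' q h0 v) n + shiftB q h0 h1 (shiftB q h0 h1 v) n = v n
    rcases n with - | n
    · rw [shiftA_zero, shiftB_apply, shiftB_apply]; simp
    · rw [shiftA_succ, shiftA'_apply, shiftB_apply, shiftB_apply, ← mul_assoc, hs]
      push_cast; ring

theorem single_ne_zero (n : ℕ) : (lp.single 2 n (1 : ℂ) : lp (fun _ : ℕ => ℂ) 2) ≠ 0 := fun h => by
  have := congrArg (fun v : lp (fun _ : ℕ => ℂ) 2 => v n) h
  simp at this

theorem shiftB_single (n : ℕ) : shiftB q h0 h1 (lp.single 2 n (1 : ℂ)) =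
    ((q ^ n : ℝ) : ℂ) • (lp.single 2 n (1 : ℂ) : lp (fun _ : ℕ => ℂ) 2) := by
  refine lp.ext (funext fun m => ?_)
  rw [shiftB_apply]
  rcases eq_or_ne m n with rfl | hmn
  · simp
  · simp [hmn]

/-- The infinite-dimensional representation on `ℓ²(ℕ)`:
`a e_n = (1 - q^{2n+2})^{1/2} e_{n+1}` and `b e_n = q^n e_n`. -/
def Rep.shift : Rep q where
  H := lp (fun _ : ℕ => ℂ) 2
  instNontrivial := ⟨lp.single 2 (0 : ℕ) (1 : ℂ), 0, single_ne_zero 0⟩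
  a := shiftA q h0
  b := shiftB q h0 h1
  rel := by rw [star_shiftA, star_shiftB]; exact shift_relations q h0 h1

end Shift

/-- The one-dimensional representations `a ↦ (1 - s²)^{1/2}`, `b ↦ s` in the classical case. -/
def Rep.point (s : ℝ) (h1 : s ^ 2 ≤ 1) : Rep 1 where
  H := ℂ
  a := ((√(1 - s ^ 2) : ℝ) : ℂ) • 1
  b := (s : ℂ) • 1
  rel := by
    have hs : ((√(1 - s ^ 2) : ℝ) : ℂ) * (√(1 - s ^ 2) : ℝ) = 1 - (s : ℂ) * s := by
      rw [ofReal_sqrt_mul_self (by linarith)]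
      push_cast; ring
    constructor <;>
      simp only [star_smul, star_one, Complex.star_def, Complex.conj_ofReal, smul_mul_smul_comm,
        mul_one, hs, Complex.ofReal_one, one_smul, one_pow] <;> module

/-- The element `bb*` of `C(SU_q(2))`. -/
def genT (q : ℝ) : CSUq q := genb q * star (genb q)

theorem eval_aeval_genT {q : ℝ} {r : Rep q} {v : r.H} {c : ℂ} (h : r.b (star r.b v) = c • v)
    (P : Polynomial ℂ) : eval r (Polynomial.aeval (genT q) P : CSUq q).1 v = P.eval c • v := by
  induction P using Polynomial.induction_on' with
  | add P Q hP hQ =>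
    rw [map_add, Polynomial.eval_add, add_smul, ← hP, ← hQ]; rfl
  | monomial n k =>
    rw [Polynomial.aeval_monomial, Polynomial.eval_monomial, ← Algebra.smul_def]
    change k • eval r ((genT q ^ n : CSUq q)).1 v = _
    rw [mul_smul]
    congr 1
    induction n with
    | zero => simp
    | succ n ih =>
      rw [pow_succ]
      change eval r ((genT q ^ n : CSUq q)).1 (r.b (star r.b v)) = _
      rw [h, map_smul, ih, smul_smul, pow_succ, mul_comm]

/-- `bb*` satisfies no polynomial equation. -/
theorem aeval_genT_injective (q : Set.Ioc (0 : ℝ) 1) {P : Polynomial ℂ}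
    (hP : Polynomial.aeval (genT q) P = 0) : P = 0 := by
  -- Every eigenvalue of `bb*` in some representation is a root of `P`. For `q < 1` the shift
  -- representation supplies the eigenvalues `q^{2n}`; for `q = 1` these collapse to `1`, and the
  -- characters with `b ↦ s` supply `s²` instead.
  have key : ∀ (r : Rep q) (v : r.H) (c : ℂ), v ≠ 0 → r.b (star r.b v) = c • v → P.eval c = 0 := by
    intro r v c hv h
    have h1 := eval_aeval_genT h P
    rw [hP] at h1
    exact (smul_eq_zero.1 (h1.symm.trans rfl)).resolve_right hv
  obtain ⟨q, hq0, hq1⟩ := q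
  rcases hq1.lt_or_eq with hlt | rfl
  · refine Polynomial.eq_zero_of_infinite_isRoot P (Set.Infinite.mono
      (s := Set.range fun n : ℕ => ((q ^ n : ℝ) : ℂ) ^ 2) ?_ ?_)
    · rintro _ ⟨n, rfl⟩
      refine key (Rep.shift q hq0.le hq1) (lp.single 2 n (1 : ℂ)) _ (single_ne_zero n) ?_
      change shiftB q hq0.le hq1 (star (shiftB q hq0.le hq1) (lp.single 2 n (1 : ℂ))) = _
      rw [star_shiftB, shiftB_single, map_smul, shiftB_single, smul_smul, ← sq]
      rfl
    · refine Set.infinite_range_of_injective fun m n h => ?_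
      simp only [← Complex.ofReal_pow, Complex.ofReal_inj] at h
      rw [← pow_mul, ← pow_mul] at h
      have := (pow_right_strictAnti₀ hq0 hlt).injective h
      omega
  · refine Polynomial.eq_zero_of_infinite_isRoot P (Set.Infinite.mono
      (s := (fun s : ℝ => (s : ℂ) ^ 2) '' Set.Icc 0 1) ?_ ?_)
    · rintro _ ⟨s, hs, rfl⟩
      have hs1 : s ^ 2 ≤ 1 := pow_le_one₀ hs.1 hs.2
      refine key (Rep.point s hs1) (show ℂ from 1) _ (one_ne_zero (α := ℂ)) ?_
      change ((s : ℂ) • (1 : ℂ →L[ℂ] ℂ)) (star ((s : ℂ) • (1 : ℂ →L[ℂ] ℂ)) 1) = _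
      rw [star_smul, star_one, Complex.star_def, Complex.conj_ofReal]
      change (s : ℂ) * ((s : ℂ) * 1) = (s : ℂ) ^ 2 * 1
      ring
    · refine Set.Infinite.image (fun x hx y hy h => ?_) (Set.Icc_infinite one_pos)
      simp only [← Complex.ofReal_pow, Complex.ofReal_inj] at h
      exact (pow_left_inj₀ hx.1 hy.1 two_ne_zero).1 h

end Representations

/-! ### Normal form `a^k b^d P(bb*)` and injectivity of `𝒪(SU_q(2)) → C(SU_q(2))`. -/

section NormalForm

open Polynomial

variable {q : ℝ}

/-- `a^k`, read as `(a*)^{-k}` for negative `k`. -/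
def apow (q : ℝ) : ℤ → Coord q
  | .ofNat n => Coord.gen q .a ^ n
  | .negSucc n => Coord.gen q .a' ^ (n + 1)

/-- `b^k`, read as `(b*)^{-k}` for negative `k`. -/
def bpow (q : ℝ) : ℤ → Coord q
  | .ofNat n => Coord.gen q .b ^ n
  | .negSucc n => Coord.gen q .b' ^ (n + 1)

/-- The element `bb*` of the coordinate algebra. -/
def coordT (q : ℝ) : Coord q := Coord.gen q .b * Coord.gen q .b'

theorem apow_natCast (n : ℕ) : apow q n = Coord.gen q .a ^ n := rfl

theorem bpow_natCast (n : ℕ) : bpow q n = Coord.gen q .b ^ n := rfl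

theorem apow_neg (n : ℕ) : apow q (-n) = Coord.gen q .a' ^ n := by
  cases n with
  | zero => exact (pow_zero _).trans (pow_zero _).symm
  | succ n => rfl

theorem bpow_neg (n : ℕ) : bpow q (-n) = Coord.gen q .b' ^ n := by
  cases n with
  | zero => exact (pow_zero _).trans (pow_zero _).symm
  | succ n => rfl

theorem commute_b_b' : Commute (Coord.gen q .b) (Coord.gen q .b') := (Coord.relations q).bb'

theorem commute_coordT_b : Commute (coordT q) (Coord.gen q .b) :=
  (Commute.refl _).mul_left commute_b_b'.symm

theorem commute_coordT_b' : Commute (coordT q) (Coord.gen q .b') :=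
  commute_b_b'.mul_left (Commute.refl _)

theorem commute_aeval {x y : Coord q} (h : Commute x y) (P : ℂ[X]) : Commute (aeval x P) y := by
  induction P using Polynomial.induction_on' with
  | add P Q hP hQ => rw [map_add]; exact hP.add_left hQ
  | monomial n c =>
    rw [aeval_monomial]
    exact Commute.mul_left (Algebra.commutes c y) (h.pow_left n)

theorem commute_coordT_bpow (d : ℤ) : Commute (coordT q) (bpow q d) := by
  rcases d with n | n
  · exact commute_coordT_b.pow_right n
  · exact commute_coordT_b'.pow_right _

theorem b_mul_bpow (d : ℤ) : ∃ Q : ℂ[X],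
    Coord.gen q .b * bpow q d = bpow q (d + 1) * aeval (coordT q) Q := by
  rcases d with n | n
  · exact ⟨1, by rw [map_one, mul_one]; exact (pow_succ' _ _).symm⟩
  · refine ⟨X, ?_⟩
    have : (Int.negSucc n) + 1 = -(n : ℤ) := by omega
    rw [this, bpow_neg, aeval_X, ← (commute_coordT_b'.pow_right n).eq]
    change _ * _ ^ (n + 1) = _
    rw [pow_succ', ← mul_assoc]; rfl

theorem b'_mul_bpow (d : ℤ) : ∃ Q : ℂ[X],
    Coord.gen q .b' * bpow q d = bpow q (d - 1) * aeval (coordT q) Q := by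
  rcases d with n | n
  · rcases n with - | n
    · exact ⟨1, by
        rw [map_one, mul_one]
        change _ * _ ^ 0 = _ ^ (0 + 1)
        rw [pow_zero, mul_one, zero_add, pow_one]⟩
    · refine ⟨X, ?_⟩
      have : Int.ofNat (n + 1) - 1 = (n : ℤ) := by simp
      rw [this, bpow_natCast, aeval_X, ← (commute_coordT_b.pow_right n).eq]
      change _ * _ ^ (n + 1) = _
      rw [pow_succ', ← mul_assoc, ← commute_b_b'.eq]; rfl
  · exact ⟨1, by rw [map_one, mul_one]; exact (pow_succ' _ _).symm⟩

theorem exists_mul_pow_comm {x y : Coord q} {c : ℂ} (h : y * x = c • (x * y)) (n : ℕ) :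
    y * x ^ n = c ^ n • (x ^ n * y) := by
  induction n with
  | zero => simp
  | succ n ih =>
    rw [pow_succ, ← mul_assoc, ih, smul_mul_assoc, mul_assoc, h, mul_smul_comm, smul_smul,
      ← pow_succ, mul_assoc]

section Invertible

variable (hq : (q : ℂ) ≠ 0)

include hq

theorem b_a' : Coord.gen q .b * Coord.gen q .a' = (q : ℂ)⁻¹ • (Coord.gen q .a' * Coord.gen q .b) := by
  rw [(Coord.relations q).a'b, inv_smul_smul₀ hq]

theorem b'_a' :
    Coord.gen q .b' * Coord.gen q .a' = (q : ℂ)⁻¹ • (Coord.gen q .a' * Coord.gen q .b') := by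
  rw [(Coord.relations q).a'b', inv_smul_smul₀ hq]

theorem b_mul_apow (k : ℤ) : ∃ c : ℂ,
    Coord.gen q .b * apow q k = c • (apow q k * Coord.gen q .b) := by
  rcases k with n | n
  · exact ⟨_, exists_mul_pow_comm (Coord.relations q).ba n⟩
  · exact ⟨_, exists_mul_pow_comm (b_a' hq) (n + 1)⟩

theorem b'_mul_apow (k : ℤ) : ∃ c : ℂ,
    Coord.gen q .b' * apow q k = c • (apow q k * Coord.gen q .b') := by
  rcases k with n | n
  · exact ⟨_, exists_mul_pow_comm (Coord.relations q).b'a n⟩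
  · exact ⟨_, exists_mul_pow_comm (b'_a' hq) (n + 1)⟩

end Invertible

/-- The elements `∑_d b^d P_d(bb*)`. -/
def normalFormB (q : ℝ) : (ℤ →₀ ℂ[X]) →ₗ[ℂ] Coord q :=
  Finsupp.lsum ℂ fun d => LinearMap.mulLeft ℂ (bpow q d) ∘ₗ (aeval (coordT q)).toLinearMap

/-- The elements `∑_{k, d} a^k b^d P_{k,d}(bb*)`. -/
def normalForm (q : ℝ) : (ℤ →₀ ℤ →₀ ℂ[X]) →ₗ[ℂ] Coord q :=
  Finsupp.lsum ℂ fun k => LinearMap.mulLeft ℂ (apow q k) ∘ₗ normalFormB q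

theorem normalFormB_single (d : ℤ) (P : ℂ[X]) :
    normalFormB q (.single d P) = bpow q d * aeval (coordT q) P := by
  rw [normalFormB, Finsupp.lsum_single]; rfl

theorem normalForm_single (k : ℤ) (f : ℤ →₀ ℂ[X]) :
    normalForm q (.single k f) = apow q k * normalFormB q f := by
  rw [normalForm, Finsupp.lsum_single]; rfl

theorem apow_mul_mem (k : ℤ) (f : ℤ →₀ ℂ[X]) :
    apow q k * normalFormB q f ∈ LinearMap.range (normalForm q) :=
  ⟨_, normalForm_single k f⟩

theorem mul_mem_range_normalForm {x : Coord q}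
    (h : ∀ k f, x * (apow q k * normalFormB q f) ∈ LinearMap.range (normalForm q)) :
    ∀ y ∈ LinearMap.range (normalForm q), x * y ∈ LinearMap.range (normalForm q) := by
  rintro _ ⟨f, rfl⟩
  induction f using Finsupp.induction_linear with
  | zero => simp
  | add f g hf hg => rw [map_add, mul_add]; exact add_mem hf hg
  | single k f => rw [normalForm_single]; exact h k f

theorem mul_normalFormB {x : Coord q} {e : ℤ}
    (h : ∀ d, ∃ Q : ℂ[X], x * bpow q d = bpow q (d + e) * aeval (coordT q) Q) (f : ℤ →₀ ℂ[X]) :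
    ∃ g, x * normalFormB q f = normalFormB q g := by
  induction f using Finsupp.induction_linear with
  | zero => exact ⟨0, by simp⟩
  | add f f' hf hf' =>
    obtain ⟨g, hg⟩ := hf
    obtain ⟨g', hg'⟩ := hf'
    exact ⟨g + g', by rw [map_add, mul_add, hg, hg', map_add]⟩
  | single d P =>
    obtain ⟨Q, hQ⟩ := h d
    exact ⟨.single (d + e) (Q * P), by
      rw [normalFormB_single, normalFormB_single, ← mul_assoc, hQ, mul_assoc, map_mul]⟩

/-- The span of normally ordered elements absorbs each generator on the left: `b` and `b*` pass
powers of `a` or `a*` up to a scalar (passing `a*` costs `q⁻¹`) and merge with `b^d` into a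
polynomial in `bb*`, while a product `aa*` or `a*a` is replaced by `1 - bb*` or `1 - q²bb*`. -/
theorem range_normalForm (hq : (q : ℂ) ≠ 0) (x : Coord q) : x ∈ LinearMap.range (normalForm q) := by
  have hb := mul_mem_range_normalForm (q := q) (x := .gen q .b) fun k f => by
    obtain ⟨c, hc⟩ := b_mul_apow hq k
    obtain ⟨g, hg⟩ := mul_normalFormB b_mul_bpow f
    rw [← mul_assoc, hc, smul_mul_assoc, mul_assoc, hg]
    exact Submodule.smul_mem _ _ (apow_mul_mem k g)
  have hb' := mul_mem_range_normalForm (q := q) (x := .gen q .b') fun k f => by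
    obtain ⟨c, hc⟩ := b'_mul_apow hq k
    obtain ⟨g, hg⟩ := mul_normalFormB b'_mul_bpow f
    rw [← mul_assoc, hc, smul_mul_assoc, mul_assoc, hg]
    exact Submodule.smul_mem _ _ (apow_mul_mem k g)
  refine Coord.mem_of_gen_mul_mem (LinearMap.range (normalForm q))
    ⟨.single 0 (.single 0 1), ?_⟩ (fun g => ?_) x
  · rw [normalForm_single, normalFormB_single, map_one, mul_one]
    exact (congrArg₂ _ (pow_zero _) (pow_zero _)).trans (one_mul _)
  cases g
  · refine mul_mem_range_normalForm fun k f => ?_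
    rcases k with n | n
    · rw [← mul_assoc]
      change _ * _ ^ n * _ ∈ _
      rw [← pow_succ']
      exact apow_mul_mem (n + 1 : ℕ) f
    · change _ * (_ ^ (n + 1) * _) ∈ _
      have h := eq_sub_of_add_eq (Coord.relations q).aa'
      rw [← mul_assoc, pow_succ', ← mul_assoc, h, mul_assoc, sub_mul, one_mul, ← apow_neg, mul_assoc]
      exact sub_mem (apow_mul_mem _ f) (hb _ (hb' _ (apow_mul_mem _ f)))
  · refine mul_mem_range_normalForm fun k f => ?_
    rcases k with (- | n) | n
    · change _ * (_ ^ 0 * _) ∈ _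
      rw [pow_zero, one_mul]
      have := apow_mul_mem (q := q) (-(1 : ℕ)) f
      rwa [apow_neg, pow_one] at this
    · change _ * (_ ^ (n + 1) * _) ∈ _
      have h := eq_sub_of_add_eq (Coord.relations q).a'a
      rw [← mul_assoc, pow_succ', ← mul_assoc, h, mul_assoc, sub_mul, one_mul, ← apow_natCast,
        smul_mul_assoc, mul_assoc]
      exact sub_mem (apow_mul_mem _ f)
        (Submodule.smul_mem _ _ (hb _ (hb' _ (apow_mul_mem _ f))))
    · change _ * (_ ^ (n + 1) * _) ∈ _
      rw [← mul_assoc, ← pow_succ']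
      exact apow_mul_mem (Int.negSucc (n + 1)) f
  · exact hb
  · exact hb'

theorem scale_apow (z w : ℂˣ) (k : ℤ) : scale q z w (apow q k) = ((z ^ k : ℂˣ) : ℂ) • apow q k := by
  rcases k with n | n
  · change scale q z w (_ ^ n) = _ • _ ^ n
    rw [map_pow, scale, Coord.lift_gen, genMap, _root_.smul_pow]
    simp
  · change scale q z w (_ ^ (n + 1)) = _ • _ ^ (n + 1)
    rw [map_pow, scale, Coord.lift_gen, genMap, _root_.smul_pow, zpow_negSucc, ← inv_pow]
    simp

theorem scale_bpow (z w : ℂˣ) (k : ℤ) : scale q z w (bpow q k) = ((w ^ k : ℂˣ) : ℂ) • bpow q k := by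
  rcases k with n | n
  · change scale q z w (_ ^ n) = _ • _ ^ n
    rw [map_pow, scale, Coord.lift_gen, genMap, _root_.smul_pow]
    simp
  · change scale q z w (_ ^ (n + 1)) = _ • _ ^ (n + 1)
    rw [map_pow, scale, Coord.lift_gen, genMap, _root_.smul_pow, zpow_negSucc, ← inv_pow]
    simp

theorem scale_coordT (z w : ℂˣ) : scale q z w (coordT q) = coordT q := by
  rw [coordT, map_mul, scale, Coord.lift_gen, Coord.lift_gen, genMap, genMap, smul_mul_smul_comm,
    Units.mul_inv, one_smul]

theorem scale_aeval_coordT (z w : ℂˣ) (P : ℂ[X]) :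
    scale q z w (aeval (coordT q) P) = aeval (coordT q) P := by
  rw [← Polynomial.aeval_algHom_apply, scale_coordT]

theorem scale_normalFormB (z : ℂˣ) (f : ℤ →₀ ℂ[X]) :
    scale q z 1 (normalFormB q f) = normalFormB q f := by
  induction f using Finsupp.induction_linear with
  | zero => simp
  | add f g hf hg => rw [map_add, map_add, hf, hg]
  | single d P => simp [normalFormB_single, scale_bpow, scale_aeval_coordT]

/-- The representation `(z a, w b)`. -/
def Rep.twist (z w : Circle) (r : Rep q) : Rep q where
  H := r.H
  a := (z : ℂ) • r.a
  b := (w : ℂ) • r.b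
  rel := by
    have hz : ∀ z : Circle, (z : ℂ) * star (z : ℂ) = 1 := fun z => by
      rw [Complex.star_def, Complex.mul_conj, Circle.normSq_coe, Complex.ofReal_one]
    have hz' : ∀ z : Circle, star (z : ℂ) * (z : ℂ) = 1 := fun z => by rw [mul_comm, hz]
    have h := r.rel
    constructor <;> simp only [star_smul, smul_mul_smul_comm, hz, hz', one_smul]
    · rw [h.ba, smul_comm, mul_comm]
    · rw [h.b'a, smul_comm, mul_comm]
    · exact h.bb'
    · rw [h.a'b', smul_comm, mul_comm]
    · rw [h.a'b, smul_comm, mul_comm]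
    · exact h.a'a
    · exact h.aa'

/-- The representation of the coordinate algebra given by a representation of the relations. -/
def Rep.coord (r : Rep q) : Coord q →ₐ[ℂ] (r.H →L[ℂ] r.H) := Coord.lift r.rel

theorem eval_toCSUq (r : Rep q) (x : Coord q) : eval r (Coord.toCSUq q x).1 = r.coord x := by
  let f : Coord q →ₐ[ℂ] (r.H →L[ℂ] r.H) :=
    ((eval r).toAlgHom.comp (suqAlg q).toSubalgebra.val).comp (Coord.toCSUq q)
  have : f = r.coord := Coord.hom_ext fun g => by
    have : f (.gen q g) = eval r (Coord.toCSUq q (.gen q g)).1 := rfl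
    rw [this, Coord.toCSUq_gen, Rep.coord, Coord.lift_gen]
    cases g <;> rfl
  exact congrArg (fun f => f x) this

theorem twist_coord (r : Rep q) (z w : Circle) (x : Coord q) :
    (r.twist z w).coord x = r.coord (scale q (Circle.toUnits z) (Circle.toUnits w) x) := by
  have hs : ∀ z : Circle, star (z : ℂ) = (z : ℂ)⁻¹ := fun z => by
    rw [← Circle.coe_inv, Circle.coe_inv_eq_conj]; rfl
  let f : Coord q →ₐ[ℂ] (r.H →L[ℂ] r.H) := (r.twist z w).coord
  have : f = r.coord.comp (scale q (Circle.toUnits z) (Circle.toUnits w)) :=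
    Coord.hom_ext fun g => by
      have hl : f (.gen q g) = genMap ((z : ℂ) • r.a) (star ((z : ℂ) • r.a)) ((w : ℂ) • r.b)
        (star ((w : ℂ) • r.b)) g := Coord.lift_gen (r.twist z w).rel g
      rw [hl, AlgHom.comp_apply, scale, Coord.lift_gen]
      cases g <;> simp only [genMap, map_smul, Rep.coord, Coord.lift_gen, star_smul, hs] <;> simp
  exact congrArg (fun f => f x) this

theorem toCSUq_eq_zero_iff (x : Coord q) : Coord.toCSUq q x = 0 ↔ ∀ r : Rep q, r.coord x = 0 := by
  constructor
  · intro h r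
    rw [← eval_toCSUq, h]; rfl
  · intro h
    exact Subtype.ext (OpFamily.ext fun r => (eval_toCSUq r x).trans (h r))

/-- The kernel is the common kernel of all representations, and twisting a representation by a point
of the two-torus gives another one. -/
theorem toCSUq_scale_eq_zero {x : Coord q} (h : Coord.toCSUq q x = 0) (z w : Circle) :
    Coord.toCSUq q (scale q (Circle.toUnits z) (Circle.toUnits w) x) = 0 := by
  rw [toCSUq_eq_zero_iff] at h ⊢
  intro r
  rw [← twist_coord]
  exact h (r.twist z w)

/-- Irrationality of `π`: a single rotation by angle `1` already separates all integer weights. -/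
theorem circle_exp_zpow_injective : Function.Injective fun k : ℤ => (Circle.exp 1 : Circle) ^ k := by
  intro k l h
  by_contra hkl
  simp only [← Circle.exp_zsmul] at h
  obtain ⟨m, hm⟩ := Circle.exp_eq_exp.1 h
  have hm0 : m ≠ 0 := by
    rintro rfl
    apply hkl
    simpa using hm
  apply irrational_pi.ne_rat ((k - l : ℤ) / (2 * m) : ℚ)
  have : (m : ℝ) ≠ 0 := by exact_mod_cast hm0
  push_cast
  field_simp
  simp at hm
  linarith

/-- Eigencomponents of an element of an invariant subspace lie in the subspace. -/
theorem mem_of_sum_eigenvectors_mem {V : Type*} [AddCommGroup V] [Module ℂ V] (T : Module.End ℂ V)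
    (K : Submodule ℂ V) (hK : ∀ x ∈ K, T x ∈ K) (μ : ℤ → ℂ) (hμ : Function.Injective μ)
    (s : Finset ℤ) (u : ℤ → V) (hu : ∀ k ∈ s, T (u k) = μ k • u k) (hs : ∑ k ∈ s, u k ∈ K) :
    ∀ k ∈ s, u k ∈ K := by
  intro k hk
  let T' : Module.End ℂ (V ⧸ K) := K.mapQ K T hK
  have hT' : ∀ x, T' (K.mkQ x) = K.mkQ (T x) := fun x => K.mapQ_apply K T x
  have hmem : ∀ j ∈ s, K.mkQ (u j) ∈ T'.eigenspace (μ j) := fun j hj => by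
    rw [Module.End.mem_eigenspace_iff, hT', hu j hj, map_smul]
  have hsum : K.mkQ (u k) = -∑ j ∈ s.erase k, K.mkQ (u j) := by
    rw [eq_neg_iff_add_eq_zero, Finset.add_sum_erase s (fun j => K.mkQ (u j)) hk, ← map_sum]
    exact (Submodule.Quotient.mk_eq_zero K).2 hs
  have h0 : K.mkQ (u k) = 0 := by
    refine Submodule.disjoint_def.1 ((Module.End.eigenspaces_iSupIndep T') (μ k)) _ (hmem k hk) ?_
    rw [hsum]
    refine neg_mem (sum_mem fun j hj => ?_)
    have hj' := Finset.mem_erase.1 hj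
    exact Submodule.mem_iSup_of_mem (μ j) (Submodule.mem_iSup_of_mem (hμ.ne hj'.1) (hmem j hj'.2))
  exact (Submodule.Quotient.mk_eq_zero K).1 h0

/-- Collapsing the innermost pair repeatedly gives a product of factors `1 - d c^j X`, where `c` is
the scalar for moving `bb*` past the right factor. The value `1` at `0` shows that it is nonzero. -/
theorem exists_apow_mul_apow (hq : (q : ℂ) ≠ 0) (k : ℤ) : ∃ R : ℂ[X], R ≠ 0 ∧
    apow q (-k) * apow q k = aeval (coordT q) R := by
  have key : ∀ (x y : Coord q) (c d : ℂ), coordT q * y = c • (y * coordT q) →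
      x * y = 1 - d • coordT q → ∀ n : ℕ, ∃ R : ℂ[X], R.eval 0 = 1 ∧
        x ^ n * y ^ n = aeval (coordT q) R := by
    intro x y c d hc hd n
    induction n with
    | zero => exact ⟨1, by simp, by simp⟩
    | succ n ih =>
      obtain ⟨R, hR, h⟩ := ih
      refine ⟨R * (1 - C (d * c ^ n) * X), by simp [hR], ?_⟩
      rw [pow_succ x, pow_succ' y, mul_assoc, ← mul_assoc x, hd, sub_mul, one_mul, mul_sub, h,
        smul_mul_assoc, exists_mul_pow_comm hc, smul_smul, mul_smul_comm, ← mul_assoc, h]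
      simp only [map_mul, map_sub, aeval_C, aeval_X, mul_sub, mul_one, Algebra.smul_def]
      congr 1
      rw [← map_mul, ← mul_assoc, Algebra.commutes, mul_assoc]
  have hne : ∀ R : ℂ[X], R.eval 0 = 1 → R ≠ 0 := by rintro R hR rfl; simp at hR
  have h := Coord.relations q
  rcases k with n | n
  · obtain ⟨R, hR, e⟩ := key (.gen q .a') (.gen q .a) (q ^ 2) (q ^ 2) (by
      rw [coordT, mul_assoc, h.b'a, mul_smul_comm, ← mul_assoc, h.ba, smul_mul_assoc, smul_smul,
        mul_assoc, ← sq]) (eq_sub_of_add_eq h.a'a) n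
    refine ⟨R, hne R hR, ?_⟩
    rw [← e, ← apow_neg]
    rfl
  · obtain ⟨R, hR, e⟩ := key (.gen q .a) (.gen q .a') ((q : ℂ)⁻¹ ^ 2) 1 (by
      rw [coordT, mul_assoc, b'_a' hq, mul_smul_comm, ← mul_assoc, b_a' hq, smul_mul_assoc,
        smul_smul, mul_assoc, ← sq]) (by rw [one_smul]; exact eq_sub_of_add_eq h.aa') (n + 1)
    refine ⟨R, hne R hR, ?_⟩
    rw [← e]
    rfl

theorem bpow_neg_mul_bpow (d : ℤ) : bpow q (-d) * bpow q d = coordT q ^ d.natAbs := by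
  rcases d with n | n
  · change bpow q (-(n : ℤ)) * _ ^ n = coordT q ^ n
    rw [bpow_neg, coordT, commute_b_b'.eq, commute_b_b'.symm.mul_pow]
  · change _ ^ (n + 1) * _ ^ (n + 1) = coordT q ^ (n + 1)
    rw [coordT, commute_b_b'.mul_pow]

theorem toCSUq_aeval_coordT (P : ℂ[X]) :
    Coord.toCSUq q (aeval (coordT q) P) = aeval (genT q) P := by
  rw [← Polynomial.aeval_algHom_apply, coordT, map_mul, Coord.toCSUq_gen, Coord.toCSUq_gen]
  rfl

/-- The coordinate algebra embeds into `C(SU_q(2))`. -/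
theorem toCSUq_injective (q : Set.Ioc (0 : ℝ) 1) : Function.Injective (Coord.toCSUq q) := by
  have hq : ((q : ℝ) : ℂ) ≠ 0 := Complex.ofReal_ne_zero.2 q.2.1.ne'
  rw [injective_iff_map_eq_zero]
  intro x hx
  obtain ⟨f, rfl⟩ := range_normalForm hq x
  suffices hf : f = 0 by rw [hf, map_zero]
  let ζ : ℤ → ℂ := fun k => ((Circle.exp 1 ^ k : Circle) : ℂ)
  have hζ : Function.Injective ζ := Subtype.val_injective.comp circle_exp_zpow_injective
  let K : Submodule ℂ (Coord q) := LinearMap.ker (Coord.toCSUq q).toLinearMap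
  -- The kernel is invariant under rotating `a` alone, so it contains every component of fixed
  -- `a`-weight; rotating `b` alone then isolates single terms `a^k b^d P(bb*)`.
  have h1 : ∀ k ∈ f.support, apow q k * normalFormB q (f k) ∈ K := by
    refine mem_of_sum_eigenvectors_mem (scale q (Circle.toUnits (Circle.exp 1)) 1).toLinearMap K
      (fun x hx => ?_) ζ hζ f.support _ (fun k _ => ?_) ?_
    · have := toCSUq_scale_eq_zero (x := x) hx (Circle.exp 1) 1
      rwa [map_one Circle.toUnits] at this
    · change scale q _ 1 (_ * _) = _
      rw [map_mul, scale_apow, scale_normalFormB, smul_mul_assoc, ← map_zpow]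
      rfl
    · have h : ∑ k ∈ f.support, apow q k * normalFormB q (f k) = normalForm q f := by
        rw [normalForm, Finsupp.lsum_apply]; rfl
      rw [h]
      exact hx
  have h2 : ∀ k, ∀ d ∈ (f k).support, apow q k * (bpow q d * aeval (coordT q) (f k d)) ∈ K := by
    intro k
    by_cases hk : k ∈ f.support
    · refine mem_of_sum_eigenvectors_mem (scale q 1 (Circle.toUnits (Circle.exp 1))).toLinearMap K
        (fun x hx => ?_) ζ hζ (f k).support _ (fun d _ => ?_) ?_
      · have := toCSUq_scale_eq_zero (x := x) hx 1 (Circle.exp 1)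
        rwa [map_one Circle.toUnits] at this
      · change scale q 1 _ (_ * _) = _
        rw [map_mul, map_mul, scale_apow, scale_bpow, scale_aeval_coordT, one_zpow, Units.val_one,
          one_smul, smul_mul_assoc, mul_smul_comm, ← map_zpow]
        rfl
      · have h : ∑ d ∈ (f k).support, apow q k * (bpow q d * aeval (coordT q) (f k d)) =
            apow q k * normalFormB q (f k) := by
          rw [normalFormB, Finsupp.lsum_apply, Finsupp.sum, Finset.mul_sum]; rfl
        rw [h]
        exact h1 k hk
    · rw [Finsupp.notMem_support_iff.1 hk]
      intro d hd
      simp at hd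
  ext1 k
  ext1 d
  by_contra hne
  have hd : d ∈ (f k).support := Finsupp.mem_support_iff.2 hne
  -- Left multiplication by the opposite powers turns the isolated term into a polynomial in `bb*`;
  -- its extra factors `R` and `X^{|d|}` are nonzero, so the coefficient itself must vanish.
  obtain ⟨R, hR, hk⟩ := exists_apow_mul_apow (q := q) hq k
  have h3 : bpow q (-d) * (apow q (-k) * (apow q k * (bpow q d * aeval (coordT q) (f k d)))) =
      aeval (coordT q) (R * X ^ d.natAbs * f k d) := by
    rw [← mul_assoc (apow q (-k)), hk, ← mul_assoc, ← mul_assoc,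
      ← (commute_aeval (commute_coordT_bpow (-d)) R).eq, mul_assoc (aeval (coordT q) R),
      bpow_neg_mul_bpow, map_mul, map_mul, map_pow, aeval_X]
  have h4 : Coord.toCSUq q (aeval (coordT q) (R * X ^ d.natAbs * f k d)) = 0 := by
    have h5 : Coord.toCSUq q (apow q k * (bpow q d * aeval (coordT q) (f k d))) = 0 := h2 k d hd
    rw [← h3, map_mul, map_mul _ (apow q (-k)), h5, mul_zero, mul_zero]
  rw [toCSUq_aeval_coordT] at h4
  have h6 := aeval_genT_injective q h4
  simp only [mul_eq_zero, hR, pow_eq_zero_iff', X_ne_zero, false_and, false_or, or_false] at h6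
  exact hne h6

end NormalForm

/-! ### Slice maps on the coordinate algebra, density and separability. -/

section Slices

variable {q : ℝ}

/-- The embedding of the algebraic tensor square of the coordinate algebra into
`C(SU_q(2)) ⊗_min C(SU_q(2))`. -/
def coordTensor (q : ℝ) : Coord q ⊗[ℂ] Coord q →ₗ[ℂ] minTensor q :=
  TensorProduct.lift (LinearMap.mk₂ ℂ
    (fun x y => ⟨elemTensor (Coord.toCSUq q x) (Coord.toCSUq q y), elemTensor_mem _ _⟩)
    (fun x x' y => Subtype.ext (OpFamily.ext fun p => by
      rw [map_add]
      exact LinearMap.map_add₂ opTensorₗ _ _ _))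
    (fun c x y => Subtype.ext (OpFamily.ext fun p => by
      rw [map_smul]
      exact LinearMap.map_smul₂ opTensorₗ _ _ _))
    (fun x y y' => Subtype.ext (OpFamily.ext fun p => by
      rw [map_add]
      exact map_add (opTensorₗ _) _ _))
    (fun c x y => Subtype.ext (OpFamily.ext fun p => by
      rw [map_smul]
      exact map_smul (opTensorₗ _) _ _)))

theorem coordTensor_tmul (x y : Coord q) : coordTensor q (x ⊗ₜ y) =
    ⟨elemTensor (Coord.toCSUq q x) (Coord.toCSUq q y), elemTensor_mem _ _⟩ := rfl

theorem prod_coord (r s : Rep q) (x : Coord q) : (r.prod s).coord x =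
    opTensorHom (Algebra.TensorProduct.map r.coord s.coord (Coord.comul q x)) := by
  let f : Coord q →ₐ[ℂ] (HTensor r.H s.H →L[ℂ] HTensor r.H s.H) := (r.prod s).coord
  have : f = (opTensorHom.comp (Algebra.TensorProduct.map r.coord s.coord)).comp
      (Coord.comul q) := Coord.hom_ext fun g => by
    have hl : f (.gen q g) = genMap (r.prod s).a (star (r.prod s).a) (r.prod s).b
      (star (r.prod s).b) g := Coord.lift_gen (r.prod s).rel g
    have hop : ∀ S T, opTensorHom (S ⊗ₜ[ℂ] T) = opTensor (H := r.H) (K := s.H) S T := fun S T => rfl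
    have ha : star (r.prod s).a = opTensor (star r.a) (star s.a) -
        (q : ℂ) • opTensor r.b (star s.b) := by
      change star (opTensor r.a s.a - (q : ℂ) • opTensor (star r.b) s.b) = _
      rw [star_sub, star_smul, star_opTensor, star_opTensor, star_star, Complex.star_def,
        Complex.conj_ofReal]
    have hb : star (r.prod s).b = opTensor (star r.b) (star s.a) + opTensor r.a (star s.b) := by
      change star (opTensor r.b s.a + opTensor (star r.a) s.b) = _
      rw [star_add, star_opTensor, star_opTensor, star_star]
    rw [hl, AlgHom.comp_apply, AlgHom.comp_apply, Coord.comul_gen]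
    cases g <;> simp only [genMap, map_add, map_sub, map_smul, Algebra.TensorProduct.map_tmul, hop,
      Rep.coord, Coord.lift_gen, ha, hb] <;> rfl
  exact congrArg (fun f => f x) this

theorem eval_coordTensor (p : Rep q × Rep q) (t : Coord q ⊗[ℂ] Coord q) :
    eval p (coordTensor q t).1 =
      opTensorHom (Algebra.TensorProduct.map p.1.coord p.2.coord t) := by
  induction t with
  | zero => rw [map_zero, map_zero, map_zero]; rfl
  | add s t hs ht => rw [map_add, map_add, map_add, ← hs, ← ht]; rfl
  | tmul x y =>
    rw [Algebra.TensorProduct.map_tmul, ← eval_toCSUq, ← eval_toCSUq]; rfl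

/-- At a pair of representations `Δ(x)` is the value of `x` at their tensor product, so the analytic
and algebraic comultiplications are compared pair by pair. -/
theorem comul_toCSUq (x : Coord q) :
    comul q (Coord.toCSUq q x) = coordTensor q (Coord.comul q x) :=
  Subtype.ext (OpFamily.ext fun p => by
    rw [eval_coordTensor, ← prod_coord]
    exact eval_toCSUq (p.1.prod p.2) x)

/-- The restriction of a functional to the coordinate algebra. -/
def onCoord (φ : CSUq q →L[ℂ] ℂ) : Coord q →ₗ[ℂ] ℂ := φ.toLinearMap ∘ₗ (Coord.toCSUq q).toLinearMap

theorem onCoord_apply (φ : CSUq q →L[ℂ] ℂ) (x : Coord q) : onCoord φ x = φ (Coord.toCSUq q x) := rfl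

/-- The bridge between analysis and algebra: identities for slices of `Δ` are checked here and
extended by density with `ext_toCSUq`. -/
theorem slice_comul_toCSUq (φ : CSUq q →L[ℂ] ℂ) (x : Coord q) :
    slice φ (comul q (Coord.toCSUq q x)) = Coord.toCSUq q (leftAction (onCoord φ) x) := by
  rw [comul_toCSUq, leftAction_apply]
  generalize Coord.comul q x = t
  induction t with
  | zero => simp
  | add s t hs ht => simp only [map_add, hs, ht]
  | tmul x y => rw [coordTensor_tmul, slice_elem]; simp [onCoord_apply]

/-- The vector functional `x ↦ ⟪ξ, x(r) η⟫`. -/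
def vecFun (r : Rep q) (ξ η : r.H) : CSUq q →L[ℂ] ℂ :=
  LinearMap.mkContinuous
    { toFun := fun x => ⟪ξ, eval r x.1 η⟫_ℂ
      map_add' := fun x y => inner_add_right ξ (eval r x.1 η) (eval r y.1 η)
      map_smul' := fun c x => inner_smul_right ξ (eval r x.1 η) c }
    (‖ξ‖ * ‖η‖) fun x => by
      calc ‖⟪ξ, eval r x.1 η⟫_ℂ‖ ≤ ‖ξ‖ * ‖eval r x.1 η‖ := norm_inner_le_norm _ _
        _ ≤ ‖ξ‖ * (‖x‖ * ‖η‖) := by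
          gcongr
          exact (ContinuousLinearMap.le_opNorm _ _).trans
            (mul_le_mul_of_nonneg_right (norm_eval_le x.1 r) (norm_nonneg _))
        _ = ‖ξ‖ * ‖η‖ * ‖x‖ := by ring

theorem vecFun_apply (r : Rep q) (ξ η : r.H) (x : CSUq q) : vecFun r ξ η x = ⟪ξ, eval r x.1 η⟫_ℂ :=
  rfl

theorem norm_vecFun_apply_le (r : Rep q) (ξ η : r.H) (x : CSUq q) :
    ‖vecFun r ξ η x‖ ≤ ‖ξ‖ * ‖η‖ * ‖x‖ :=
  ContinuousLinearMap.le_of_opNorm_le _ (LinearMap.mkContinuous_norm_le _ (by positivity) _) x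

theorem vecFun_slice (r : Rep q) (ξ η : r.H) (φ : CSUq q →L[ℂ] ℂ) (z : minTensor q) :
    vecFun r ξ η (slice φ z) = φ (vecSlice r ξ η z) :=
  inner_sliceOp φ z r ξ η

/-- The slice by a vector functional in the first leg, as a bounded linear map. -/
def vecSliceL (r : Rep q) (ξ η : r.H) : minTensor q →L[ℂ] CSUq q :=
  LinearMap.mkContinuous
    { toFun := vecSlice r ξ η
      map_add' := fun z w => Subtype.ext (map_add (sliceAmbient r ξ η) z.1 w.1)
      map_smul' := fun c z => Subtype.ext (map_smul (sliceAmbient r ξ η) c z.1) }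
    (‖ξ‖ * ‖η‖) fun z => norm_vecSlice_le r ξ η z

theorem vecSliceL_apply (r : Rep q) (ξ η : r.H) (z : minTensor q) :
    vecSliceL r ξ η z = vecSlice r ξ η z := rfl

theorem vecSlice_comul_toCSUq (r : Rep q) (ξ η : r.H) (x : Coord q) :
    vecSlice r ξ η (comul q (Coord.toCSUq q x)) =
      Coord.toCSUq q (rightAction (onCoord (vecFun r ξ η)) x) := by
  rw [comul_toCSUq, rightAction_apply, ← vecSliceL_apply]
  generalize Coord.comul q x = t
  induction t with
  | zero => simp
  | add s t hs ht => simp only [map_add, hs, ht]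
  | tmul x y =>
    rw [LinearMap.rTensor_tmul, TensorProduct.lid_tmul, map_smul]
    exact Subtype.ext (sliceAmbient_elem r ξ η _ _)

/-- The comultiplication as a bounded linear map. -/
def comulL (q : ℝ) : CSUq q →L[ℂ] minTensor q :=
  LinearMap.mkContinuous (comul q).toAlgHom.toLinearMap 1 fun x => by
    rw [one_mul]
    exact NonUnitalStarAlgHom.norm_apply_le (comul q) x

theorem comulL_apply (x : CSUq q) : comulL q x = comul q x := rfl

theorem norm_slice_apply_le {φ : CSUq q →L[ℂ] ℂ} {C : ℝ} (hC : 0 ≤ C) (h : ∀ x, ‖φ x‖ ≤ C * ‖x‖)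
    (z : minTensor q) : ‖slice φ z‖ ≤ C * ‖z‖ :=
  OpFamily.norm_le (by positivity) fun r => (norm_sliceOp_le φ z r).trans
    (mul_le_mul_of_nonneg_right (ContinuousLinearMap.opNorm_le_bound _ hC h) (norm_nonneg _))

theorem norm_comul_le (x : CSUq q) : ‖comul q x‖ ≤ ‖x‖ :=
  NonUnitalStarAlgHom.norm_apply_le (comul q) x

/-- An identity between bounded linear maps on `C(SU_q(2))` may be checked on the coordinate
algebra. -/
theorem ext_toCSUq {F : Type*} [TopologicalSpace F] [T2Space F] {f g : CSUq q → F}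
    (hf : Continuous f) (hg : Continuous g)
    (h : ∀ x, f (Coord.toCSUq q x) = g (Coord.toCSUq q x)) (x : CSUq q) : f x = g x :=
  closure_minimal (s := Set.range (Coord.toCSUq q)) (t := {x | f x = g x})
    (by rintro _ ⟨x, rfl⟩; exact h x) (isClosed_eq hf hg) (dense_coord x)

/-- Words in four letters are countable and span the dense coordinate algebra. Separability lets a
countable combination of vector states be faithful. -/
instance : TopologicalSpace.SeparableSpace (CSUq q) := by
  have hc : (Set.range fun l : List Gen => (l.map (Coord.gen q)).prod).Countable := by
    have : Function.Surjective ![Gen.a, Gen.a', Gen.b, Gen.b'] := by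
      intro g
      cases g
      exacts [⟨0, rfl⟩, ⟨1, rfl⟩, ⟨2, rfl⟩, ⟨3, rfl⟩]
    have : Countable Gen := this.countable
    exact Set.countable_range _
  have htop : ∀ x : Coord q,
      x ∈ Submodule.span ℂ (Set.range fun l : List Gen => (l.map (Coord.gen q)).prod) := by
    refine Coord.mem_of_gen_mul_mem _ (Submodule.subset_span ⟨[], rfl⟩) fun g x hx => ?_
    induction hx using Submodule.span_induction with
    | mem x hx =>
      obtain ⟨l, rfl⟩ := hx
      exact Submodule.subset_span ⟨g :: l, by simp⟩
    | zero => rw [mul_zero]; exact zero_mem _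
    | add x y _ _ hx hy => rw [mul_add]; exact add_mem hx hy
    | smul c x _ hx => rw [mul_smul_comm]; exact Submodule.smul_mem _ _ hx
  have hs : TopologicalSpace.IsSeparable (Set.range (Coord.toCSUq q)) := by
    refine ((hc.image (Coord.toCSUq q)).isSeparable.span (R := ℂ)).mono ?_
    rintro _ ⟨x, rfl⟩
    have := Submodule.mem_map_of_mem (f := (Coord.toCSUq q).toLinearMap) (htop x)
    rwa [Submodule.map_span] at this
  rw [← TopologicalSpace.isSeparable_univ_iff]
  exact hs.closure.mono fun x _ => dense_coord x

end Slices

/-! ### A faithful state on `C(SU_q(2))`. -/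

section FaithfulState

variable {q : ℝ}

/-- An element of `C(SU_q(2))` that is positive in every representation. -/
def PointwiseNonneg (x : CSUq q) : Prop := ∀ (r : Rep q) (v : r.H), 0 ≤ ⟪v, eval r x.1 v⟫_ℂ

theorem pointwiseNonneg_star_mul_self (x : CSUq q) : PointwiseNonneg (star x * x) := fun r v => by
  have h : eval r (star x * x : CSUq q).1 = star (eval r x.1) * eval r x.1 := rfl
  rw [h, mul_apply_eq_comp, ContinuousLinearMap.star_eq_adjoint,
    ContinuousLinearMap.adjoint_inner_right, inner_self_eq_norm_sq_to_K]
  positivity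

/-- The norm is a supremum over representations and unit vectors that need not be attained; the
factor `1/2` leaves room. The trivial representation supplies a unit vector when `x = 0`. -/
theorem exists_norming_vector (x : CSUq q) :
    ∃ (r : Rep q) (ξ : r.H), ‖ξ‖ = 1 ∧ ‖x‖ / 2 ≤ ‖eval r x.1 ξ‖ := by
  by_contra! hcon
  have h1 : ‖x‖ ≤ ‖x‖ / 2 := by
    refine OpFamily.norm_le (by positivity) fun r => ?_
    refine ContinuousLinearMap.opNorm_le_bound _ (by positivity) fun v => ?_
    rcases eq_or_ne v 0 with rfl | hv
    · simp
    have hv' : (‖v‖ : ℂ) ≠ 0 := by simpa using hv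
    have h2 := hcon r ((‖v‖ : ℂ)⁻¹ • v) (by rw [norm_smul]; simp [hv])
    rw [map_smul, norm_smul, norm_inv, Complex.norm_real, norm_norm,
      inv_mul_lt_iff₀ (norm_pos_iff.2 hv), mul_comm] at h2
    exact h2.le
  have hx : ‖x‖ / 2 ≤ 0 := by linarith
  exact absurd (hcon (Rep.triv q) (show ℂ from 1) (norm_one (α := ℂ)))
    (not_lt.2 (hx.trans (norm_nonneg _)))

/-- `C(SU_q(2))` has a faithful state. -/
theorem exists_faithful_state (q : ℝ) : ∃ ω : CSUq q →L[ℂ] ℂ, (∀ x, ‖ω x‖ ≤ ‖x‖) ∧ ω 1 = 1 ∧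
    (∀ x, PointwiseNonneg x → 0 ≤ ω x) ∧ (∀ x, ω (star x) = star (ω x)) ∧
    ∀ x, ω (star x * x) = 0 → x = 0 := by
  let d : ℕ → CSUq q := TopologicalSpace.denseSeq (CSUq q)
  choose r ξ hξ hd using fun n => exists_norming_vector (d n)
  -- The weights `2^{-(n+1)}` sum to `1`, so the combination of vector states is a state.
  let c : ℕ → ℂ := fun n => ((1 / 2 / 2 ^ n : ℝ) : ℂ)
  have hc : ∀ x n, ‖c n * vecFun (r n) (ξ n) (ξ n) x‖ ≤ ‖x‖ / 2 / 2 ^ n := fun x n => by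
    rw [norm_mul, Complex.norm_real, Real.norm_of_nonneg (by positivity)]
    calc 1 / 2 / 2 ^ n * ‖vecFun (r n) (ξ n) (ξ n) x‖ ≤ 1 / 2 / 2 ^ n * (1 * 1 * ‖x‖) := by
          gcongr
          have := norm_vecFun_apply_le (r n) (ξ n) (ξ n) x
          rwa [hξ] at this
      _ = ‖x‖ / 2 / 2 ^ n := by ring
  have hs : ∀ x, Summable fun n => c n * vecFun (r n) (ξ n) (ξ n) x := fun x =>
    Summable.of_norm_bounded (hasSum_geometric_two' ‖x‖).summable (hc x)
  have hb : ∀ x, ‖∑' n, c n * vecFun (r n) (ξ n) (ξ n) x‖ ≤ ‖x‖ := fun x =>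
    tsum_of_norm_bounded (hasSum_geometric_two' ‖x‖) (hc x)
  let ω : CSUq q →L[ℂ] ℂ := LinearMap.mkContinuous
    { toFun := fun x => ∑' n, c n * vecFun (r n) (ξ n) (ξ n) x
      map_add' := fun x y => by
        rw [← (hs x).tsum_add (hs y)]
        simp only [map_add, mul_add]
      map_smul' := fun k x => by
        rw [RingHom.id_apply, ← tsum_const_smul'']
        simp only [map_smul, smul_eq_mul, mul_left_comm] }
    1 fun x => by rw [one_mul]; exact hb x
  have hω : ∀ x, HasSum (fun n => c n * ⟪ξ n, eval (r n) x.1 (ξ n)⟫_ℂ) (ω x) := fun x =>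
    (hs x).hasSum
  have hpos : ∀ x, PointwiseNonneg x → ∀ n, 0 ≤ c n * ⟪ξ n, eval (r n) x.1 (ξ n)⟫_ℂ :=
    fun x hx n => mul_nonneg (Complex.zero_le_real.2 (by positivity)) (hx _ _)
  refine ⟨ω, hb, ?_, fun x hx => (hω x).nonneg (hpos x hx), fun x => ?_, fun x hx => ?_⟩
  · have h1 : HasSum c 1 := by
      have h := Complex.hasSum_ofReal.2 (hasSum_geometric_two' 1)
      rw [Complex.ofReal_one] at h
      exact h
    refine (hω 1).unique ?_
    convert! h1 using 2 with n
    have : ⟪ξ n, eval (r n) (1 : CSUq q).1 (ξ n)⟫_ℂ = ⟪ξ n, ξ n⟫_ℂ := rfl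
    rw [this, inner_self_eq_norm_sq_to_K, hξ]
    simp
  · refine (hω (star x)).unique ?_
    have h := (hω x).star
    convert! h using 2 with n
    have : eval (r n) (star x : CSUq q).1 = star (eval (r n) x.1) := rfl
    rw [this, ContinuousLinearMap.star_eq_adjoint, ContinuousLinearMap.adjoint_inner_right, star_mul',
      Complex.star_def, inner_conj_symm, Complex.conj_ofReal]
  · have h0 : ∀ n, eval (r n) x.1 (ξ n) = 0 := fun n => by
      have h1 := (hasSum_zero_iff_of_nonneg (hpos _ (pointwiseNonneg_star_mul_self x))).1
        (hx ▸ hω (star x * x))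
      have h2 := congrFun h1 n
      have hcn : c n ≠ 0 := Complex.ofReal_ne_zero.2 (by positivity)
      have h3 := (mul_eq_zero.1 h2).resolve_left hcn
      have h : eval (r n) (star x * x : CSUq q).1 = star (eval (r n) x.1) * eval (r n) x.1 := rfl
      rw [h, mul_apply_eq_comp, ContinuousLinearMap.star_eq_adjoint,
        ContinuousLinearMap.adjoint_inner_right] at h3
      exact inner_self_eq_zero.1 h3
    by_contra hne
    -- With `d n` within `‖x‖/4` of `x` and `x ξ_n = 0`, one gets `‖d n‖/2 ≤ ‖(d n) ξ_n‖ ≤ ‖x - d n‖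
    -- < ‖x‖/4`. Then `‖x‖ ≤ ‖x - d n‖ + ‖d n‖ < ¾‖x‖`, a contradiction.
    have hε : 0 < ‖x‖ / 4 := by
      have := norm_pos_iff.2 hne
      positivity
    obtain ⟨_, ⟨n, rfl⟩, hn⟩ :=
      Metric.mem_closure_iff.1 (TopologicalSpace.denseRange_denseSeq (CSUq q) x) _ hε
    rw [dist_eq_norm] at hn
    change ‖x - d n‖ < _ at hn
    have h4 : ‖eval (r n) (d n).1 (ξ n)‖ ≤ ‖x - d n‖ := by
      have h5 : eval (r n) (x - d n).1 (ξ n) = - eval (r n) (d n).1 (ξ n) := by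
        have : eval (r n) (x - d n).1 (ξ n) = eval (r n) x.1 (ξ n) - eval (r n) (d n).1 (ξ n) := rfl
        rw [this, h0, zero_sub]
      rw [← norm_neg, ← h5]
      refine (ContinuousLinearMap.le_opNorm _ _).trans ?_
      rw [hξ, mul_one]
      exact norm_eval_le _ _
    have h6 : ‖x‖ ≤ ‖x - d n‖ + ‖d n‖ := by
      simpa using norm_add_le (x - d n) (d n)
    have h7 := hd n
    linarith

end FaithfulState

/-! ### Unitary matrix corepresentations and vectors fixed by `ω(V)`. -/

section Corepresentations

variable {q : ℝ}

/-- A unitary matrix corepresentation with coefficients in the coordinate algebra. -/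
structure IsUnitaryCorep {ι : Type} [Fintype ι] [DecidableEq ι] (v : Matrix ι ι (Coord q)) :
    Prop where
  comul : ∀ i j, Coord.comul q (v i j) = ∑ k, v i k ⊗ₜ[ℂ] v k j
  star_mul : ∀ i j, ∑ k, star (Coord.toCSUq q (v k i)) * Coord.toCSUq q (v k j) =
    if i = j then 1 else 0
  mul_star : ∀ i j, ∑ k, Coord.toCSUq q (v i k) * star (Coord.toCSUq q (v j k)) =
    if i = j then 1 else 0

/-- The fundamental corepresentation. -/
def fundCorep (q : ℝ) : Matrix (Fin 2) (Fin 2) (Coord q) :=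
  !![Coord.gen q .a, (-1 : ℂ) • Coord.gen q .b'; (q : ℂ) • Coord.gen q .b, Coord.gen q .a']

theorem isUnitaryCorep_fund : IsUnitaryCorep (fundCorep q) where
  comul i j := by
    fin_cases i <;> fin_cases j <;>
    · simp [-Complex.coe_smul, -neg_smul, fundCorep, Coord.comul_gen, genMap,
        ← TensorProduct.smul_tmul', TensorProduct.tmul_smul]
      try module
  star_mul i j := by
    have h := CSUq_relations q
    fin_cases i <;> fin_cases j <;>
      simp only [fundCorep, Fin.sum_univ_two, Fin.zero_eta, Fin.mk_one, Matrix.of_apply,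
        Matrix.cons_val', Matrix.cons_val_zero, Matrix.cons_val_one, Matrix.cons_val_fin_one,
        map_smul, Coord.toCSUq_gen, genMap, star_smul, star_star, mul_smul_comm, smul_mul_assoc,
        smul_smul, h.a'b', h.ba, ← h.bb']
    · simpa [-Complex.coe_smul, ← sq] using h.a'a
    · rw [← add_smul]; simp
    · rw [← add_smul]; simp
    · rw [add_comm]; simpa using h.aa'
  mul_star i j := by
    have h := CSUq_relations q
    fin_cases i <;> fin_cases j <;>
      simp only [fundCorep, Fin.sum_univ_two, Fin.zero_eta, Fin.mk_one, Matrix.of_apply,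
        Matrix.cons_val', Matrix.cons_val_zero, Matrix.cons_val_one, Matrix.cons_val_fin_one,
        map_smul, Coord.toCSUq_gen, genMap, star_smul, star_star, mul_smul_comm, smul_mul_assoc,
        smul_smul, h.a'b, h.b'a, ← h.bb']
    · simpa using h.aa'
    · rw [← add_smul]; simp
    · rw [← add_smul]; simp
    · rw [add_comm]; simpa [-Complex.coe_smul, ← sq] using h.a'a

theorem isUnitaryCorep_one : IsUnitaryCorep (1 : Matrix Unit Unit (Coord q)) where
  comul i j := by simp [Algebra.TensorProduct.one_def]
  star_mul i j := by simp
  mul_star i j := by simp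

/-- Coefficients of corepresentations are thereby closed under products. In `V*V` the index of `v`
is summed first and in `VV*` that of `w`, since those factors are adjacent and collapse by
unitarity. -/
theorem IsUnitaryCorep.kronecker {ι κ : Type} [Fintype ι] [DecidableEq ι] [Fintype κ]
    [DecidableEq κ] {v : Matrix ι ι (Coord q)} {w : Matrix κ κ (Coord q)} (hv : IsUnitaryCorep v)
    (hw : IsUnitaryCorep w) :
    IsUnitaryCorep (Matrix.of fun i j : ι × κ => v i.1 j.1 * w i.2 j.2) where
  comul i j := by
    simp only [Matrix.of_apply, map_mul, hv.comul, hw.comul, Finset.sum_mul_sum,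
      Algebra.TensorProduct.tmul_mul_tmul, Fintype.sum_prod_type]
  star_mul i j := by
    simp only [Matrix.of_apply, map_mul, StarMul.star_mul, Fintype.sum_prod_type]
    rw [Finset.sum_comm]
    have h : ∀ y : κ, ∑ x : ι, star (Coord.toCSUq q (w y i.2)) * star (Coord.toCSUq q (v x i.1)) *
        (Coord.toCSUq q (v x j.1) * Coord.toCSUq q (w y j.2)) =
        star (Coord.toCSUq q (w y i.2)) * (if i.1 = j.1 then 1 else 0) *
          Coord.toCSUq q (w y j.2) := fun y => by
      rw [← hv.star_mul, Finset.mul_sum, Finset.sum_mul]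
      simp only [mul_assoc]
    simp only [h, Prod.ext_iff]
    by_cases h1 : i.1 = j.1
    · simp only [h1, if_true, mul_one, hw.star_mul, true_and]
    · simp [h1]
  mul_star i j := by
    simp only [Matrix.of_apply, map_mul, StarMul.star_mul, Fintype.sum_prod_type]
    have h : ∀ x : ι, ∑ y : κ, Coord.toCSUq q (v i.1 x) * Coord.toCSUq q (w i.2 y) *
        (star (Coord.toCSUq q (w j.2 y)) * star (Coord.toCSUq q (v j.1 x))) =
        Coord.toCSUq q (v i.1 x) * (if i.2 = j.2 then 1 else 0) *
          star (Coord.toCSUq q (v j.1 x)) := fun y => by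
      rw [← hw.mul_star, Finset.mul_sum, Finset.sum_mul]
      simp only [mul_assoc]
    simp only [h, Prod.ext_iff]
    by_cases h1 : i.2 = j.2
    · simp only [h1, if_true, mul_one, hv.mul_star, and_true]
    · simp [h1]

/-- The coefficients of unitary corepresentations. -/
def coefficients (q : ℝ) : Set (Coord q) :=
  {x | ∃ (ι : Type) (_ : Fintype ι) (_ : DecidableEq ι) (v : Matrix ι ι (Coord q)),
    IsUnitaryCorep v ∧ ∃ i j, v i j = x}

/-- Each generator is a nonzero multiple of an entry of the fundamental corepresentation (for `b`
this uses `q⁻¹`), so every word is a multiple of a coefficient of a tensor power. -/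
theorem span_coefficients (hq : (q : ℂ) ≠ 0) (x : Coord q) :
    x ∈ Submodule.span ℂ (coefficients q) := by
  have hmul : ∀ i j, ∀ x ∈ Submodule.span ℂ (coefficients q),
      fundCorep q i j * x ∈ Submodule.span ℂ (coefficients q) := by
    intro i j x hx
    induction hx using Submodule.span_induction with
    | mem x hx =>
      obtain ⟨ι, _, _, v, hv, k, l, rfl⟩ := hx
      exact Submodule.subset_span ⟨_, _, _, _, isUnitaryCorep_fund.kronecker hv, (i, k), (j, l), rfl⟩
    | zero => rw [mul_zero]; exact zero_mem _
    | add x y _ _ hx hy => rw [mul_add]; exact add_mem hx hy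
    | smul c x _ hx => rw [mul_smul_comm]; exact Submodule.smul_mem _ _ hx
  refine Coord.mem_of_gen_mul_mem (Submodule.span ℂ (coefficients q))
    (Submodule.subset_span (show (1 : Coord q) ∈ coefficients q from
      ⟨Unit, inferInstance, inferInstance, 1, isUnitaryCorep_one, (), (), rfl⟩)) (fun g x hx => ?_) x
  cases g
  · exact hmul 0 0 x hx
  · exact hmul 1 1 x hx
  · have h := Submodule.smul_mem _ (q : ℂ)⁻¹ (hmul 1 0 x hx)
    rwa [← smul_mul_assoc, show (q : ℂ)⁻¹ • fundCorep q 1 0 = Coord.gen q .b from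
      inv_smul_smul₀ hq _] at h
  · have h := Submodule.smul_mem _ (-1 : ℂ) (hmul 0 1 x hx)
    rwa [← smul_mul_assoc, show (-1 : ℂ) • fundCorep q 0 1 = Coord.gen q .b' from by
      simp [fundCorep]] at h

theorem leftAction_corep {ι : Type} [Fintype ι] [DecidableEq ι] {v : Matrix ι ι (Coord q)}
    (hv : IsUnitaryCorep v) (η : Coord q →ₗ[ℂ] ℂ) (i j : ι) :
    leftAction η (v i j) = ∑ k, η (v k j) • v i k := by
  rw [leftAction_apply, hv.comul]
  simp

/-- A state that is faithful in the sense used for averaging: a contractive functional, positive on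
squares, hermitian, with trivial kernel. -/
structure IsFaithfulState (ω : CSUq q →L[ℂ] ℂ) : Prop where
  norm_le : ∀ x, ‖ω x‖ ≤ ‖x‖
  map_one : ω 1 = 1
  nonneg : ∀ x, PointwiseNonneg x → 0 ≤ ω x
  map_star : ∀ x, ω (star x) = star (ω x)
  eq_zero : ∀ x, ω (star x * x) = 0 → x = 0

theorem IsFaithfulState.variance {ω : CSUq q →L[ℂ] ℂ} (hω : IsFaithfulState ω) (y : CSUq q) :
    ω (star (y - ω y • 1) * (y - ω y • 1)) = ω (star y * y) - (‖ω y‖ ^ 2 : ℝ) := by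
  have h : star (y - ω y • 1) * (y - ω y • 1) = star y * y - ω y • star y - star (ω y) • y +
      (star (ω y) * ω y) • (1 : CSUq q) := by
    rw [star_sub, star_smul, star_one, sub_mul, mul_sub, mul_sub, smul_mul_assoc, smul_mul_assoc,
      mul_smul_comm, mul_smul_comm, one_mul, one_mul, mul_one, smul_smul]
    abel
  have h2 : star (ω y) * ω y = ((‖ω y‖ ^ 2 : ℝ) : ℂ) := by
    rw [Complex.star_def, ← Complex.normSq_eq_conj_mul_self, Complex.normSq_eq_norm_sq]
  rw [h, map_add, map_sub, map_sub, map_smul, map_smul, map_smul, hω.map_star, hω.map_one, ← h2]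
  simp only [smul_eq_mul]
  ring

variable {ι : Type} [Fintype ι] [DecidableEq ι]

/-- The vector `V ξ` with entries in `C(SU_q(2))`. -/
def corepVec (v : Matrix ι ι (Coord q)) (ξ : EuclideanSpace ℂ ι) (i : ι) : CSUq q :=
  ∑ j, ξ j • Coord.toCSUq q (v i j)

theorem sum_star_corepVec {v : Matrix ι ι (Coord q)} (hv : IsUnitaryCorep v)
    (ξ : EuclideanSpace ℂ ι) : ∑ i, star (corepVec v ξ i) * corepVec v ξ i =
      ((‖ξ‖ ^ 2 : ℝ) : ℂ) • (1 : CSUq q) := by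
  have h : ∀ i, star (corepVec v ξ i) * corepVec v ξ i = ∑ j, ∑ k, (star (ξ j) * ξ k) •
      (star (Coord.toCSUq q (v i j)) * Coord.toCSUq q (v i k)) := fun i => by
    simp only [corepVec, star_sum, Finset.sum_mul_sum, star_smul, smul_mul_smul_comm]
  simp only [h]
  rw [Finset.sum_comm]
  have h2 : ∀ j, ∑ i, ∑ k, (star (ξ j) * ξ k) •
      (star (Coord.toCSUq q (v i j)) * Coord.toCSUq q (v i k)) = (star (ξ j) * ξ j) • 1 := fun j => by
    rw [Finset.sum_comm]
    simp only [← Finset.smul_sum, hv.star_mul]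
    simp
  simp only [h2, ← Finset.sum_smul]
  congr 1
  rw [EuclideanSpace.norm_sq_eq]
  push_cast
  refine Finset.sum_congr rfl fun j _ => ?_
  rw [Complex.star_def, ← Complex.normSq_eq_conj_mul_self, Complex.normSq_eq_norm_sq]
  push_cast; rfl

/-- The matrix of values of a functional on the coefficients, as an operator. -/
def corepOp (ω : CSUq q →L[ℂ] ℂ) (v : Matrix ι ι (Coord q)) :
    EuclideanSpace ℂ ι →L[ℂ] EuclideanSpace ℂ ι :=
  Matrix.toEuclideanCLM (𝕜 := ℂ) (Matrix.of fun i j => ω (Coord.toCSUq q (v i j)))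

theorem corepOp_apply (ω : CSUq q →L[ℂ] ℂ) (v : Matrix ι ι (Coord q)) (ξ : EuclideanSpace ℂ ι)
    (i : ι) : corepOp ω v ξ i = ω (corepVec v ξ i) := by
  rw [corepVec, map_sum]
  change (Matrix.of fun i j => ω (Coord.toCSUq q (v i j))).mulVec ξ i = _
  rw [Matrix.mulVec, dotProduct]
  refine Finset.sum_congr rfl fun j _ => ?_
  rw [map_smul, smul_eq_mul, mul_comm]; rfl

/-- The variance of each entry of `Vξ` is nonnegative, and unitarity turns the sum of second moments
into `‖ξ‖²`. So `ω(V)` is a contraction; on a fixed vector all variances vanish, and faithfulness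
makes the entries of `Vξ` scalar. -/
theorem sum_variance {ω : CSUq q →L[ℂ] ℂ} (hω : IsFaithfulState ω) {v : Matrix ι ι (Coord q)}
    (hv : IsUnitaryCorep v) (ξ : EuclideanSpace ℂ ι) :
    ∑ i, ω (star (corepVec v ξ i - ω (corepVec v ξ i) • 1) *
      (corepVec v ξ i - ω (corepVec v ξ i) • 1)) =
      ((‖ξ‖ ^ 2 - ‖corepOp ω v ξ‖ ^ 2 : ℝ) : ℂ) := by
  simp only [hω.variance, Finset.sum_sub_distrib, ← map_sum, sum_star_corepVec hv, map_smul,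
    hω.map_one, smul_eq_mul, mul_one]
  rw [EuclideanSpace.norm_sq_eq (corepOp ω v ξ)]
  simp only [corepOp_apply]
  push_cast; rfl

theorem norm_corepOp_le {ω : CSUq q →L[ℂ] ℂ} (hω : IsFaithfulState ω) {v : Matrix ι ι (Coord q)}
    (hv : IsUnitaryCorep v) : ‖corepOp ω v‖ ≤ 1 := by
  refine ContinuousLinearMap.opNorm_le_bound _ zero_le_one fun ξ => ?_
  rw [one_mul]
  have h : 0 ≤ ((‖ξ‖ ^ 2 - ‖corepOp ω v ξ‖ ^ 2 : ℝ) : ℂ) := by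
    rw [← sum_variance hω hv]
    exact Finset.sum_nonneg fun i _ => hω.nonneg _ (pointwiseNonneg_star_mul_self _)
  rw [Complex.zero_le_real] at h
  exact le_of_sq_le_sq (by linarith) (norm_nonneg _)

/-- A vector fixed by `ω(V)` for a faithful state `ω` is fixed by `V`. -/
theorem corepVec_eq_of_fixed {ω : CSUq q →L[ℂ] ℂ} (hω : IsFaithfulState ω)
    {v : Matrix ι ι (Coord q)} (hv : IsUnitaryCorep v) {ξ : EuclideanSpace ℂ ι}
    (hξ : corepOp ω v ξ = ξ) (i : ι) : corepVec v ξ i = ξ i • 1 := by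
  have h := sum_variance hω hv ξ
  rw [hξ, sub_self, Complex.ofReal_zero, Finset.sum_eq_zero_iff_of_nonneg
    (fun i _ => hω.nonneg _ (pointwiseNonneg_star_mul_self _))] at h
  have h2 := sub_eq_zero.1 (hω.eq_zero _ (h i (Finset.mem_univ i)))
  rwa [← corepOp_apply, hξ] at h2

/-- The orthogonal projection onto the vectors fixed by `ω(V)`. -/
def fixedProj (ω : CSUq q →L[ℂ] ℂ) (v : Matrix ι ι (Coord q)) (ξ : EuclideanSpace ℂ ι) :
    EuclideanSpace ℂ ι :=
  ((corepOp ω v).eqLocus (1 : EuclideanSpace ℂ ι →L[ℂ] EuclideanSpace ℂ ι)).orthogonalProjectionOnto ξ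

theorem corepVec_fixedProj {ω : CSUq q →L[ℂ] ℂ} (hω : IsFaithfulState ω)
    {v : Matrix ι ι (Coord q)} (hv : IsUnitaryCorep v) (ξ : EuclideanSpace ℂ ι) (i : ι) :
    corepVec v (fixedProj ω v ξ) i = fixedProj ω v ξ i • 1 :=
  corepVec_eq_of_fixed hω hv
    (((corepOp ω v).eqLocus (1 : EuclideanSpace ℂ ι →L[ℂ] EuclideanSpace ℂ ι)).orthogonalProjectionOnto ξ).2 i

theorem inner_fixedProj (ω : CSUq q →L[ℂ] ℂ) (v : Matrix ι ι (Coord q))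
    (ξ η : EuclideanSpace ℂ ι) : ⟪fixedProj ω v ξ, η⟫_ℂ = ⟪ξ, fixedProj ω v η⟫_ℂ := by
  have := Submodule.starProjection_isSymmetric
    (K := (corepOp ω v).eqLocus (1 : EuclideanSpace ℂ ι →L[ℂ] EuclideanSpace ℂ ι)) ξ η
  exact this

/-- The matrix entries of the projection. -/
def fixedEntry (ω : CSUq q →L[ℂ] ℂ) (v : Matrix ι ι (Coord q)) (i j : ι) : ℂ :=
  fixedProj ω v (EuclideanSpace.single j 1) i

theorem star_fixedEntry (ω : CSUq q →L[ℂ] ℂ) (v : Matrix ι ι (Coord q)) (i j : ι) :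
    star (fixedEntry ω v i j) = fixedEntry ω v j i := by
  have h := inner_fixedProj ω v (EuclideanSpace.single j 1) (EuclideanSpace.single i 1)
  rw [EuclideanSpace.inner_single_left, EuclideanSpace.inner_single_right] at h
  simpa [fixedEntry] using h

theorem sum_fixedEntry_smul {ω : CSUq q →L[ℂ] ℂ} (hω : IsFaithfulState ω)
    {v : Matrix ι ι (Coord q)} (hv : IsUnitaryCorep v) (i j : ι) :
    ∑ k, fixedEntry ω v k j • Coord.toCSUq q (v i k) = fixedEntry ω v i j • 1 :=
  corepVec_fixedProj hω hv _ i

/-- From `VP = P` and `V*V = 1` follows `V*P = P`; taking adjoints, with `P = P*`, gives `PV = P`.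
This provides the invariance on the other side. -/
theorem sum_fixedEntry_smul' {ω : CSUq q →L[ℂ] ℂ} (hω : IsFaithfulState ω)
    {v : Matrix ι ι (Coord q)} (hv : IsUnitaryCorep v) (i j : ι) :
    ∑ k, fixedEntry ω v i k • Coord.toCSUq q (v k j) = fixedEntry ω v i j • 1 := by
  have h : ∀ l, ∑ k, fixedEntry ω v k i • star (Coord.toCSUq q (v k l)) = fixedEntry ω v l i • 1 := by
    intro l
    have h1 : ∀ k, fixedEntry ω v k i • star (Coord.toCSUq q (v k l)) =
        ∑ m, fixedEntry ω v m i • (star (Coord.toCSUq q (v k l)) * Coord.toCSUq q (v k m)) := by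
      intro k
      have h2 := congrArg (fun y => star (Coord.toCSUq q (v k l)) * y) (sum_fixedEntry_smul hω hv k i)
      simp only [Finset.mul_sum, mul_smul_comm, mul_one] at h2
      exact h2.symm
    simp only [h1]
    rw [Finset.sum_comm]
    simp only [← Finset.smul_sum, hv.star_mul]
    simp
  have h3 := congrArg star (h j)
  simpa only [star_sum, star_smul, star_star, star_fixedEntry, star_one] using h3

end Corepresentations

/-! ### Existence of the Haar state by averaging convolution powers. -/

section HaarExistence

variable {q : ℝ}

/-- The convolution operator `(1 ⊗ φ)Δ`. -/
def convOp (φ : CSUq q →L[ℂ] ℂ) : CSUq q →L[ℂ] CSUq q := (slice φ).comp (comulL q)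

theorem convOp_apply (φ : CSUq q →L[ℂ] ℂ) (x : CSUq q) : convOp φ x = slice φ (comul q x) := rfl

/-- The quadratic form of the slice at `w` is that of `x` at `v ⊗ w` in the tensor product
representation. -/
theorem pointwiseNonneg_vecSlice {x : CSUq q} (hx : PointwiseNonneg x) (r : Rep q) (v : r.H) :
    PointwiseNonneg (vecSlice r v v (comul q x)) := fun s w => by
  have h := inner_sliceVec (K := s.H) v v (eval (r.prod s) x.1) w w
  exact (hx (r.prod s) (insertL (K := s.H) v w)).trans_eq h.symm

theorem pointwiseNonneg_convOp {φ : CSUq q →L[ℂ] ℂ} (hφ : ∀ x, PointwiseNonneg x → 0 ≤ φ x)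
    {x : CSUq q} (hx : PointwiseNonneg x) : PointwiseNonneg (convOp φ x) := fun r v => by
  have h := vecFun_slice r v v φ (comul q x)
  rw [vecFun_apply] at h
  rw [convOp_apply, h]
  exact hφ _ (pointwiseNonneg_vecSlice hx r v)

theorem norm_convOp_apply_le {φ : CSUq q →L[ℂ] ℂ} (hφ : ∀ x, ‖φ x‖ ≤ ‖x‖) (x : CSUq q) :
    ‖convOp φ x‖ ≤ ‖x‖ := by
  have h := norm_slice_apply_le zero_le_one (by simpa using hφ) (comul q x)
  rw [one_mul] at h
  exact h.trans (norm_comul_le x)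

theorem convOp_one (φ : CSUq q →L[ℂ] ℂ) : convOp φ 1 = φ 1 • (1 : CSUq q) := by
  have h := slice_comul_toCSUq φ 1
  rw [leftAction_one, map_smul, onCoord_apply, map_one (Coord.toCSUq q)] at h
  exact h

variable {ι : Type} [Fintype ι] [DecidableEq ι]

theorem convOp_corep {v : Matrix ι ι (Coord q)} (hv : IsUnitaryCorep v) (φ : CSUq q →L[ℂ] ℂ)
    (i j : ι) : convOp φ (Coord.toCSUq q (v i j)) =
      ∑ k, φ (Coord.toCSUq q (v k j)) • Coord.toCSUq q (v i k) := by
  rw [convOp_apply, slice_comul_toCSUq, leftAction_corep hv, map_sum]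
  simp only [map_smul, onCoord_apply]

/-- On coefficients, convolution by `φ` becomes the finite matrix `φ(V)`, so convolution powers
become matrix powers. -/
theorem convOp_corepVec {v : Matrix ι ι (Coord q)} (hv : IsUnitaryCorep v) (φ : CSUq q →L[ℂ] ℂ)
    (ξ : EuclideanSpace ℂ ι) (i : ι) :
    convOp φ (corepVec v ξ i) = corepVec v (corepOp φ v ξ) i := by
  simp only [corepVec, map_sum, map_smul, convOp_corep hv, Finset.smul_sum]
  rw [Finset.sum_comm]
  refine Finset.sum_congr rfl fun k _ => ?_
  simp only [corepOp_apply, corepVec, map_sum, map_smul, Finset.sum_smul, smul_smul, smul_eq_mul]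

/-- The values `ω` takes on the Cesàro means of the convolution powers. -/
def cesaro (ω : CSUq q →L[ℂ] ℂ) (n : ℕ) (x : CSUq q) : ℂ :=
  (n : ℂ)⁻¹ * ∑ k ∈ Finset.range n, ω ((convOp ω ^ k) x)

theorem convOp_pow_corepVec {v : Matrix ι ι (Coord q)} (hv : IsUnitaryCorep v)
    (φ : CSUq q →L[ℂ] ℂ) (ξ : EuclideanSpace ℂ ι) (i : ι) (k : ℕ) :
    (convOp φ ^ k) (corepVec v ξ i) = corepVec v ((corepOp φ v)^[k] ξ) i := by
  induction k with
  | zero => simp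
  | succ k ih =>
    rw [pow_succ', mul_apply_eq_comp, ih, convOp_corepVec hv, Function.iterate_succ_apply']

theorem cesaro_corepVec {v : Matrix ι ι (Coord q)} (hv : IsUnitaryCorep v) (ω : CSUq q →L[ℂ] ℂ)
    (ξ : EuclideanSpace ℂ ι) (i : ι) (n : ℕ) : cesaro ω n (corepVec v ξ i) =
      corepOp ω v (birkhoffAverage ℂ (corepOp ω v) _root_.id n ξ) i := by
  simp only [cesaro, convOp_pow_corepVec hv, birkhoffAverage, birkhoffSum, map_smul, map_sum,
    ← corepOp_apply]
  simp

/-- The mean ergodic theorem for the contraction `ω(V)`: its Cesàro means converge to the orthogonal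
projection onto its fixed vectors. -/
theorem tendsto_cesaro {ω : CSUq q →L[ℂ] ℂ} (hω : IsFaithfulState ω) {v : Matrix ι ι (Coord q)}
    (hv : IsUnitaryCorep v) (i j : ι) : Filter.Tendsto (fun n => cesaro ω n (Coord.toCSUq q (v i j)))
      Filter.atTop (nhds (fixedEntry ω v i j)) := by
  have hvec : Coord.toCSUq q (v i j) = corepVec v (EuclideanSpace.single j 1) i := by
    simp [corepVec]
  have hlim := ContinuousLinearMap.tendsto_birkhoffAverage_orthogonalProjection (corepOp ω v)
    (norm_corepOp_le hω hv) (EuclideanSpace.single j 1)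
  have hcont : Continuous fun ξ : EuclideanSpace ℂ ι => corepOp ω v ξ i :=
    (EuclideanSpace.proj i : EuclideanSpace ℂ ι →L[ℂ] ℂ).continuous.comp (corepOp ω v).continuous
  have h := (hcont.tendsto _).comp hlim
  have hfix : corepOp ω v (fixedProj ω v (EuclideanSpace.single j 1)) =
      fixedProj ω v (EuclideanSpace.single j 1) :=
    (((corepOp ω v).eqLocus (1 : EuclideanSpace ℂ ι →L[ℂ] EuclideanSpace ℂ ι)).orthogonalProjectionOnto
      (EuclideanSpace.single j 1)).2
  have h2 : fixedEntry ω v i j = corepOp ω v (fixedProj ω v (EuclideanSpace.single j 1)) i := by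
    rw [hfix]; rfl
  rw [h2, hvec]
  simp only [cesaro_corepVec hv]
  exact h

theorem norm_cesaro_le {ω : CSUq q →L[ℂ] ℂ} (hω : IsFaithfulState ω) (n : ℕ) (x : CSUq q) :
    ‖cesaro ω n x‖ ≤ ‖x‖ := by
  have hk : ∀ k, ‖(convOp ω ^ k) x‖ ≤ ‖x‖ := fun k => by
    induction k with
    | zero => simp
    | succ k ih =>
      rw [pow_succ', mul_apply_eq_comp]
      exact (norm_convOp_apply_le hω.norm_le _).trans ih
  have h : ‖∑ k ∈ Finset.range n, ω ((convOp ω ^ k) x)‖ ≤ n * ‖x‖ :=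
    (norm_sum_le_of_le _ (n := fun _ => ‖x‖) fun k _ => (hω.norm_le _).trans (hk k)).trans (by simp)
  rw [cesaro, norm_mul, norm_inv, Complex.norm_natCast]
  rcases Nat.eq_zero_or_pos n with rfl | hn
  · simp
  · have hn' : (0 : ℝ) < n := by exact_mod_cast hn
    calc (n : ℝ)⁻¹ * _ ≤ (n : ℝ)⁻¹ * (n * ‖x‖) := by gcongr
      _ = ‖x‖ := by field_simp

theorem cesaro_nonneg {ω : CSUq q →L[ℂ] ℂ} (hω : IsFaithfulState ω) (n : ℕ) {x : CSUq q}
    (hx : PointwiseNonneg x) : 0 ≤ cesaro ω n x := by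
  have hk : ∀ k, PointwiseNonneg ((convOp ω ^ k) x) := fun k => by
    induction k with
    | zero => simpa using hx
    | succ k ih =>
      rw [pow_succ', mul_apply_eq_comp]
      exact pointwiseNonneg_convOp hω.nonneg ih
  refine mul_nonneg ?_ (Finset.sum_nonneg fun k _ => hω.nonneg _ (hk k))
  rw [← Complex.ofReal_natCast, ← Complex.ofReal_inv, Complex.zero_le_real]
  positivity

/-- The limit of the Cesàro means of a faithful state takes on a coefficient matrix `V` the value
`P`, the projection onto the fixed vectors. The relations `VP = P = PV` are its invariance on
coefficients, which span a dense subalgebra. -/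
theorem exists_isHaarState (hq : (q : ℂ) ≠ 0) : ∃ h : CSUq q →ₚ[ℂ] ℂ, IsHaarState h := by
  obtain ⟨ω, h1, h2, h3, h4, h5⟩ := exists_faithful_state q
  have hω : IsFaithfulState ω := ⟨h1, h2, h3, h4, h5⟩
  -- Compactness gives a limit along an ultrafilter for every `x`, so the functional is defined and
  -- positive on the whole C*-algebra; on coefficients it agrees with the ordinary limit.
  have hlim : ∀ x, ∃ c, Filter.Tendsto (fun n => cesaro ω n x) (Filter.hyperfilter ℕ) (nhds c) := by
    intro x
    obtain ⟨c, -, hc⟩ := (isCompact_closedBall (0 : ℂ) ‖x‖).ultrafilter_le_nhds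
      ((Filter.hyperfilter ℕ).map fun n => cesaro ω n x) (by
        rw [Filter.le_principal_iff, Ultrafilter.mem_coe, Ultrafilter.mem_map]
        exact Filter.univ_mem' fun n => mem_closedBall_zero_iff.2 (norm_cesaro_le hω n x))
    exact ⟨c, hc⟩
  choose H hH using hlim
  have hadd : ∀ x y, H (x + y) = H x + H y := fun x y => tendsto_nhds_unique (hH (x + y)) (by
    convert (hH x).add (hH y) using 2 with n
    simp only [cesaro, map_add, Finset.sum_add_distrib, mul_add])
  have hsmul : ∀ (c : ℂ) x, H (c • x) = c • H x := fun c x => tendsto_nhds_unique (hH (c • x)) (by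
    convert (hH x).const_smul c using 2 with n
    simp only [cesaro, map_smul, ← Finset.smul_sum, mul_smul_comm])
  have hnn : ∀ x, PointwiseNonneg x → 0 ≤ H x := fun x hx =>
    ge_of_tendsto (hH x) (Filter.Eventually.of_forall fun n => cesaro_nonneg hω n hx)
  let h : CSUq q →ₚ[ℂ] ℂ := PositiveLinearMap.mk₀ ⟨⟨H, hadd⟩, hsmul⟩ fun a ha => by
    obtain ⟨b, rfl⟩ := CStarAlgebra.nonneg_iff_eq_star_mul_self.1 ha
    exact hnn _ (pointwiseNonneg_star_mul_self b)
  have hh : ∀ x, h x = H x := fun x => rfl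
  have hval : ∀ {ι : Type} [Fintype ι] [DecidableEq ι] {v : Matrix ι ι (Coord q)}
      (_ : IsUnitaryCorep v) (i j : ι), h (Coord.toCSUq q (v i j)) = fixedEntry ω v i j :=
    fun hv i j => tendsto_nhds_unique (hH _)
      ((tendsto_cesaro hω hv i j).mono_left Nat.hyperfilter_le_atTop)
  have hinv : ∀ (ψ : CSUq q →L[ℂ] ℂ) (x : Coord q),
      ψ (convOp (toCLM h) (Coord.toCSUq q x)) = toCLM h (Coord.toCSUq q x) * ψ 1 ∧
      toCLM h (convOp ψ (Coord.toCSUq q x)) = toCLM h (Coord.toCSUq q x) * ψ 1 := by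
    intro ψ x
    have hx := span_coefficients hq x
    induction hx using Submodule.span_induction with
    | mem x hx =>
      obtain ⟨ι, _, _, v, hv, i, j, rfl⟩ := hx
      have hval' : ∀ i j, toCLM h (Coord.toCSUq q (v i j)) = fixedEntry ω v i j := hval hv
      rw [convOp_corep hv, convOp_corep hv]
      simp only [hval', map_sum, map_smul, smul_eq_mul]
      constructor
      · have := congrArg ψ (sum_fixedEntry_smul hω hv i j)
        simpa only [map_sum, map_smul, smul_eq_mul] using this
      · have := congrArg ψ (sum_fixedEntry_smul' hω hv i j)
        simp only [map_sum, map_smul, smul_eq_mul] at this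
        rw [← this]
        exact Finset.sum_congr rfl fun k _ => mul_comm _ _
    | zero => simp
    | add x y _ _ hx hy => simp only [map_add, hx.1, hx.2, hy.1, hy.2, add_mul, and_self]
    | smul c x _ hx => simp only [map_smul, hx.1, hx.2, smul_mul_assoc, and_self]
  refine ⟨h, ?_, fun ψ x => ⟨?_, ?_⟩⟩
  · refine tendsto_nhds_unique (hH 1) (tendsto_const_nhds.congr' ?_)
    have hk : ∀ k, (convOp ω ^ k) (1 : CSUq q) = 1 := fun k => by
      induction k with
      | zero => simp
      | succ k ih => rw [pow_succ', mul_apply_eq_comp, ih, convOp_one, h2, one_smul]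
    -- The index `0` must be avoided: the mean there is `0` because `0⁻¹ = 0`.
    have hev : ∀ᶠ n : ℕ in Filter.hyperfilter ℕ, n ≠ 0 :=
      Nat.hyperfilter_le_atTop (Filter.eventually_ne_atTop 0)
    filter_upwards [hev] with n hn
    simp [cesaro, hk, h2, hn]
  · exact ext_toCSUq (f := fun x => ψ (convOp (toCLM h) x)) (g := fun x => toCLM h x * ψ 1)
      (ψ.continuous.comp (convOp _).continuous) ((toCLM h).continuous.mul continuous_const)
      (fun x => (hinv ψ x).1) x
  · exact ext_toCSUq (f := fun x => toCLM h (convOp ψ x)) (g := fun x => toCLM h x * ψ 1)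
      ((toCLM h).continuous.comp (convOp _).continuous) ((toCLM h).continuous.mul continuous_const)
      (fun x => (hinv ψ x).2) x

theorem isHaarState_haar (hq : (q : ℂ) ≠ 0) : IsHaarState (haar q) :=
  Classical.epsilon_spec (exists_isHaarState hq)

end HaarExistence

/-! ### Invariance of the Haar state on the coordinate algebra. -/

section HaarInvariance

variable (q : Set.Ioc (0 : ℝ) 1)

theorem param_ne_zero : ((q : ℝ) : ℂ) ≠ 0 := Complex.ofReal_ne_zero.2 q.2.1.ne'

/-- The Haar state on the coordinate algebra. -/
def haarCoord : Coord q →ₗ[ℂ] ℂ := onCoord (toCLM (haar q))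

theorem haarCoord_apply (x : Coord q) : haarCoord q x = haar q (Coord.toCSUq q x) := rfl

theorem haarCoord_one : haarCoord q 1 = 1 := by
  rw [haarCoord_apply, map_one]
  exact (isHaarState_haar (param_ne_zero q)).1

variable {q}

theorem ext_vecFun {q : ℝ} {x y : CSUq q} (h : ∀ r ξ η, vecFun r ξ η x = vecFun r ξ η y) : x = y :=
  Subtype.ext (OpFamily.ext fun r => ContinuousLinearMap.ext fun η =>
    ext_inner_left ℂ fun ξ => h r ξ η)

theorem apply_rightAction {q : ℝ} (φ η : Coord q →ₗ[ℂ] ℂ) (x : Coord q) :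
    η (rightAction φ x) = φ (leftAction η x) := by
  rw [rightAction_apply, leftAction_apply]
  generalize Coord.comul q x = t
  induction t with
  | zero => simp
  | add s t hs ht => simp only [map_add, hs, ht]
  | tmul x y => simp [mul_comm]

/-- Invariance of a Haar state is expressed through bounded functionals. Vector functionals separate
`C(SU_q(2))`, and injectivity of `Coord.toCSUq` carries the identity back to the coordinate algebra.
-/
theorem leftAction_haarCoord (x : Coord q) : leftAction (haarCoord q) x = haarCoord q x • 1 := by
  refine toCSUq_injective q (ext_vecFun fun r ξ η => ?_)
  have h := ((isHaarState_haar (param_ne_zero q)).2 (vecFun r ξ η) (Coord.toCSUq q x)).1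
  rw [slice_comul_toCSUq] at h
  rw [map_smul, map_one, map_smul]
  exact h

theorem rightAction_haarCoord (x : Coord q) : rightAction (haarCoord q) x = haarCoord q x • 1 := by
  refine toCSUq_injective q (ext_vecFun fun r ξ η => ?_)
  have h := ((isHaarState_haar (param_ne_zero q)).2 (vecFun r ξ η) (Coord.toCSUq q x)).2
  rw [slice_comul_toCSUq] at h
  rw [map_smul, map_one, map_smul, ← onCoord_apply, apply_rightAction]
  exact h

theorem haarCoord_leftAction (η : Coord q →ₗ[ℂ] ℂ) (x : Coord q) :
    haarCoord q (leftAction η x) = haarCoord q x * η 1 := by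
  rw [← apply_rightAction, rightAction_haarCoord, map_smul, smul_eq_mul]

theorem haarCoord_rightAction (η : Coord q →ₗ[ℂ] ℂ) (x : Coord q) :
    haarCoord q (rightAction η x) = haarCoord q x * η 1 := by
  rw [apply_rightAction, leftAction_haarCoord, map_smul, smul_eq_mul]

/-- Integration by parts: invariance gives the factor `η(1)`, which is zero for a skew derivation.
Applied to products, this yields the moment recursions and the formal adjoints of `∂_e` and `∂_f`.
-/
theorem haarCoord_leftAction_of_isSkew {η : Coord q →ₗ[ℂ] ℂ} (h : IsSkew q η) (x : Coord q) :
    haarCoord q (leftAction η x) = 0 := by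
  rw [haarCoord_leftAction, h.map_one, mul_zero]

theorem haarCoord_scale (z : ℂˣ) (x : Coord q) : haarCoord q (scale q z z x) = haarCoord q x := by
  have h := haarCoord_leftAction (torusChar q z).toLinearMap x
  rw [leftAction_torusChar] at h
  simpa using h

theorem haarCoord_scale_inv (z : ℂˣ) (x : Coord q) :
    haarCoord q (scale q z z⁻¹ x) = haarCoord q x := by
  have h := haarCoord_rightAction (torusChar q z).toLinearMap x
  rw [rightAction_torusChar] at h
  simpa using h

/-- An element of bidegree `(k, d)`: `a` and `b` have bidegrees `(1, 0)` and `(0, 1)`. -/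
def HasBidegree {q : ℝ} (k d : ℤ) (x : Coord q) : Prop :=
  ∀ z w : ℂˣ, scale q z w x = ((z ^ k * w ^ d : ℂˣ) : ℂ) • x

theorem HasBidegree.mul {q : ℝ} {k d k' d' : ℤ} {x y : Coord q} (hx : HasBidegree k d x)
    (hy : HasBidegree k' d' y) : HasBidegree (k + k') (d + d') (x * y) := fun z w => by
  rw [map_mul, hx, hy, smul_mul_smul_comm, ← Units.val_mul]
  rw [zpow_add, zpow_add, mul_mul_mul_comm]

theorem hasBidegree_apow {q : ℝ} (k : ℤ) : HasBidegree k 0 (apow q k) := fun z w => by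
  rw [scale_apow, zpow_zero, mul_one]

theorem hasBidegree_bpow {q : ℝ} (d : ℤ) : HasBidegree 0 d (bpow q d) := fun z w => by
  rw [scale_bpow, zpow_zero, one_mul]

theorem hasBidegree_aeval {q : ℝ} (P : Polynomial ℂ) :
    HasBidegree 0 0 (Polynomial.aeval (coordT q) P) := fun z w => by
  rw [scale_aeval_coordT]; simp

theorem hasBidegree_a {q : ℝ} : HasBidegree 1 0 (Coord.gen q .a) := by
  rw [← pow_one (Coord.gen q .a), ← apow_natCast]
  exact hasBidegree_apow _

theorem hasBidegree_b' {q : ℝ} : HasBidegree 0 (-1) (Coord.gen q .b') := by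
  rw [← pow_one (Coord.gen q .b'), ← bpow_neg]
  exact hasBidegree_bpow _

/-- Scaling by `(2, 2)` and by `(2, 1/2)` preserves the Haar state and multiplies `x` by `2^{k+d}`
and `2^{k-d}`. Both factors are `1` only if `k = d = 0`. -/
theorem HasBidegree.haarCoord_eq_zero {k d : ℤ} {x : Coord q} (hx : HasBidegree k d x)
    (hkd : k ≠ 0 ∨ d ≠ 0) : haarCoord q x = 0 := by
  have h2 : ∀ n : ℤ, n ≠ 0 → (2 : ℂ) ^ n ≠ 1 := fun n hn h => by
    have := zpow_right_injective₀ (a := (2 : ℝ)) (by norm_num) (by norm_num)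
      (show (2 : ℝ) ^ n = 2 ^ (0 : ℤ) by
        rw [zpow_zero]
        have := congrArg Complex.re h
        rwa [show ((2 : ℂ) ^ n) = ((2 ^ n : ℝ) : ℂ) by push_cast; rfl, Complex.ofReal_re] at this)
    exact hn this
  let u : ℂˣ := Units.mk0 2 two_ne_zero
  have hcan : ∀ c : ℂ, c ≠ 1 → c * haarCoord q x = haarCoord q x → haarCoord q x = 0 := by
    intro c hc h
    have : (c - 1) * haarCoord q x = 0 := by rw [sub_mul, h, one_mul, sub_self]
    exact (mul_eq_zero.1 this).resolve_left (sub_ne_zero.2 hc)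
  have h1 := haarCoord_scale u x
  have h3 := haarCoord_scale_inv u x
  rw [hx, map_smul, smul_eq_mul] at h1 h3
  by_cases hs : k + d = 0
  · refine hcan _ ?_ h3
    have : (((u ^ k * u⁻¹ ^ d : ℂˣ)) : ℂ) = 2 ^ (k - d) := by
      rw [inv_zpow', ← zpow_add, ← sub_eq_add_neg, Units.val_zpow_eq_zpow_val]; rfl
    rw [this]
    exact h2 _ (by omega)
  · refine hcan _ ?_ h1
    have : (((u ^ k * u ^ d : ℂˣ)) : ℂ) = 2 ^ (k + d) := by
      rw [← zpow_add, Units.val_zpow_eq_zpow_val]; rfl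
    rw [this]
    exact h2 _ hs

end HaarInvariance

/-! ### Moments and modular property of the Haar state. -/

section Moments

variable (q : Set.Ioc (0 : ℝ) 1)

/-- The number `⟨n⟩ = ∑_{k < n} q^{2k}`. -/
def angle (n : ℕ) : ℂ := ∑ k ∈ Finset.range n, ((q : ℝ) : ℂ) ^ (2 * k)

theorem angle_succ (n : ℕ) : angle q (n + 1) = angle q n + ((q : ℝ) : ℂ) ^ (2 * n) :=
  Finset.sum_range_succ _ _

theorem angle_succ' (n : ℕ) : angle q (n + 1) = 1 + ((q : ℝ) : ℂ) ^ 2 * angle q n := by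
  rw [angle, Finset.sum_range_succ', angle, Finset.mul_sum, add_comm, mul_zero, pow_zero]
  congr 1
  exact Finset.sum_congr rfl fun k _ => by ring

theorem angle_eq_ofReal (n : ℕ) :
    angle q n = ((∑ k ∈ Finset.range n, (q : ℝ) ^ (2 * k) : ℝ) : ℂ) := by
  rw [angle]; push_cast; rfl

theorem one_le_sum (n : ℕ) : 1 ≤ ∑ k ∈ Finset.range (n + 1), (q : ℝ) ^ (2 * k) := by
  rw [Finset.sum_range_succ']
  have : 0 ≤ ∑ k ∈ Finset.range n, (q : ℝ) ^ (2 * (k + 1)) :=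
    Finset.sum_nonneg fun k _ => pow_nonneg q.2.1.le _
  simpa using this

theorem angle_ne_zero (n : ℕ) : angle q (n + 1) ≠ 0 := by
  rw [angle_eq_ofReal, Complex.ofReal_ne_zero]
  linarith [one_le_sum q n]

/-- The common recursion behind the moments of `bb*`, the normalisation of the Berezin states, and
the rigidity of elements commuting with `∂_e`. -/
theorem angle_mul_eq {f : ℕ → ℂ}
    (h : ∀ n, angle q (n + 2) * f (n + 1) = angle q (n + 1) * f n) (n : ℕ) :
    angle q (n + 1) * f n = f 0 := by
  induction n with
  | zero => simp [angle]
  | succ n ih => rw [h, ih]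

variable {q}

theorem pow_mul_comm_smul {A : Type*} [Ring A] [Algebra ℂ A] {x y : A} {c : ℂ}
    (h : y * x = c • (x * y)) (n : ℕ) : y ^ n * x = c ^ n • (x * y ^ n) := by
  induction n with
  | zero => simp
  | succ n ih =>
    rw [pow_succ', mul_assoc, ih, mul_smul_comm, ← mul_assoc, h, smul_mul_assoc, smul_smul,
      mul_assoc, ← pow_succ', pow_succ c]

theorem coordT_mul_a {q : ℝ} :
    coordT q * Coord.gen q .a = (q : ℂ) ^ 2 • (Coord.gen q .a * coordT q) := by
  have h := Coord.relations q
  rw [coordT, mul_assoc, h.b'a, mul_smul_comm, ← mul_assoc, h.ba, smul_mul_assoc, smul_smul,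
    mul_assoc, sq]

theorem coordT_mul_a' {q : ℝ} (hq : (q : ℂ) ≠ 0) :
    coordT q * Coord.gen q .a' = ((q : ℂ) ^ 2)⁻¹ • (Coord.gen q .a' * coordT q) := by
  rw [coordT, mul_assoc, b'_a' hq, mul_smul_comm, ← mul_assoc, b_a' hq, smul_mul_assoc, smul_smul,
    mul_assoc, sq, mul_inv]

theorem scale_gen {q : ℝ} (z w : ℂˣ) (g : Gen) : scale q z w (Coord.gen q g) =
    genMap ((z : ℂ) • Coord.gen q .a) (((z⁻¹ : ℂˣ) : ℂ) • Coord.gen q .a')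
      ((w : ℂ) • Coord.gen q .b) (((w⁻¹ : ℂˣ) : ℂ) • Coord.gen q .b') g :=
  Coord.lift_gen _ g

theorem leftAction_pairE_coordT : leftAction (pairE q) (coordT q) =
    (-((q : ℝ) : ℂ)⁻¹ * ((sqrtUnit q)⁻¹ : ℂˣ)) • (Coord.gen q .a' * Coord.gen q .b') := by
  rw [coordT, (isSkew_pairE q).leftAction_mul, leftAction_pairE_gen, leftAction_pairE_gen, scale_gen]
  simp only [genMap, mul_zero, add_zero, smul_mul_smul_comm]

theorem leftAction_pairE_b_mul_pow (m : ℕ) :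
    leftAction (pairE q) (Coord.gen q .b * coordT q ^ m) =
      (-(((q : ℝ) : ℂ) ^ (2 * m + 1))⁻¹ * angle q (m + 1)) • (Coord.gen q .a' * coordT q ^ m) := by
  have hq := param_ne_zero q
  induction m with
  | zero =>
    rw [pow_zero, mul_one, mul_one, leftAction_pairE_gen]
    simp [genMap, angle]
  | succ m ih =>
    have hb : Coord.gen q .b * coordT q ^ m * (Coord.gen q .a' * Coord.gen q .b') =
        (((q : ℝ) : ℂ) ^ (2 * m + 1))⁻¹ • (Coord.gen q .a' * coordT q ^ (m + 1)) := by
      rw [mul_assoc, ← mul_assoc (coordT (q : ℝ) ^ m), pow_mul_comm_smul (coordT_mul_a' hq),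
        smul_mul_assoc, mul_smul_comm, mul_assoc, (commute_coordT_b'.pow_left m).eq, ← mul_assoc,
        b_a' hq, smul_mul_assoc, smul_smul, mul_assoc, ← mul_assoc (Coord.gen (q : ℝ) .b), ← coordT,
        ← pow_succ', ← inv_pow, inv_pow, inv_pow, ← mul_inv, ← pow_mul, ← pow_succ]
    have hs : (((sqrtUnit q)⁻¹ : ℂˣ) : ℂ) * ((sqrtUnit q)⁻¹ : ℂˣ) = ((q : ℝ) : ℂ)⁻¹ := by
      rw [← sqrtUnit_sq, sq, mul_inv, Units.val_inv_eq_inv_val]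
    rw [pow_succ, ← mul_assoc, (isSkew_pairE q).leftAction_mul, ih, leftAction_pairE_coordT,
      scale_coordT, map_mul, map_pow, scale_coordT, scale_gen]
    simp only [genMap, smul_mul_assoc, mul_smul_comm, hb, smul_smul, mul_assoc, ← pow_succ]
    rw [← add_smul]
    congr 1
    rw [angle_succ' q (m + 1), ← mul_assoc (((sqrtUnit q)⁻¹ : ℂˣ) : ℂ), hs]
    field_simp
    ring

theorem leftAction_pairE_pow (n : ℕ) : leftAction (pairE q) (Coord.gen q .a ^ (n + 1)) =
    (((sqrtUnit q)⁻¹ ^ n : ℂˣ) * angle q (n + 1)) • (Coord.gen q .a ^ n * Coord.gen q .b') := by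
  induction n with
  | zero => simp [leftAction_pairE_gen, genMap, angle]
  | succ n ih =>
    rw [pow_succ, (isSkew_pairE q).leftAction_mul, ih, leftAction_pairE_gen, map_pow, scale_gen,
      scale_gen]
    simp only [genMap, mul_assoc, (Coord.relations (q : ℝ)).b'a, mul_smul_comm,
      smul_smul, _root_.smul_pow, smul_mul_assoc]
    rw [← mul_assoc (_ ^ n), ← pow_succ, ← add_smul]
    congr 1
    rw [angle_succ' q (n + 1), ← sqrtUnit_sq]
    have := (sqrtUnit q).ne_zero
    simp only [Units.val_pow_eq_pow_val, Units.val_inv_eq_inv_val, inv_pow]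
    field_simp
    ring

/-- The moments of `bb*`. -/
theorem angle_mul_moment (m : ℕ) : angle q (m + 1) * haarCoord q (coordT q ^ m) = 1 := by
  refine (angle_mul_eq q (f := fun m => haarCoord q (coordT q ^ m)) (fun m => ?_) m).trans
    (by simp [haarCoord_one])
  have hq := param_ne_zero q
  -- The test element `b (bb*)^m a` is chosen because `∂_e` turns it into multiples of `a*(bb*)^m a`
  -- and `b(bb*)^m b*`, both polynomials in `bb*` of degree `m + 1`. The result is `⟨m+1⟩ h(t^m) =
  -- ⟨m+2⟩ h(t^{m+1})` for `t = bb*`.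
  have h := haarCoord_leftAction_of_isSkew (isSkew_pairE q)
    (Coord.gen q .b * coordT q ^ m * Coord.gen q .a)
  have h1 : Coord.gen q .a' * (coordT q ^ m * Coord.gen q .a) = ((q : ℝ) : ℂ) ^ (2 * m) •
      (coordT q ^ m - ((q : ℝ) : ℂ) ^ 2 • coordT q ^ (m + 1)) := by
    rw [pow_mul_comm_smul coordT_mul_a, mul_smul_comm, ← mul_assoc,
      eq_sub_of_add_eq (Coord.relations (q : ℝ)).a'a, sub_mul, one_mul, smul_mul_assoc, ← coordT,
      ← pow_succ', pow_mul]
  have h2 : Coord.gen q .b * (coordT q ^ m * Coord.gen q .b') = coordT q ^ (m + 1) := by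
    rw [(commute_coordT_b'.pow_left m).eq, ← mul_assoc, ← coordT, pow_succ']
  rw [(isSkew_pairE q).leftAction_mul, leftAction_pairE_b_mul_pow, leftAction_pairE_gen, map_mul,
    map_pow, scale_coordT, scale_gen, scale_gen] at h
  simp only [genMap, mul_smul_comm, smul_mul_assoc, mul_assoc, h1, h2, map_add, map_smul,
    map_sub, smul_eq_mul, Units.val_inv_eq_inv_val] at h
  have hα := (sqrtUnit q).ne_zero
  have hα2 := sqrtUnit_sq q
  rw [angle_succ' q (m + 1)]
  field_simp at h
  rw [hα2] at h
  field_simp at h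
  refine mul_left_cancel₀ (pow_ne_zero (2 * m + 1) hq) ?_
  linear_combination h

theorem leftAction_pairE_a'_pow_mul (N : ℕ) (x : Coord q) :
    leftAction (pairE q) (Coord.gen q .a' ^ N * x) =
      ((sqrtUnit q : ℂˣ) : ℂ) ^ N • (Coord.gen q .a' ^ N * leftAction (pairE q) x) := by
  have h0 : leftAction (pairE q) (Coord.gen q .a' ^ N) = 0 := by
    induction N with
    | zero => rw [pow_zero, leftAction_one, (isSkew_pairE q).map_one, zero_smul]
    | succ N ih =>
      rw [pow_succ, (isSkew_pairE q).leftAction_mul, ih, leftAction_pairE_gen]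
      simp [genMap]
  rw [(isSkew_pairE q).leftAction_mul, h0, zero_mul, zero_add, map_pow, scale_gen]
  simp only [genMap, inv_inv, _root_.smul_pow, smul_mul_assoc]

/-- Integration by parts with the test element `(a*)^N b a^{N+1}`; the power `(a*)^N` passes through
`∂_e` up to a scalar because `∂_e(a*) = 0`. -/
theorem angle_mul_haarCoord_coordT (N : ℕ) :
    angle q (N + 1) * haarCoord q (Coord.gen q .a' ^ N * coordT q * Coord.gen q .a ^ N) =
      ((q : ℝ) : ℂ) ^ (2 * N) *
        haarCoord q (Coord.gen q .a' ^ (N + 1) * Coord.gen q .a ^ (N + 1)) := by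
  have hq := param_ne_zero q
  have h := haarCoord_leftAction_of_isSkew (isSkew_pairE q)
    (Coord.gen q .a' ^ N * (Coord.gen q .b * Coord.gen q .a ^ (N + 1)))
  have h1 : Coord.gen q .b * (Coord.gen q .a ^ N * Coord.gen q .b') =
      (((q : ℝ) : ℂ) ^ N)⁻¹ • (coordT q * Coord.gen q .a ^ N) := by
    rw [coordT, mul_assoc, exists_mul_pow_comm (Coord.relations (q : ℝ)).b'a, mul_smul_comm,
      inv_smul_smul₀ (pow_ne_zero _ hq)]
  rw [leftAction_pairE_a'_pow_mul, (isSkew_pairE q).leftAction_mul, leftAction_pairE_pow,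
    leftAction_pairE_gen, map_pow, scale_gen, scale_gen] at h
  simp only [genMap, _root_.smul_pow, mul_smul_comm, smul_mul_assoc, mul_add, map_add, map_smul,
    smul_eq_mul, Units.val_inv_eq_inv_val, Units.val_pow_eq_pow_val, h1, smul_add] at h
  rw [← mul_assoc (Coord.gen (q : ℝ) .a' ^ N), ← mul_assoc (Coord.gen (q : ℝ) .a' ^ N),
    ← pow_succ] at h
  have hα := (sqrtUnit q).ne_zero
  have hα2 := sqrtUnit_sq q
  rw [← hα2] at h ⊢
  simp only [inv_pow] at h
  field_simp at h
  refine mul_left_cancel₀ hα ?_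
  linear_combination h

/-- The normalisation of the Berezin states. -/
theorem angle_mul_haarCoord_pow (N : ℕ) :
    angle q (N + 1) * haarCoord q (Coord.gen q .a' ^ N * Coord.gen q .a ^ N) = 1 := by
  refine (angle_mul_eq q (f := fun N => haarCoord q (Coord.gen q .a' ^ N * Coord.gen q .a ^ N))
    (fun N => ?_) N).trans (by simp [haarCoord_one])
  have h := angle_mul_haarCoord_coordT (q := q) N
  -- Inserting `1 = a*a + q²bb*` between the powers compares consecutive `N`; with `⟨N+2⟩ = ⟨N+1⟩ +
  -- q^{2N+2}` this closes the recursion.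
  have h1 : ((q : ℝ) : ℂ) ^ 2 • (Coord.gen q .a' ^ N * coordT q * Coord.gen q .a ^ N) =
      Coord.gen q .a' ^ N * Coord.gen q .a ^ N -
        Coord.gen q .a' ^ (N + 1) * Coord.gen q .a ^ (N + 1) := by
    rw [eq_sub_iff_add_eq, pow_succ (Coord.gen (q : ℝ) .a'), pow_succ' (Coord.gen (q : ℝ) .a),
      mul_assoc _ (Coord.gen (q : ℝ) .a'),
      ← mul_assoc (Coord.gen (q : ℝ) .a'), mul_assoc, ← mul_smul_comm, ← smul_mul_assoc, ← mul_add,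
      ← add_mul, add_comm, coordT, (Coord.relations (q : ℝ)).a'a, one_mul]
  have h2 := congrArg (haarCoord q) h1
  rw [map_smul, map_sub, smul_eq_mul] at h2
  rw [angle_succ q (N + 1)]
  linear_combination angle q (N + 1) * h2 - ((q : ℝ) : ℂ) ^ 2 * h

/-- This is the modular automorphism of `h` on `a`. By bidegree only `x = a*(bb*)^m` matters. Both
sides are then differences of moments, and the two recursions `⟨m+2⟩ = ⟨m+1⟩ + q^{2m+2} = 1 +
q²⟨m+1⟩` show that they differ by the factor `q⁻²`. -/
theorem haarCoord_mul_a (x : Coord q) : haarCoord q (x * Coord.gen q .a) =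
    (((q : ℝ) : ℂ) ^ 2)⁻¹ * haarCoord q (Coord.gen q .a * x) := by
  have hq := param_ne_zero q
  obtain ⟨f, rfl⟩ := range_normalForm hq x
  induction f using Finsupp.induction_linear with
  | zero => simp
  | add f g hf hg => rw [map_add, add_mul, mul_add, map_add, map_add, hf, hg, mul_add]
  | single k f =>
    rw [normalForm_single]
    induction f using Finsupp.induction_linear with
    | zero => simp
    | add f g hf hg => rw [map_add, mul_add, add_mul, mul_add, map_add, map_add, hf, hg, mul_add]
    | single d P =>
      rw [normalFormB_single]
      have hdeg := (hasBidegree_apow (q := q) k).mul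
        ((hasBidegree_bpow (q := q) d).mul (hasBidegree_aeval P))
      by_cases hkd : k + 1 = 0 ∧ d = 0
      · obtain ⟨hk, rfl⟩ := hkd
        obtain rfl : k = -((1 : ℕ) : ℤ) := by push_cast; omega
        clear hdeg
        rw [apow_neg, pow_one, show bpow (q : ℝ) 0 = 1 from pow_zero _, one_mul]
        induction P using Polynomial.induction_on' with
        | add P Q hP hQ => rw [map_add, mul_add, add_mul, mul_add, map_add, map_add, hP, hQ, mul_add]
        | monomial m c =>
          rw [Polynomial.aeval_monomial, ← Algebra.smul_def]
          simp only [mul_smul_comm, smul_mul_assoc, map_smul]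
          have h1 : Coord.gen q .a' * coordT q ^ m * Coord.gen q .a = ((q : ℝ) : ℂ) ^ (2 * m) •
              (coordT q ^ m - ((q : ℝ) : ℂ) ^ 2 • coordT q ^ (m + 1)) := by
            rw [mul_assoc, pow_mul_comm_smul coordT_mul_a, mul_smul_comm, ← mul_assoc,
              eq_sub_of_add_eq (Coord.relations (q : ℝ)).a'a, sub_mul, one_mul, smul_mul_assoc,
              ← coordT, ← pow_succ', pow_mul]
          have h2 : Coord.gen q .a * (Coord.gen q .a' * coordT q ^ m) =
              coordT q ^ m - coordT q ^ (m + 1) := by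
            rw [← mul_assoc, eq_sub_of_add_eq (Coord.relations (q : ℝ)).aa', sub_mul, one_mul,
              ← coordT, ← pow_succ']
          rw [h1, h2]
          simp only [map_smul, map_sub, smul_eq_mul]
          have h3 := angle_mul_moment (q := q) m
          have h4 := angle_mul_moment (q := q) (m + 1)
          have h5 := angle_succ q (m + 1)
          have h6 := angle_succ' q (m + 1)
          have h7 := angle_ne_zero q m
          have h8 := angle_ne_zero q (m + 1)
          rw [eq_div_of_mul_eq h7 ((mul_comm _ _).trans h3),
            eq_div_of_mul_eq h8 ((mul_comm _ _).trans h4)]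
          field_simp
          linear_combination c * ((q : ℝ) : ℂ) ^ (2 * m + 2) * h6 - c * h5
      · have hor : k + 1 ≠ 0 ∨ d ≠ 0 := by tauto
        rw [(hdeg.mul hasBidegree_a).haarCoord_eq_zero (by rcases hor with h | h <;> [left; right] <;> omega),
          (hasBidegree_a.mul hdeg).haarCoord_eq_zero (by rcases hor with h | h <;> [left; right] <;> omega),
          mul_zero]

/-- Both sides vanish if a power of `a` or `a*` is present; otherwise `x` is built from `b, b*`
alone and commutes with `b*`. -/
theorem haarCoord_mul_b' (x : Coord q) : haarCoord q (x * Coord.gen q .b') =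
    haarCoord q (Coord.gen q .b' * x) := by
  have hq := param_ne_zero q
  obtain ⟨f, rfl⟩ := range_normalForm hq x
  induction f using Finsupp.induction_linear with
  | zero => simp
  | add f g hf hg => rw [map_add, add_mul, mul_add, map_add, map_add, hf, hg]
  | single k f =>
    rw [normalForm_single]
    induction f using Finsupp.induction_linear with
    | zero => simp
    | add f g hf hg => rw [map_add, mul_add, add_mul, mul_add, map_add, map_add, hf, hg]
    | single d P =>
      rw [normalFormB_single]
      have hdeg := (hasBidegree_apow (q := q) k).mul
        ((hasBidegree_bpow (q := q) d).mul (hasBidegree_aeval P))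
      by_cases hk : k = 0
      · subst hk
        rw [show apow (q : ℝ) 0 = 1 from pow_zero _, one_mul]
        have hb : Commute (bpow q d) (Coord.gen q .b') := by
          rcases d with n | n
          · exact commute_b_b'.pow_left n
          · exact (Commute.refl _).pow_left _
        rw [(hb.mul_left (commute_aeval commute_coordT_b' P)).eq]
      · rw [(hdeg.mul hasBidegree_b').haarCoord_eq_zero (by left; omega),
          (hasBidegree_b'.mul hdeg).haarCoord_eq_zero (by left; omega)]

theorem haar_mul_gena (x : CSUq q) :
    haar q (x * gena q) = (((q : ℝ) : ℂ) ^ 2)⁻¹ * haar q (gena q * x) := by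
  refine ext_toCSUq (f := fun x => toCLM (haar q) (x * gena q))
    (g := fun x => (((q : ℝ) : ℂ) ^ 2)⁻¹ * toCLM (haar q) (gena q * x))
    ((toCLM _).continuous.comp (continuous_id.mul continuous_const))
    (continuous_const.mul ((toCLM _).continuous.comp (continuous_const.mul continuous_id)))
    (fun x => ?_) x
  have h := haarCoord_mul_a x
  rw [haarCoord_apply, haarCoord_apply, map_mul (Coord.toCSUq q), map_mul (Coord.toCSUq q), Coord.toCSUq_gen] at h
  exact h

theorem haar_mul_star_genb (x : CSUq q) :
    haar q (x * star (genb q)) = haar q (star (genb q) * x) := by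
  refine ext_toCSUq (f := fun x => toCLM (haar q) (x * star (genb q)))
    (g := fun x => toCLM (haar q) (star (genb q) * x))
    ((toCLM _).continuous.comp (continuous_id.mul continuous_const))
    ((toCLM _).continuous.comp (continuous_const.mul continuous_id))
    (fun x => ?_) x
  have h := haarCoord_mul_b' x
  rw [haarCoord_apply, haarCoord_apply, map_mul (Coord.toCSUq q), map_mul (Coord.toCSUq q), Coord.toCSUq_gen] at h
  exact h

theorem haar_mul_gena_pow (n : ℕ) (x : CSUq q) :
    haar q (x * gena q ^ n) = (((q : ℝ) : ℂ) ^ (2 * n))⁻¹ * haar q (gena q ^ n * x) := by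
  induction n generalizing x with
  | zero => simp
  | succ n ih =>
    rw [pow_succ, ← mul_assoc, haar_mul_gena, ← mul_assoc, ih, ← mul_assoc, ← pow_succ, ← mul_assoc,
      ← mul_inv, ← pow_add]
    congr 3
    ring

end Moments

/-! ### Spectral subspaces as algebraic homogeneous components. -/

section SpectralSubspaces

variable {q : Set.Ioc (0 : ℝ) 1}

theorem circleAction_toCSUq {q : ℝ} (z : Circle) (x : Coord q) :
    circleAction q z (Coord.toCSUq q x) =
      Coord.toCSUq q (scale q (Circle.toUnits z) (Circle.toUnits z) x) := by
  have hs : star (z : ℂ) = (z : ℂ)⁻¹ := by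
    rw [← Circle.coe_inv, Circle.coe_inv_eq_conj]; rfl
  let f : Coord q →ₐ[ℂ] CSUq q := (circleAction q z).toAlgHom.comp (Coord.toCSUq q)
  have : f = (Coord.toCSUq q).comp (scale q (Circle.toUnits z) (Circle.toUnits z)) :=
    Coord.hom_ext fun g => by
      change circleAction q z (Coord.toCSUq q (.gen q g)) = Coord.toCSUq q (scale q _ _ (.gen q g))
      rw [Coord.toCSUq_gen, scale_gen]
      cases g
      · simp only [genMap, circleAction_a, map_smul, Coord.toCSUq_gen]; rfl
      · simp only [genMap, map_star, circleAction_a, star_smul, map_smul, Coord.toCSUq_gen, hs]; rfl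
      · simp only [genMap, circleAction_b, map_smul, Coord.toCSUq_gen]; rfl
      · simp only [genMap, map_star, circleAction_b, star_smul, map_smul, Coord.toCSUq_gen, hs]; rfl
  exact congrArg (fun f => f x) this

/-- The span of the normally ordered elements of total degree `n`. -/
def homogeneous (q : ℝ) (n : ℤ) : Submodule ℂ (Coord q) :=
  Submodule.span ℂ {x | ∃ (k : ℤ) (P : Polynomial ℂ),
    x = apow q k * (bpow q (n - k) * Polynomial.aeval (coordT q) P)}

theorem scale_of_mem_homogeneous {q : ℝ} {n : ℤ} {x : Coord q} (hx : x ∈ homogeneous q n) (z : ℂˣ) :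
    scale q z z x = ((z ^ n : ℂˣ) : ℂ) • x := by
  induction hx using Submodule.span_induction with
  | mem x hx =>
    obtain ⟨k, P, rfl⟩ := hx
    rw [((hasBidegree_apow k).mul ((hasBidegree_bpow (n - k)).mul (hasBidegree_aeval P))) z z,
      ← zpow_add]
    congr 4
    ring
  | zero => simp
  | add x y _ _ hx hy => rw [map_add, hx, hy, smul_add]
  | smul c x _ hx => rw [map_smul, hx, smul_comm]

theorem iSup_homogeneous (x : Coord q) : x ∈ ⨆ n, homogeneous q n := by
  obtain ⟨f, rfl⟩ := range_normalForm (param_ne_zero q) x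
  induction f using Finsupp.induction_linear with
  | zero => simp
  | add f g hf hg => rw [map_add]; exact add_mem hf hg
  | single k f =>
    rw [normalForm_single]
    induction f using Finsupp.induction_linear with
    | zero => simp
    | add f g hf hg => rw [map_add, mul_add]; exact add_mem hf hg
    | single d P =>
      rw [normalFormB_single]
      refine Submodule.mem_iSup_of_mem (k + d) (Submodule.subset_span ⟨k, P, ?_⟩)
      rw [add_sub_cancel_left]

/-- Spectral subspaces are defined with `|z| = 1`. The algebraic description gives the same scaling
law for all `z ∈ ℂˣ`, in particular for `z = q^{±1/2}`, which is how `∂_k` acts in the twisted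
product rules. -/
theorem mem_homogeneous_of_mem_spectral {n : ℤ} {x : Coord q} (hx : x ∈ spectral q n) :
    x ∈ homogeneous q n := by
  obtain ⟨u, hu, hux⟩ := (Submodule.mem_iSup_iff_exists_finsupp _ _).1 (iSup_homogeneous x)
  let ζ : Circle := Circle.exp 1
  -- With `x` subtracted from the `n`-th homogeneous component, these eigenvectors for distinct
  -- eigenvalues sum to zero, so each vanishes; for `m = n` this says `x = u n`.
  let v : ℤ → Coord q := fun m => if m = n then u n - x else u m
  have hT : scale q (Circle.toUnits ζ) (Circle.toUnits ζ) x = ((ζ ^ n : Circle) : ℂ) • x := by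
    refine toCSUq_injective q ?_
    rw [← circleAction_toCSUq, hx ζ, map_smul, Circle.coe_zpow]
  have hu' : ∀ m, scale q (Circle.toUnits ζ) (Circle.toUnits ζ) (u m) = ((ζ ^ m : Circle) : ℂ) • u m :=
    fun m => by
      rw [scale_of_mem_homogeneous (hu m), ← map_zpow]; rfl
  have hsum : ∑ m ∈ insert n u.support, v m = 0 := by
    have h1 : ∀ m, v m = u m - if m = n then x else 0 := fun m => by
      by_cases h : m = n
      · simp [v, h]
      · simp [v, h]
    simp only [h1, Finset.sum_sub_distrib, Finset.sum_ite_eq', Finset.mem_insert_self, if_true]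
    rw [sub_eq_zero, ← hux, Finsupp.sum]
    symm
    refine Finset.sum_subset (Finset.subset_insert _ _) fun m _ hm => ?_
    rwa [Finsupp.notMem_support_iff] at hm
  have key := mem_of_sum_eigenvectors_mem (scale q (Circle.toUnits ζ) (Circle.toUnits ζ)).toLinearMap
    ⊥ (fun x hx => by rw [(Submodule.mem_bot ℂ).1 hx]; simp) (fun k => ((ζ ^ k : Circle) : ℂ))
    (fun k l h => circle_exp_zpow_injective (Circle.ext h)) (insert n u.support) v
    (fun k _ => by
      by_cases h : k = n
      · subst h
        simp only [v, if_true, AlgHom.toLinearMap_apply, map_sub, hT, hu', smul_sub]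
      · simp only [v, h, if_false, AlgHom.toLinearMap_apply, hu'])
    ((Submodule.mem_bot ℂ).2 hsum) n (Finset.mem_insert_self _ _)
  rw [Submodule.mem_bot] at key
  simp only [v, if_true] at key
  rw [← sub_eq_zero.1 key]
  exact hu n

theorem scale_of_mem_spectral {n : ℤ} {x : Coord q} (hx : x ∈ spectral q n) (z : ℂˣ) :
    scale q z z x = ((z ^ n : ℂˣ) : ℂ) • x :=
  scale_of_mem_homogeneous (mem_homogeneous_of_mem_spectral hx) z

theorem mem_spectral_of_scale {q : ℝ} {n : ℤ} {x : Coord q}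
    (hx : ∀ z : ℂˣ, scale q z z x = ((z ^ n : ℂˣ) : ℂ) • x) : x ∈ spectral q n := fun z => by
  rw [circleAction_toCSUq, hx, map_smul, ← map_zpow]
  exact congrArg (· • _) (Circle.coe_zpow z n)

end SpectralSubspaces

/-! ### The Berezin states converge to the counit; rigidity when the commutator with `∂_e` vanishes.
-/

section BerezinLimit

variable {q : Set.Ioc (0 : ℝ) 1}

theorem inner_gnsVec {q : ℝ} (x y : CSUq q) : ⟪gnsVec q x, gnsVec q y⟫_ℂ = haar q (star x * y) := by
  refine (UniformSpace.Completion.inner_coe _ _).trans ?_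
  exact PositiveLinearMap.preGNS_inner_def _ _ _

theorem norm_gnsRep_le {q : ℝ} (x : CSUq q) (v : L2 q) : ‖gnsRep q x v‖ ≤ ‖x‖ * ‖v‖ :=
  (ContinuousLinearMap.le_opNorm _ _).trans
    (mul_le_mul_of_nonneg_right (NonUnitalStarAlgHom.norm_apply_le (gnsRep q) x) (norm_nonneg _))

theorem norm_gnsVec_mul_le {q : ℝ} (x y : CSUq q) : ‖gnsVec q (x * y)‖ ≤ ‖x‖ * ‖gnsVec q y‖ := by
  rw [← gnsRep_gnsVec]
  exact norm_gnsRep_le x _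

theorem norm_gnsVec_sq {q : ℝ} (x : CSUq q) :
    ((‖gnsVec q x‖ ^ 2 : ℝ) : ℂ) = haar q (star x * x) := by
  rw [← inner_gnsVec, inner_self_eq_norm_sq_to_K]
  push_cast; rfl

theorem berezinFunctional_eq (N : ℕ) (x : CSUq q) : berezinFunctional q N x =
    angle q (N + 1) * haar q (star (gena q) ^ N * x * gena q ^ N) :=
  berezinFunctional_apply q N x

theorem toCSUq_a'_pow_mul_a_pow {q : ℝ} (N : ℕ) : Coord.toCSUq q (Coord.gen q .a' ^ N * Coord.gen q .a ^ N) =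
    star (gena q) ^ N * gena q ^ N := by
  rw [map_mul, map_pow, map_pow, Coord.toCSUq_gen, Coord.toCSUq_gen]; rfl

theorem angle_mul_norm_sq (N : ℕ) :
    (∑ k ∈ Finset.range (N + 1), (q : ℝ) ^ (2 * k)) * ‖gnsVec q (gena q ^ N)‖ ^ 2 = 1 := by
  have h := angle_mul_haarCoord_pow (q := q) N
  rw [haarCoord_apply, toCSUq_a'_pow_mul_a_pow, ← star_pow, ← norm_gnsVec_sq, angle_eq_ofReal,
    ← Complex.ofReal_mul] at h
  exact_mod_cast h

/-- The left side equals `q^{2N}/⟨N+2⟩`. The first `N + 1` terms of `⟨N+2⟩` are each at least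
`q^{2N}`, which gives a bound valid also for `q = 1`. It says that `b` is small in the states `h_N`.
-/
theorem angle_mul_norm_sq_b (N : ℕ) :
    (∑ k ∈ Finset.range (N + 1), (q : ℝ) ^ (2 * k)) * ‖gnsVec q (genb q * gena q ^ N)‖ ^ 2 ≤
      1 / (N + 1) := by
  have h := angle_mul_haarCoord_coordT (q := q) N
  have h2 := angle_mul_haarCoord_pow (q := q) (N + 1)
  have h3 : haarCoord q (Coord.gen q .a' ^ N * coordT q * Coord.gen q .a ^ N) =
      ((‖gnsVec q (genb q * gena q ^ N)‖ ^ 2 : ℝ) : ℂ) := by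
    rw [norm_gnsVec_sq, haarCoord_apply, coordT]
    refine congrArg (haar q) ?_
    simp only [map_mul, map_pow, Coord.toCSUq_gen, star_mul, star_pow, genMap, mul_assoc]
    rw [← mul_assoc (genb (q : ℝ)), (CSUq_relations (q : ℝ)).bb', mul_assoc]
  set g : ℝ := ∑ k ∈ Finset.range (N + 1 + 1), (q : ℝ) ^ (2 * k) with hg
  rw [eq_div_of_mul_eq (angle_ne_zero q (N + 1)) ((mul_comm _ _).trans h2), h3, angle_eq_ofReal,
    angle_eq_ofReal, ← hg] at h
  have h4 : (∑ k ∈ Finset.range (N + 1), (q : ℝ) ^ (2 * k)) * ‖gnsVec q (genb q * gena q ^ N)‖ ^ 2 =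
      (q : ℝ) ^ (2 * N) * (1 / g) := by exact_mod_cast h
  rw [h4, mul_one_div]
  have hq0 : 0 < (q : ℝ) := q.2.1
  have h5 : (N + 1) * (q : ℝ) ^ (2 * N) ≤ g := by
    rw [hg, Finset.sum_range_succ]
    have : ∑ k ∈ Finset.range (N + 1), (q : ℝ) ^ (2 * N) ≤
        ∑ k ∈ Finset.range (N + 1), (q : ℝ) ^ (2 * k) :=
      Finset.sum_le_sum fun k hk =>
        pow_le_pow_of_le_one hq0.le q.2.2 (by have := Finset.mem_range.1 hk; omega)
    rw [Finset.sum_const, Finset.card_range, nsmul_eq_mul] at this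
    push_cast at this
    have h6 : 0 ≤ (q : ℝ) ^ (2 * (N + 1)) := by positivity
    linarith
  have hg0 : 0 < g := lt_of_lt_of_le (by positivity) h5
  rw [div_le_div_iff₀ hg0 (by positivity)]
  linarith

/-- Cauchy–Schwarz, with the functional written as `⟨N+1⟩⟪Λ(x* a^N), Λ(y a^N)⟫`. -/
theorem norm_berezin_mul_le (N : ℕ) (x y : CSUq q) : ‖berezinFunctional q N (x * y)‖ ≤
    (∑ k ∈ Finset.range (N + 1), (q : ℝ) ^ (2 * k)) *
      (‖x‖ * ‖gnsVec q (gena q ^ N)‖ * ‖gnsVec q (y * gena q ^ N)‖) := by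
  have h : star (gena q) ^ N * (x * y) * gena q ^ N =
      star (star x * gena q ^ N) * (y * gena q ^ N) := by
    rw [star_mul, star_star, star_pow]; simp only [mul_assoc]
  rw [berezinFunctional_eq, h, ← inner_gnsVec, norm_mul, angle_eq_ofReal, Complex.norm_real,
    Real.norm_of_nonneg (Finset.sum_nonneg fun k _ => pow_nonneg q.2.1.le _)]
  refine mul_le_mul_of_nonneg_left ?_ (Finset.sum_nonneg fun k _ => pow_nonneg q.2.1.le _)
  refine (norm_inner_le_norm _ _).trans (mul_le_mul_of_nonneg_right ?_ (norm_nonneg _))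
  rw [← norm_star x]
  exact norm_gnsVec_mul_le _ _

theorem norm_berezinFunctional_le (N : ℕ) (x : CSUq q) : ‖berezinFunctional q N x‖ ≤ ‖x‖ := by
  have h := norm_berezin_mul_le N x 1
  rw [mul_one, one_mul, mul_assoc ‖x‖, ← sq, mul_left_comm, angle_mul_norm_sq, mul_one] at h
  exact h

theorem berezinFunctional_one (N : ℕ) : berezinFunctional q N 1 = 1 := by
  rw [berezinFunctional_eq, mul_one, ← toCSUq_a'_pow_mul_a_pow, ← haarCoord_apply,
    angle_mul_haarCoord_pow]

/-- The hypothesis on `y` covers both `b` and `b*`, as `b` is normal; only `y*y` enters the norm of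
`Λ(y a^N)`. -/
theorem norm_berezin_mul_b_le (N : ℕ) (x : CSUq q) {y : CSUq q}
    (hy : star y * y = star (genb q) * genb q) :
    ‖berezinFunctional q N (x * y)‖ ≤ ‖x‖ * √(1 / (N + 1)) := by
  have hyb : ‖gnsVec q (y * gena q ^ N)‖ = ‖gnsVec q (genb q * gena q ^ N)‖ := by
    have h : ((‖gnsVec q (y * gena q ^ N)‖ ^ 2 : ℝ) : ℂ) =
        ((‖gnsVec q (genb q * gena q ^ N)‖ ^ 2 : ℝ) : ℂ) := by
      rw [norm_gnsVec_sq, norm_gnsVec_sq, star_mul, star_mul, mul_assoc, ← mul_assoc (star y), hy]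
      simp only [mul_assoc]
    exact (sq_eq_sq₀ (norm_nonneg _) (norm_nonneg _)).1 (by exact_mod_cast h)
  refine (norm_berezin_mul_le N x y).trans ?_
  rw [hyb]
  set S := ∑ k ∈ Finset.range (N + 1), (q : ℝ) ^ (2 * k) with hS
  have hS0 : 0 ≤ S := Finset.sum_nonneg fun k _ => pow_nonneg q.2.1.le _
  have h1 := angle_mul_norm_sq (q := q) N
  have h2 := angle_mul_norm_sq_b (q := q) N
  set u := ‖gnsVec q (gena q ^ N)‖
  set v := ‖gnsVec q (genb q * gena q ^ N)‖
  have h3 : S * (‖x‖ * u * v) = ‖x‖ * (S * u * v) := by ring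
  rw [h3]
  refine mul_le_mul_of_nonneg_left (Real.le_sqrt_of_sq_le ?_) (norm_nonneg _)
  have h4 : (S * u * v) ^ 2 = (S * u ^ 2) * (S * v ^ 2) := by ring
  rw [h4, h1, one_mul]
  exact h2

theorem tendsto_berezin_mul_b (x : CSUq q) {y : CSUq q}
    (hy : star y * y = star (genb q) * genb q) :
    Filter.Tendsto (fun N => berezinFunctional q N (x * y)) Filter.atTop (nhds 0) := by
  refine squeeze_zero_norm (fun N => norm_berezin_mul_b_le N x hy) ?_
  have h : Filter.Tendsto (fun N : ℕ => (1 / (N + 1) : ℝ)) Filter.atTop (nhds 0) :=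
    tendsto_one_div_add_atTop_nhds_zero_nat
  have h2 := ((Real.continuous_sqrt.tendsto 0).comp h).const_mul ‖x‖
  simpa using h2

theorem counit_genb {q : ℝ} : counit q (genb q) = 0 := rfl

theorem counit_eq_zero_of_sq {q : ℝ} {y : CSUq q} (hy : star y * y = star (genb q) * genb q) :
    counit q y = 0 := by
  have h := congrArg (counit q) hy
  rw [map_mul, map_mul, counit_genb, mul_zero, map_star] at h
  simpa using h

/-- The Berezin states converge to the counit on the Podleś sphere. -/
theorem tendsto_berezin_spectral {x : Coord q} (hx : x ∈ spectral q 0) :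
    Filter.Tendsto (fun N => berezinFunctional q N (Coord.toCSUq q x)) Filter.atTop
      (nhds (counit q (Coord.toCSUq q x))) := by
  have hbb' := (CSUq_relations (q : ℝ)).bb'
  -- In degree zero every normally ordered monomial other than `1` can be written with `b` or `b*`
  -- as its last factor; the counit and the limit of the `h_N` both vanish on it.
  have key : ∀ (y : Coord q) (g : Gen), g = .b ∨ g = .b' →
      Filter.Tendsto (fun N => berezinFunctional q N (Coord.toCSUq q (y * Coord.gen q g)))
        Filter.atTop (nhds (counit q (Coord.toCSUq q (y * Coord.gen q g)))) := by
    intro y g hg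
    have h : star (Coord.toCSUq q (Coord.gen q g)) * Coord.toCSUq q (Coord.gen q g) =
        star (genb q) * genb q := by
      rcases hg with rfl | rfl
      · rw [Coord.toCSUq_gen]; rfl
      · rw [Coord.toCSUq_gen, genMap, star_star, hbb']
    rw [map_mul, map_mul, counit_eq_zero_of_sq h, mul_zero]
    exact tendsto_berezin_mul_b _ h
  have hx' := mem_homogeneous_of_mem_spectral hx
  clear hx
  induction hx' using Submodule.span_induction with
  | mem x hx =>
    obtain ⟨k, P, rfl⟩ := hx
    induction P using Polynomial.induction_on' with
    | add P Q hP hQ =>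
      simp only [map_add, mul_add]
      exact hP.add hQ
    | monomial m c =>
      rw [Polynomial.aeval_monomial, ← Algebra.smul_def]
      simp only [mul_smul_comm, map_smul]
      refine Filter.Tendsto.const_smul ?_ c
      rcases m with - | m
      · rw [pow_zero, mul_one, zero_sub]
        rcases k with (- | n) | n
        · have : apow (q : ℝ) (Int.ofNat 0) * bpow q (-Int.ofNat 0) = 1 :=
            (congrArg₂ (· * ·) (pow_zero _) (pow_zero _)).trans (one_mul 1)
          rw [this]
          simp only [map_one, berezinFunctional_one]
          exact tendsto_const_nhds
        · have : bpow (q : ℝ) (-Int.ofNat (n + 1)) = Coord.gen q .b' ^ (n + 1) := bpow_neg (n + 1)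
          rw [this, pow_succ, ← mul_assoc]
          exact key _ _ (Or.inr rfl)
        · have : bpow (q : ℝ) (-Int.negSucc n) = Coord.gen q .b ^ (n + 1) := rfl
          rw [this, pow_succ, ← mul_assoc]
          exact key _ _ (Or.inl rfl)
      · have : coordT (q : ℝ) ^ (m + 1) = coordT q ^ m * Coord.gen q .b * Coord.gen q .b' := by
          rw [pow_succ, mul_assoc, ← coordT]
        rw [this, ← mul_assoc, ← mul_assoc]
        exact key _ _ (Or.inr rfl)
  | zero => simp
  | add x y _ _ hx hy =>
    simp only [map_add]
    exact hx.add hy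
  | smul c x _ hx =>
    simp only [map_smul]
    exact hx.const_smul c

/-- The limit is known only on the coordinate algebra. Contractivity of `h_N` and `ε` carries it to
`y` by approximation with elements of `𝒜_0`. -/
theorem counit_eq_of_berezin_const {y : CSUq q} (hy : y ∈ sphere q) {c : ℂ}
    (h : ∀ N, berezinFunctional q N y = c) : counit q y = c := by
  have hy' : ∀ z : Circle, circleAction q z y = (z : ℂ) ^ (0 : ℤ) • y := fun z => by
    rw [zpow_zero, one_smul]
    exact (StarSubalgebra.mem_iInf.1 hy z : _)
  rw [← dist_eq_zero]
  refine le_antisymm (le_of_forall_pos_le_add fun ε hε => ?_) dist_nonneg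
  obtain ⟨_, ⟨p, hp, rfl⟩, hpy⟩ := Metric.mem_closure_iff.1 (mem_closure_spectral hy') (ε / 2)
    (by positivity)
  rw [dist_eq_norm] at hpy
  have hlim := (tendsto_berezin_spectral hp).dist
    (tendsto_const_nhds (x := counit q (Coord.toCSUq q p)))
  rw [dist_self] at hlim
  -- For every `N` the distance from `ε(y)` to `c` is at most `ε + |h_N(p) - ε(p)|`, and the last
  -- term tends to zero.
  refine ge_of_tendsto (hlim.const_add ε |>.congr fun N => rfl) (Filter.Eventually.of_forall fun N => ?_) |>.trans
    (by rw [add_zero, zero_add])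
  have h1 : ‖counit q (y - Coord.toCSUq q p)‖ ≤ ε / 2 :=
    (NonUnitalStarAlgHom.norm_apply_le (counit q) _).trans hpy.le
  have h2 : ‖berezinFunctional q N (y - Coord.toCSUq q p)‖ ≤ ε / 2 :=
    (norm_berezinFunctional_le N _).trans hpy.le
  rw [map_sub] at h1 h2
  rw [h N] at h2
  rw [dist_eq_norm, dist_eq_norm]
  have h3 : counit q y - c = (counit q y - counit q (Coord.toCSUq q p)) -
      (c - berezinFunctional q N (Coord.toCSUq q p)) -
      (berezinFunctional q N (Coord.toCSUq q p) - counit q (Coord.toCSUq q p)) := by ring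
  rw [h3]
  refine (norm_sub_le _ _).trans (add_le_add ((norm_sub_le _ _).trans ?_) le_rfl)
  linarith

/-- The weak form of the vanishing of the commutator with `E`. -/
def IsWeaklyConstant (y : CSUq q) : Prop :=
  ∀ v ∈ spectral q 1, ∀ w ∈ spectral q 1,
    -((q : ℝ) : ℂ) * haar q (Coord.toCSUq q (leftAction (pairE q) v) * y * Coord.toCSUq q w) =
      haar q (Coord.toCSUq q v * y * Coord.toCSUq q (leftAction (pairE q) w))

theorem hasBidegree_b_mul_pow {q : ℝ} (m : ℕ) : HasBidegree 0 1 (Coord.gen q .b * coordT q ^ m) := by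
  have h := (hasBidegree_bpow (q := q) 1).mul (hasBidegree_aeval (q := q) (Polynomial.X ^ m))
  have hb : bpow q 1 = Coord.gen q .b := pow_one _
  simpa [hb] using h

theorem HasBidegree.mem_spectral {q : ℝ} {k d n : ℤ} {x : Coord q} (h : HasBidegree k d x)
    (hn : k + d = n) : x ∈ spectral q n :=
  mem_spectral_of_scale fun z => by rw [h z z, ← zpow_add, hn]

/-- Test elements `v = b (bb*)^m` and `w = a`. Moving `a` and `b*` around by the modular rules gives
for `h((bb*)^m y)` the same recursion as for `h((bb*)^m)`. -/
theorem IsWeaklyConstant.moment {y : CSUq q} (hy : IsWeaklyConstant y) (m : ℕ) :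
    angle q (m + 1) * haar q (Coord.toCSUq q (coordT q ^ m) * y) = haar q y := by
  refine (angle_mul_eq q (f := fun m => haar q (Coord.toCSUq q (coordT q ^ m) * y)) (fun m => ?_)
    m).trans (by simp)
  have hq := param_ne_zero q
  have hrel := Coord.relations (q : ℝ)
  have h := hy _ ((hasBidegree_b_mul_pow m).mem_spectral rfl) _ (hasBidegree_a.mem_spectral rfl)
  have ha : Coord.toCSUq q (Coord.gen q .a) = gena q := Coord.toCSUq_gen _ _
  have hb : Coord.toCSUq q (Coord.gen q .b') = star (genb q) := Coord.toCSUq_gen _ _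
  have h1 : Coord.gen q .a * (Coord.gen q .a' * coordT q ^ m) =
      coordT q ^ m - coordT q ^ (m + 1) := by
    rw [← mul_assoc, eq_sub_of_add_eq hrel.aa', sub_mul, one_mul, ← coordT, ← pow_succ']
  have h2 : Coord.gen q .b' * (Coord.gen q .b * coordT q ^ m) = coordT q ^ (m + 1) := by
    rw [← mul_assoc, ← hrel.bb', ← coordT, pow_succ']
  rw [leftAction_pairE_b_mul_pow, leftAction_pairE_gen, genMap, map_smul, smul_mul_assoc,
    smul_mul_assoc, map_smul, ha, hb, haar_mul_gena, haar_mul_star_genb, ← ha, ← hb, ← mul_assoc,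
    ← mul_assoc, ← map_mul (Coord.toCSUq q), ← map_mul (Coord.toCSUq q), h1, h2,
    map_sub (Coord.toCSUq q), sub_mul, map_sub, smul_eq_mul] at h
  rw [angle_succ q (m + 1)]
  field_simp at h
  linear_combination -h

theorem IsWeaklyConstant.haar_aeval_mul {y : CSUq q} (hy : IsWeaklyConstant y) (P : Polynomial ℂ) :
    haar q (Coord.toCSUq q (Polynomial.aeval (coordT q) P) * y) =
      haarCoord q (Polynomial.aeval (coordT q) P) * haar q y := by
  induction P using Polynomial.induction_on' with
  | add P Q hP hQ =>
    rw [map_add, map_add (Coord.toCSUq q), add_mul, map_add, hP, hQ, map_add, add_mul]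
  | monomial m c =>
    rw [Polynomial.aeval_monomial, ← Algebra.smul_def, map_smul, smul_mul_assoc, map_smul, map_smul,
      smul_mul_assoc]
    congr 1
    refine mul_left_cancel₀ (angle_ne_zero q m) ?_
    rw [hy.moment, ← mul_assoc, angle_mul_moment, one_mul]

/-- The modular rule rewrites `h((a*)^N y a^N)` as `q^{-2N} h(a^N (a*)^N y)`, and `a^N (a*)^N` is a
polynomial in `bb*`. So the functional factors as `h_N(1) h(y)`. -/
theorem IsWeaklyConstant.berezin_eq {y : CSUq q} (hy : IsWeaklyConstant y) (N : ℕ) :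
    berezinFunctional q N y = haar q y := by
  obtain ⟨R, -, hR⟩ := exists_apow_mul_apow (param_ne_zero q) (-(N : ℤ))
  rw [neg_neg, apow_natCast, apow_neg] at hR
  have hC : gena q ^ N * star (gena q) ^ N = Coord.toCSUq q (Polynomial.aeval (coordT q) R) := by
    rw [← hR, map_mul, map_pow, map_pow, Coord.toCSUq_gen, Coord.toCSUq_gen]; rfl
  have h1 : ∀ x, haar q (star (gena q) ^ N * x * gena q ^ N) = (((q : ℝ) : ℂ) ^ (2 * N))⁻¹ *
      haar q (Coord.toCSUq q (Polynomial.aeval (coordT q) R) * x) := fun x => by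
    rw [haar_mul_gena_pow, ← mul_assoc, hC]
  have h2 := berezinFunctional_one (q := q) N
  rw [berezinFunctional_eq, h1, mul_one, ← haarCoord_apply] at h2
  rw [berezinFunctional_eq, h1, hy.haar_aeval_mul, ← mul_assoc, ← mul_assoc,
    mul_assoc (angle q (N + 1)), h2, one_mul]

theorem IsWeaklyConstant.counit_eq {y : CSUq q} (hy : IsWeaklyConstant y) (hs : y ∈ sphere q)
    (N : ℕ) : counit q y = berezinFunctional q N y := by
  rw [counit_eq_of_berezin_const hs hy.berezin_eq, hy.berezin_eq]

end BerezinLimit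

/-! ### Closability of `∂_e` and `∂_f`, and their closed graphs. -/

section Ladder

variable {q : Set.Ioc (0 : ℝ) 1}

/-- `Coord q` carries no involution, so adjoints are handled by existence of a preimage in
`C(SU_q(2))`. -/
theorem exists_star {q : ℝ} (x : Coord q) : ∃ y, Coord.toCSUq q y = star (Coord.toCSUq q x) := by
  let M : Submodule ℂ (Coord q) :=
    { carrier := {x | ∃ y, Coord.toCSUq q y = star (Coord.toCSUq q x)}
      add_mem' := by
        rintro x x' ⟨y, hy⟩ ⟨y', hy'⟩
        exact ⟨y + y', by rw [map_add, map_add, hy, hy', star_add]⟩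
      zero_mem' := ⟨0, by rw [map_zero, star_zero]⟩
      smul_mem' := by
        rintro c x ⟨y, hy⟩
        exact ⟨star c • y, by rw [map_smul, map_smul, hy, star_smul]⟩ }
  refine Coord.mem_of_gen_mul_mem M ⟨1, by rw [map_one, star_one]⟩ ?_ x
  rintro g x ⟨y, hy⟩
  have hg : ∃ z, Coord.toCSUq q z = star (Coord.toCSUq q (Coord.gen q g)) := by
    cases g
    · exact ⟨Coord.gen q .a', by rw [Coord.toCSUq_gen, Coord.toCSUq_gen]; rfl⟩
    · exact ⟨Coord.gen q .a, by rw [Coord.toCSUq_gen, Coord.toCSUq_gen, genMap, genMap, star_star]⟩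
    · exact ⟨Coord.gen q .b', by rw [Coord.toCSUq_gen, Coord.toCSUq_gen]; rfl⟩
    · exact ⟨Coord.gen q .b, by rw [Coord.toCSUq_gen, Coord.toCSUq_gen, genMap, genMap, star_star]⟩
  obtain ⟨z, hz⟩ := hg
  exact ⟨y * z, by rw [map_mul, map_mul, hy, hz, star_mul]⟩

theorem exists_star_mem_spectral {q : ℝ} {n : ℤ} {x : Coord q} (hx : x ∈ spectral q n) :
    ∃ y ∈ spectral q (-n), Coord.toCSUq q y = star (Coord.toCSUq q x) := by
  obtain ⟨y, hy⟩ := exists_star x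
  refine ⟨y, fun z => ?_, hy⟩
  have hs : star (z : ℂ) = (z : ℂ)⁻¹ := by
    rw [← Circle.coe_inv, Circle.coe_inv_eq_conj]; rfl
  rw [hy, map_star, hx z, star_smul, star_zpow₀, hs, inv_zpow, zpow_neg]

theorem scale_scale {q : ℝ} (z w z' w' : ℂˣ) (x : Coord q) :
    scale q z w (scale q z' w' x) = scale q (z * z') (w * w') x := by
  have : (scale q z w).comp (scale q z' w') = scale q (z * z') (w * w') := Coord.hom_ext fun g => by
    rw [AlgHom.comp_apply, scale_gen, scale_gen]
    cases g <;> simp only [genMap, map_smul, scale_gen, smul_smul] <;> simp [mul_comm]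
  exact congrArg (fun f => f x) this

/-- A skew derivation is homogeneous if it is so on the generators. -/
theorem IsSkew.scale_leftAction {η : Coord q →ₗ[ℂ] ℂ} (hη : IsSkew q η) {d : ℤ}
    (hd : ∀ g (z : ℂˣ), scale q z z (leftAction η (Coord.gen q g)) =
      ((z ^ d : ℂˣ) : ℂ) • leftAction η (scale q z z (Coord.gen q g))) (z : ℂˣ) (x : Coord q) :
    scale q z z (leftAction η x) = ((z ^ d : ℂˣ) : ℂ) • leftAction η (scale q z z x) := by
  let M : Submodule ℂ (Coord q) := LinearMap.eqLocus
    ((scale q z z).toLinearMap ∘ₗ leftAction η)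
    (((z ^ d : ℂˣ) : ℂ) • (leftAction η ∘ₗ (scale q z z).toLinearMap))
  have hM : ∀ x, x ∈ M ↔ scale q z z (leftAction η x) =
    ((z ^ d : ℂˣ) : ℂ) • leftAction η (scale q z z x) := fun x => Iff.rfl
  refine (hM x).1 (Coord.mem_of_gen_mul_mem M ?_ (fun g x hx => ?_) x)
  · rw [hM, _root_.map_one (scale q z z), leftAction_one, hη.map_one]; simp
  · rw [hM] at hx ⊢
    rw [hη.leftAction_mul, map_add, map_mul, map_mul, hd, hx, map_mul, hη.leftAction_mul,
      scale_scale, scale_scale, scale_scale, scale_scale, mul_comm z, mul_comm z, smul_mul_assoc,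
      mul_smul_comm, smul_add]

theorem IsSkew.leftAction_mem_spectral {η : Coord q →ₗ[ℂ] ℂ} (hη : IsSkew q η) {d : ℤ}
    (hd : ∀ g (z : ℂˣ), scale q z z (leftAction η (Coord.gen q g)) =
      ((z ^ d : ℂˣ) : ℂ) • leftAction η (scale q z z (Coord.gen q g))) {n : ℤ} {x : Coord q}
    (hx : x ∈ spectral q n) : leftAction η x ∈ spectral q (n + d) :=
  mem_spectral_of_scale fun z => by
    rw [hη.scale_leftAction hd, scale_of_mem_spectral hx, map_smul, smul_smul, ← Units.val_mul,
      ← zpow_add, add_comm]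

theorem leftAction_pairE_mem {n : ℤ} {x : Coord q} (hx : x ∈ spectral q n) :
    leftAction (pairE q) x ∈ spectral q (n + (-2)) :=
  (isSkew_pairE q).leftAction_mem_spectral (fun g z => by
    rw [leftAction_pairE_gen, scale_gen]
    cases g <;> simp only [genMap, map_smul, leftAction_pairE_gen, map_zero, smul_zero, scale_gen,
      smul_smul]
    · congr 1
      rw [← Units.val_mul]
      congr 1
      group
    · rw [mul_comm, ← mul_assoc, ← Units.val_mul]
      congr 3
      group) hx

theorem leftAction_pairF_mem {n : ℤ} {x : Coord q} (hx : x ∈ spectral q n) :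
    leftAction (pairF q) x ∈ spectral q (n + 2) :=
  (isSkew_pairF q).leftAction_mem_spectral (fun g z => by
    rw [leftAction_pairF_gen, scale_gen]
    cases g <;> simp only [genMap, map_smul, leftAction_pairF_gen, map_zero, smul_zero, scale_gen,
      smul_smul]
    · rw [mul_comm, ← mul_assoc, ← Units.val_mul]
      congr 3
      group
    · congr 1
      rw [← Units.val_mul]
      congr 1
      group) hx

/-- The map `Λ` on the coordinate algebra. -/
def coordVec (q : ℝ) : Coord q →ₗ[ℂ] L2 q := gnsVec q ∘ₗ (Coord.toCSUq q).toLinearMap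

theorem coordVec_apply {q : ℝ} (x : Coord q) : coordVec q x = gnsVec q (Coord.toCSUq q x) := rfl

/-- The adjoint relation for a skew derivation. -/
theorem IsSkew.haar_mul_leftAction {η : Coord q →ₗ[ℂ] ℂ} (hη : IsSkew q η) {n m : ℤ}
    {u x : Coord q} (hu : u ∈ spectral q (-m)) (hx : x ∈ spectral q n) :
    haarCoord q (u * leftAction η x) =
      -((sqrtUnit q ^ (n - m) : ℂˣ) : ℂ) * haarCoord q (leftAction η u * x) := by
  have h := haarCoord_leftAction_of_isSkew hη (u * x)
  rw [hη.leftAction_mul, scale_of_mem_spectral hx, scale_of_mem_spectral hu, map_add,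
    mul_smul_comm, smul_mul_assoc, map_smul, map_smul, inv_zpow, ← zpow_neg, neg_neg] at h
  simp only [smul_eq_mul] at h
  have h0 : ((sqrtUnit q ^ m : ℂˣ) : ℂ) ≠ 0 := Units.ne_zero _
  rw [zpow_sub, Units.val_mul, Units.val_inv_eq_inv_val]
  field_simp
  linear_combination h

theorem IsSkew.exists_adjoint {η : Coord q →ₗ[ℂ] ℂ} (hη : IsSkew q η) {m : ℤ} {u : Coord q}
    (hu : u ∈ spectral q m) (n : ℤ) : ∃ u', ∀ x ∈ spectral q n,
      ⟪coordVec q u, coordVec q (leftAction η x)⟫_ℂ = ⟪coordVec q u', coordVec q x⟫_ℂ := by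
  obtain ⟨v, hv, hvu⟩ := exists_star_mem_spectral hu
  obtain ⟨u', hu'⟩ := exists_star (-((sqrtUnit q ^ (n - m) : ℂˣ) : ℂ) • leftAction η v)
  refine ⟨u', fun x hx => ?_⟩
  rw [coordVec_apply, coordVec_apply, coordVec_apply, coordVec_apply, inner_gnsVec, inner_gnsVec,
    ← hvu, hu', star_star, ← map_mul, ← map_mul, ← haarCoord_apply, ← haarCoord_apply,
    hη.haar_mul_leftAction hv hx, smul_mul_assoc, map_smul, smul_eq_mul]

/-- The closure of the graph of `Λ(x) ↦ Λ(T x)`, `x ∈ 𝒜_n`. -/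
def ladderGraph (q : ℝ) (n : ℤ) (T : Coord q →ₗ[ℂ] Coord q) : Submodule ℂ (L2 q × L2 q) :=
  ((spectral q n).map ((coordVec q).prod (coordVec q ∘ₗ T))).topologicalClosure

theorem mem_ladderGraph {q : ℝ} {n : ℤ} (T : Coord q →ₗ[ℂ] Coord q) {x : Coord q}
    (hx : x ∈ spectral q n) : (coordVec q x, coordVec q (T x)) ∈ ladderGraph q n T :=
  Submodule.le_topologicalClosure _ ⟨x, hx, rfl⟩

theorem ladderGraph_induction {q : ℝ} {n : ℤ} {T : Coord q →ₗ[ℂ] Coord q} {s : Set (L2 q × L2 q)}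
    (hs : IsClosed s) (h : ∀ x ∈ spectral q n, (coordVec q x, coordVec q (T x)) ∈ s)
    {p : L2 q × L2 q} (hp : p ∈ ladderGraph q n T) : p ∈ s := by
  refine closure_minimal ?_ hs hp
  rintro _ ⟨x, hx, rfl⟩
  exact h x hx

theorem isClosed_Hspec (q : ℝ) (n : ℤ) : IsClosed (Hspec q n : Set (L2 q)) :=
  Submodule.isClosed_topologicalClosure _

theorem coordVec_mem {q : ℝ} {n : ℤ} {x : Coord q} (hx : x ∈ spectral q n) :
    coordVec q x ∈ Hspec q n := Submodule.le_topologicalClosure _ ⟨x, hx, rfl⟩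

theorem Hspec_induction {q : ℝ} {n : ℤ} {s : Set (L2 q)} (hs : IsClosed s)
    (h : ∀ x ∈ spectral q n, coordVec q x ∈ s) {v : L2 q} (hv : v ∈ Hspec q n) : v ∈ s := by
  refine closure_minimal ?_ hs hv
  rintro _ ⟨x, hx, rfl⟩
  exact h x hx

theorem ladderGraph_mem_Hspec {q : ℝ} {n m : ℤ} {T : Coord q →ₗ[ℂ] Coord q}
    (hT : ∀ x ∈ spectral q n, T x ∈ spectral q m) {p : L2 q × L2 q} (hp : p ∈ ladderGraph q n T) :
    p.1 ∈ Hspec q n ∧ p.2 ∈ Hspec q m :=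
  ladderGraph_induction (s := {p | p.1 ∈ Hspec q n ∧ p.2 ∈ Hspec q m})
    (((isClosed_Hspec q n).preimage continuous_fst).inter
      ((isClosed_Hspec q m).preimage continuous_snd))
    (fun x hx => ⟨coordVec_mem hx, coordVec_mem (hT x hx)⟩) hp

/-- Closability from a densely defined adjoint: integration by parts moves `∂_η` onto `Λ(u)`, so `v`
is orthogonal to `Λ(𝒜_m)`, which is dense in `H_m ∋ v`. -/
theorem IsSkew.eq_zero_of_mem_ladderGraph {η : Coord q →ₗ[ℂ] ℂ} (hη : IsSkew q η) {n m : ℤ}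
    (hT : ∀ x ∈ spectral q n, leftAction η x ∈ spectral q m) {v : L2 q}
    (hv : (0, v) ∈ ladderGraph q n (leftAction η)) : v = 0 := by
  have horth : ∀ u ∈ spectral q m, ⟪coordVec q u, v⟫_ℂ = 0 := fun u hu => by
    obtain ⟨u', hu'⟩ := hη.exists_adjoint hu n
    have := ladderGraph_induction (s := {p : L2 q × L2 q | ⟪coordVec q u, p.2⟫_ℂ = ⟪coordVec q u', p.1⟫_ℂ})
      (isClosed_eq (continuous_const.inner continuous_snd) (continuous_const.inner continuous_fst))
      hu' hv
    simpa using this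
  have hmem := (ladderGraph_mem_Hspec hT hv).2
  have h := Hspec_induction (s := {u : L2 q | ⟪u, v⟫_ℂ = 0})
    (isClosed_eq (continuous_id.inner continuous_const) continuous_const) horth hmem
  exact inner_self_eq_zero.1 h

/-- This replaces the closed operators `E` and `F` by closed subspaces of `L² × L²`, where domains
need no separate bookkeeping and closed conditions can be checked on `Λ(𝒜_n)`. -/
theorem IsSkew.ladder_closure_graph {η : Coord q →ₗ[ℂ] ℂ} (hη : IsSkew q η) {n m : ℤ}
    (hT : ∀ x ∈ spectral q n, leftAction η x ∈ spectral q m) (p : Hspec q n × Hspec q m) :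
    p ∈ (ladder q n m (leftAction η)).closure.graph ↔
      ((p.1 : L2 q), (p.2 : L2 q)) ∈ ladderGraph q n (leftAction η) := by
  let ι : Hspec q n × Hspec q m →ₗ[ℂ] L2 q × L2 q :=
    (Hspec q n).subtype.prodMap (Hspec q m).subtype
  let S : Submodule ℂ (L2 q × L2 q) :=
    (spectral q n).map ((coordVec q).prod (coordVec q ∘ₗ leftAction η))
  have hSg : (ladder q n m (leftAction η)).graph = S.comap ι := by
    refine Submodule.toLinearPMap_graph_eq _ fun p hp h0 => ?_
    have h1 : ((0 : L2 q), (p.2 : L2 q)) ∈ ladderGraph q n (leftAction η) := by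
      have h2 : ι p ∈ ladderGraph q n (leftAction η) := Submodule.le_topologicalClosure _ hp
      have h3 : ι p = ((0 : L2 q), (p.2 : L2 q)) := by
        change ((p.1 : L2 q), (p.2 : L2 q)) = _
        rw [h0]; rfl
      rwa [h3] at h2
    exact Subtype.ext (hη.eq_zero_of_mem_ladderGraph hT h1)
  have hind : Topology.IsInducing ι :=
    (Topology.IsInducing.subtypeVal.prodMap Topology.IsInducing.subtypeVal : _)
  have hcl : ∀ p, p ∈ (S.comap ι).topologicalClosure ↔ ι p ∈ ladderGraph q n (leftAction η) := by
    intro p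
    change p ∈ closure (ι ⁻¹' S) ↔ ι p ∈ closure (S : Set (L2 q × L2 q))
    rw [hind.closure_eq_preimage_closure_image, Set.mem_preimage, Set.image_preimage_eq_of_subset]
    rintro _ ⟨x, hx, rfl⟩
    exact ⟨(⟨_, coordVec_mem hx⟩, ⟨_, coordVec_mem (hT x hx)⟩), rfl⟩
  have hclosable : (ladder q n m (leftAction η)).IsClosable := by
    refine ⟨(S.comap ι).topologicalClosure.toLinearPMap, ?_⟩
    rw [hSg, Submodule.toLinearPMap_graph_eq]
    intro p hp h0
    rw [hcl] at hp
    refine Subtype.ext (hη.eq_zero_of_mem_ladderGraph hT (v := (p.2 : L2 q)) ?_)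
    have h3 : ι p = ((0 : L2 q), (p.2 : L2 q)) := by
      change ((p.1 : L2 q), (p.2 : L2 q)) = _
      rw [h0]; rfl
    rwa [h3] at hp
  rw [← hclosable.graph_closure_eq_closure_graph, hSg]
  exact hcl p

end Ladder

/-! ### The algebraic coaction map `W` and its surjectivity on graded tensors. -/

section CoactionUnitary

variable {q : ℝ} (r : Rep q)

/-- The action of the coordinate algebra on the space of a representation, forgetting continuity. -/
def Rep.coordEnd : Coord q →ₐ[ℂ] Module.End ℂ r.H :=
  AlgHom.comp (⟨ContinuousLinearMap.toLinearMapRingHom, fun _ => rfl⟩ :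
    (r.H →L[ℂ] r.H) →ₐ[ℂ] Module.End ℂ r.H) r.coord

/-- The action of `𝒪(SU_q(2)) ⊗ 𝒪(SU_q(2))` on `H_r ⊗ 𝒪(SU_q(2))`. -/
def Rep.act : Coord q ⊗[ℂ] Coord q →ₐ[ℂ] Module.End ℂ (r.H ⊗[ℂ] Coord q) :=
  Module.endTensorEndAlgHom.comp
    (Algebra.TensorProduct.map r.coordEnd (Algebra.lmul ℂ (Coord q)))

theorem Rep.act_tmul (x y : Coord q) (ζ : r.H) (w : Coord q) :
    r.act (x ⊗ₜ y) (ζ ⊗ₜ w) = r.coord x ζ ⊗ₜ (y * w) := rfl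

/-- The map `ζ ⊗ w ↦ Δ(w)(ζ ⊗ 1)`. -/
def Rep.coaction : r.H ⊗[ℂ] Coord q →ₗ[ℂ] r.H ⊗[ℂ] Coord q :=
  TensorProduct.lift (LinearMap.mk₂ ℂ (fun ζ w => r.act (Coord.comul q w) (ζ ⊗ₜ 1))
    (fun ζ ζ' w => by rw [TensorProduct.add_tmul, map_add])
    (fun c ζ w => by rw [← TensorProduct.smul_tmul', map_smul])
    (fun ζ w w' => by rw [map_add, map_add, LinearMap.add_apply])
    (fun c ζ w => by rw [map_smul, map_smul, LinearMap.smul_apply]))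

theorem Rep.coaction_tmul (ζ : r.H) (w : Coord q) :
    r.coaction (ζ ⊗ₜ w) = r.act (Coord.comul q w) (ζ ⊗ₜ 1) := rfl

/-- Multiplicativity of `Δ` in operator form: `W(1 ⊗ x) = Δ(x)W`. -/
theorem Rep.coaction_act (x : Coord q) (t : r.H ⊗[ℂ] Coord q) :
    r.coaction (r.act (1 ⊗ₜ x) t) = r.act (Coord.comul q x) (r.coaction t) := by
  induction t with
  | zero => simp
  | add s t hs ht => simp only [map_add, hs, ht]
  | tmul ζ w =>
    rw [r.act_tmul, map_one, r.coaction_tmul, r.coaction_tmul, map_mul, map_mul]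
    rfl

/-- By coassociativity `∂_η` touches only the second leg of `Δ(w)`. Hence `W` commutes with `1 ⊗
∂_η`. -/
theorem Rep.coaction_leftAction (η : Coord q →ₗ[ℂ] ℂ) (t : r.H ⊗[ℂ] Coord q) :
    r.coaction (LinearMap.lTensor r.H (leftAction η) t) =
      LinearMap.lTensor r.H (leftAction η) (r.coaction t) := by
  induction t with
  | zero => simp
  | add s t hs ht => simp only [map_add, hs, ht]
  | tmul ζ w =>
    rw [LinearMap.lTensor_tmul, r.coaction_tmul, r.coaction_tmul, comul_leftAction]
    generalize Coord.comul q w = s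
    induction s with
    | zero => simp
    | add s t hs ht => simp only [map_add, LinearMap.add_apply, hs, ht]
    | tmul x y =>
      rw [LinearMap.lTensor_tmul, r.act_tmul, r.act_tmul, LinearMap.lTensor_tmul, mul_one, mul_one]

/-- The tensors in `H_r ⊗ 𝒜_n`. -/
def Rep.gradedTensor (n : ℤ) : Submodule ℂ (r.H ⊗[ℂ] Coord q) :=
  Submodule.span ℂ {t | ∃ ζ, ∃ w ∈ spectral q n, t = ζ ⊗ₜ w}

variable {r}

theorem act_mem_gradedTensor {n m : ℤ} {x : Coord q} (hx : x ∈ spectral q m) {t : r.H ⊗[ℂ] Coord q}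
    (ht : t ∈ r.gradedTensor n) : r.act (1 ⊗ₜ x) t ∈ r.gradedTensor (m + n) := by
  induction ht using Submodule.span_induction with
  | mem t ht =>
    obtain ⟨ζ, w, hw, rfl⟩ := ht
    exact Submodule.subset_span ⟨ζ, x * w, spectral_mul hx hw, by rw [r.act_tmul, map_one]; rfl⟩
  | zero => rw [map_zero]; exact zero_mem _
  | add s t _ _ hs ht => rw [map_add]; exact add_mem hs ht
  | smul c t _ ht => rw [map_smul]; exact Submodule.smul_mem _ _ ht

variable (r) in
/-- The elements `w` such that `H_r ⊗ w` is covered by `H_r ⊗ 𝒜_n` under the coaction map. -/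
def Rep.covered (n : ℤ) : Submodule ℂ (Coord q) where
  carrier := {w | ∀ ζ : r.H, ∃ t ∈ r.gradedTensor n, r.coaction t = ζ ⊗ₜ w}
  add_mem' {w w'} h h' ζ := by
    obtain ⟨t, ht, e⟩ := h ζ
    obtain ⟨t', ht', e'⟩ := h' ζ
    exact ⟨t + t', add_mem ht ht', by rw [map_add, e, e', TensorProduct.tmul_add]⟩
  zero_mem' ζ := ⟨0, zero_mem _, by rw [map_zero, TensorProduct.tmul_zero]⟩
  smul_mem' c w h ζ := by
    obtain ⟨t, ht, e⟩ := h ζ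
    exact ⟨c • t, Submodule.smul_mem _ _ ht, by rw [map_smul, e, TensorProduct.tmul_smul]⟩

theorem one_mem_covered : 1 ∈ r.covered 0 := fun ζ =>
  ⟨ζ ⊗ₜ 1, Submodule.subset_span ⟨ζ, 1, mem_spectral_of_scale fun z => by simp, rfl⟩, by
    rw [r.coaction_tmul, map_one, map_one]; rfl⟩

/-- A generator factors as `1 ⊗ g = Δ(x)(u ⊗ 1) + Δ(y)(v ⊗ 1)`. -/
theorem mul_mem_covered_of_factor {g x y u v : Coord q} {n m : ℤ} (hx : x ∈ spectral q m)
    (hy : y ∈ spectral q m) (h : (1 : Coord q) ⊗ₜ[ℂ] g = Coord.comul q x * (u ⊗ₜ 1) +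
      Coord.comul q y * (v ⊗ₜ 1)) {w : Coord q} (hw : w ∈ r.covered n) :
    g * w ∈ r.covered (m + n) := fun ζ => by
  obtain ⟨s, hs, es⟩ := hw (r.coord u ζ)
  obtain ⟨t, ht, et⟩ := hw (r.coord v ζ)
  refine ⟨r.act (1 ⊗ₜ x) s + r.act (1 ⊗ₜ y) t,
    add_mem (act_mem_gradedTensor hx hs) (act_mem_gradedTensor hy ht), ?_⟩
  rw [map_add, r.coaction_act, r.coaction_act, es, et]
  have h1 : ∀ c : Coord q, r.coord c ζ ⊗ₜ[ℂ] w = r.act (c ⊗ₜ 1) (ζ ⊗ₜ w) := fun c => by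
    rw [r.act_tmul, one_mul]
  have h2 : ζ ⊗ₜ[ℂ] (g * w) = r.act (1 ⊗ₜ g) (ζ ⊗ₜ w) := by
    rw [r.act_tmul, map_one]; rfl
  rw [h1, h1, h2, h, map_add, map_mul, map_mul]
  rfl

/-- The degree of a generator. -/
def genDegree : Gen → ℤ := genMap 1 (-1) 1 (-1)

theorem gen_mem_spectral (g : Gen) : Coord.gen q g ∈ spectral q (genDegree g) :=
  mem_spectral_of_scale fun z => by
    rw [scale_gen]
    cases g <;> simp [genDegree, genMap]

/-- The factors `u, v` come from the Hopf identity `1 ⊗ g = Δ(g₂)(S⁻¹(g₁) ⊗ 1)`: they are the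
inverse antipode of the first-leg coefficients of `Δ(g)`. The elements `x, y` have the degree of
`g`, which preserves the grading. -/
theorem gen_mul_mem_covered (hq : (q : ℂ) ≠ 0) (g : Gen) {n : ℤ} {w : Coord q}
    (hw : w ∈ r.covered n) : Coord.gen q g * w ∈ r.covered (genDegree g + n) := by
  have h := Coord.relations q
  have h1 := eq_sub_of_add_eq h.a'a
  have h2 := eq_sub_of_add_eq h.aa'
  cases g
  · refine mul_mem_covered_of_factor (x := .gen q .a) (y := .gen q .b) (u := .gen q .a')
      (v := .gen q .b') (gen_mem_spectral .a) (gen_mem_spectral .b) ?_ hw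
    simp only [Coord.comul_gen, genMap, add_mul, sub_mul, smul_mul_assoc,
      Algebra.TensorProduct.tmul_mul_tmul, mul_one, h2, h.a'b', ← TensorProduct.smul_tmul',
      TensorProduct.sub_tmul]
    module
  · refine mul_mem_covered_of_factor (x := .gen q .a') (y := .gen q .b') (u := .gen q .a)
      (v := (q : ℂ) ^ 2 • .gen q .b) (gen_mem_spectral .a') (gen_mem_spectral .b') ?_ hw
    simp only [Coord.comul_gen, genMap, add_mul, sub_mul, smul_mul_assoc, mul_smul_comm,
      Algebra.TensorProduct.tmul_mul_tmul, mul_one, h1, h.ba, ← h.bb', ← TensorProduct.smul_tmul',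
      TensorProduct.sub_tmul]
    module
  · refine mul_mem_covered_of_factor (x := .gen q .a) (y := .gen q .b) (u := -(q : ℂ) • .gen q .b)
      (v := .gen q .a) (gen_mem_spectral .a) (gen_mem_spectral .b) ?_ hw
    simp only [Coord.comul_gen, genMap, add_mul, sub_mul, smul_mul_assoc, mul_smul_comm,
      Algebra.TensorProduct.tmul_mul_tmul, mul_one, h1, h.ba, ← h.bb', ← TensorProduct.smul_tmul',
      TensorProduct.sub_tmul]
    module
  · refine mul_mem_covered_of_factor (x := .gen q .a') (y := .gen q .b')
      (u := -(q : ℂ)⁻¹ • .gen q .b') (v := .gen q .a') (gen_mem_spectral .a') (gen_mem_spectral .b')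
      ?_ hw
    simp only [Coord.comul_gen, genMap, add_mul, sub_mul, smul_mul_assoc, mul_smul_comm,
      Algebra.TensorProduct.tmul_mul_tmul, mul_one, h2, h.a'b', ← TensorProduct.smul_tmul',
      TensorProduct.sub_tmul, smul_smul, smul_sub]
    rw [neg_mul, inv_mul_cancel₀ hq]
    module

theorem gen_pow_mul_mem_covered (hq : (q : ℂ) ≠ 0) (g : Gen) (j : ℕ) {n : ℤ} {w : Coord q}
    (hw : w ∈ r.covered n) : Coord.gen q g ^ j * w ∈ r.covered (j * genDegree g + n) := by
  induction j with
  | zero => simpa using hw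
  | succ j ih =>
    have := gen_mul_mem_covered hq g ih
    rw [← mul_assoc, ← pow_succ'] at this
    convert this using 1
    push_cast
    ring_nf

theorem coordT_pow_mem_covered (hq : (q : ℂ) ≠ 0) (m : ℕ) : coordT q ^ m ∈ r.covered 0 := by
  induction m with
  | zero => rw [pow_zero]; exact one_mem_covered
  | succ m ih =>
    rw [pow_succ', coordT, mul_assoc]
    have h := gen_mul_mem_covered hq .b (gen_mul_mem_covered hq .b' ih)
    have hd : genDegree .b + (genDegree .b' + 0) = 0 := by norm_num [genDegree, genMap]
    rwa [hd] at h

theorem aeval_coordT_mem_covered (hq : (q : ℂ) ≠ 0) (P : Polynomial ℂ) :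
    Polynomial.aeval (coordT q) P ∈ r.covered 0 := by
  induction P using Polynomial.induction_on' with
  | add P Q hP hQ => rw [map_add]; exact add_mem hP hQ
  | monomial m c =>
    rw [Polynomial.aeval_monomial, ← Algebra.smul_def]
    exact Submodule.smul_mem _ _ (coordT_pow_mem_covered hq m)

theorem bpow_mul_mem_covered (hq : (q : ℂ) ≠ 0) (d : ℤ) {l : ℤ} {w : Coord q}
    (hw : w ∈ r.covered l) : bpow q d * w ∈ r.covered (d + l) := by
  rcases d with j | j
  · have h := gen_pow_mul_mem_covered hq .b j hw
    have hd : (j : ℤ) * genDegree .b + l = Int.ofNat j + l := by simp [genDegree, genMap]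
    rw [hd] at h
    exact h
  · have h := gen_pow_mul_mem_covered hq .b' (j + 1) hw
    have hd : ((j + 1 : ℕ) : ℤ) * genDegree .b' + l = Int.negSucc j + l := by
      simp only [genDegree, genMap, Int.negSucc_eq]; push_cast; ring
    rw [hd] at h
    exact h

theorem apow_mul_mem_covered (hq : (q : ℂ) ≠ 0) (d : ℤ) {l : ℤ} {w : Coord q}
    (hw : w ∈ r.covered l) : apow q d * w ∈ r.covered (d + l) := by
  rcases d with j | j
  · have h := gen_pow_mul_mem_covered hq .a j hw
    have hd : (j : ℤ) * genDegree .a + l = Int.ofNat j + l := by simp [genDegree, genMap]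
    rw [hd] at h
    exact h
  · have h := gen_pow_mul_mem_covered hq .a' (j + 1) hw
    have hd : ((j + 1 : ℕ) : ℤ) * genDegree .a' + l = Int.negSucc j + l := by
      simp only [genDegree, genMap, Int.negSucc_eq]; push_cast; ring
    rw [hd] at h
    exact h

/-- The preimage under `W` must stay in `H_r ⊗ 𝒜_n`, because the commutator with `x` is controlled
only on `𝒜_n`. Degrees add up along the generators of a normally ordered monomial. -/
theorem spectral_le_covered {q : Set.Ioc (0 : ℝ) 1} {r : Rep q} {n : ℤ} {x : Coord q}
    (hx : x ∈ spectral q n) : x ∈ r.covered n := by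
  have hq := param_ne_zero q
  have hx' := mem_homogeneous_of_mem_spectral hx
  clear hx
  induction hx' using Submodule.span_induction with
  | mem x hx =>
    obtain ⟨k, P, rfl⟩ := hx
    have h := apow_mul_mem_covered (r := r) hq k
      (bpow_mul_mem_covered hq (n - k) (aeval_coordT_mem_covered hq P))
    have hd : k + (n - k + 0) = n := by ring
    rw [hd] at h
    exact h
  | zero => exact zero_mem _
  | add x y _ _ hx hy => exact add_mem hx hy
  | smul c x _ hx => exact Submodule.smul_mem _ _ hx

end CoactionUnitary

/-! ### The regular representation on `H_r ⊗ L²(SU_q(2))`. -/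

section RegularRepresentation

/-- The involution on the set of generators. -/
def starGen : Gen → Gen := genMap .a' .a .b' .b

/-- One and the same `y` has to represent the adjoint of `x` under both homomorphisms; two separate
existence statements would not suffice for the isometry of `W`. -/
theorem Coord.exists_star_of_gen {q : ℝ} {A B : Type*} [Ring A] [Algebra ℂ A] [StarRing A]
    [StarModule ℂ A] [Ring B] [Algebra ℂ B] [StarRing B] [StarModule ℂ B] (f : Coord q →ₐ[ℂ] A)
    (g : Coord q →ₐ[ℂ] B) (hf : ∀ k, f (Coord.gen q (starGen k)) = star (f (Coord.gen q k)))
    (hg : ∀ k, g (Coord.gen q (starGen k)) = star (g (Coord.gen q k))) (x : Coord q) :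
    ∃ y, f y = star (f x) ∧ g y = star (g x) := by
  let M : Submodule ℂ (Coord q) :=
    { carrier := {x | ∃ y, f y = star (f x) ∧ g y = star (g x)}
      add_mem' := by
        rintro x x' ⟨y, hy, hz⟩ ⟨y', hy', hz'⟩
        exact ⟨y + y', by rw [map_add, map_add, hy, hy', star_add],
          by rw [map_add, map_add, hz, hz', star_add]⟩
      zero_mem' := ⟨0, by rw [map_zero, star_zero], by rw [map_zero, star_zero]⟩
      smul_mem' := by
        rintro c x ⟨y, hy, hz⟩
        exact ⟨star c • y, by rw [map_smul, map_smul, hy, star_smul],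
          by rw [map_smul, map_smul, hz, star_smul]⟩ }
  refine Coord.mem_of_gen_mul_mem M ⟨1, by rw [map_one, star_one], by rw [map_one, star_one]⟩ ?_ x
  rintro k x ⟨y, hy, hz⟩
  exact ⟨y * Coord.gen q (starGen k), by rw [map_mul, map_mul, hy, hf, star_mul],
    by rw [map_mul, map_mul, hz, hg, star_mul]⟩

theorem toCSUq_starGen (q : ℝ) (k : Gen) :
    Coord.toCSUq q (Coord.gen q (starGen k)) = star (Coord.toCSUq q (Coord.gen q k)) := by
  rw [Coord.toCSUq_gen, Coord.toCSUq_gen]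
  cases k <;> simp [starGen, genMap]

theorem Rep.coord_starGen {q : ℝ} (r : Rep q) (k : Gen) :
    r.coord (Coord.gen q (starGen k)) = star (r.coord (Coord.gen q k)) := by
  rw [Rep.coord, Coord.lift_gen, Coord.lift_gen]
  cases k <;> simp [starGen, genMap]

variable {q : ℝ} (r : Rep q)

/-- The action of `𝒪(SU_q(2)) ⊗ 𝒪(SU_q(2))` on `H_r ⊗ L²(SU_q(2))`. -/
def Rep.regular : Coord q ⊗[ℂ] Coord q →ₐ[ℂ] (HTensor r.H (L2 q) →L[ℂ] HTensor r.H (L2 q)) :=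
  opTensorHom.comp (Algebra.TensorProduct.map r.coord
    ((gnsRep q).toAlgHom.comp (Coord.toCSUq q)))

theorem Rep.regular_tmul (x y : Coord q) :
    r.regular (x ⊗ₜ y) = opTensor (r.coord x) (gnsRep q (Coord.toCSUq q y)) := rfl

theorem Rep.regular_comul_starGen (k : Gen) :
    r.regular (Coord.comul q (Coord.gen q (starGen k))) =
      star (r.regular (Coord.comul q (Coord.gen q k))) := by
  have ha := r.coord_starGen .a
  have ha' := r.coord_starGen .a'
  have hb := r.coord_starGen .b
  have hb' := r.coord_starGen .b'
  have ka := toCSUq_starGen q .a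
  have ka' := toCSUq_starGen q .a'
  have kb := toCSUq_starGen q .b
  have kb' := toCSUq_starGen q .b'
  simp only [starGen, genMap] at ha ha' hb hb' ka ka' kb kb'
  rw [Coord.comul_gen, Coord.comul_gen]
  cases k <;> simp only [starGen, genMap, map_add, map_sub, map_smul, r.regular_tmul, star_add,
    star_sub, star_smul, star_opTensor, ← map_star, Complex.star_def, Complex.conj_ofReal,
    ← ha, ← ha', ← hb, ← hb', ← ka, ← ka', ← kb, ← kb']

/-- The embedding of `H_r ⊗ 𝒪(SU_q(2))` into `H_r ⊗ L²(SU_q(2))`. -/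
def Rep.vec : r.H ⊗[ℂ] Coord q →ₗ[ℂ] HTensor r.H (L2 q) :=
  HTensor.incl.toLinearMap ∘ₗ LinearMap.lTensor r.H (coordVec q)

theorem Rep.vec_tmul (ζ : r.H) (w : Coord q) :
    r.vec (ζ ⊗ₜ w) = HTensor.incl (ζ ⊗ₜ coordVec q w) := rfl

theorem gnsRep_coordVec (x : CSUq q) (y : Coord q) :
    gnsRep q x (coordVec q y) = gnsVec q (x * Coord.toCSUq q y) := gnsRep_gnsVec q x _

theorem gnsRep_toCSUq_coordVec (x y : Coord q) :
    gnsRep q (Coord.toCSUq q x) (coordVec q y) = coordVec q (x * y) := by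
  rw [gnsRep_coordVec, coordVec_apply, map_mul (Coord.toCSUq q)]

theorem Rep.vec_act (s : Coord q ⊗[ℂ] Coord q) (t : r.H ⊗[ℂ] Coord q) :
    r.vec (r.act s t) = r.regular s (r.vec t) := by
  induction s with
  | zero => simp
  | add s s' hs hs' => rw [map_add, map_add, LinearMap.add_apply, map_add, hs, hs']; rfl
  | tmul x y =>
    induction t with
    | zero => simp
    | add t t' ht ht' => simp only [map_add, ht, ht']
    | tmul ζ w =>
      rw [r.act_tmul, r.vec_tmul, r.vec_tmul, r.regular_tmul, opTensor_incl,
        TensorProduct.mapL_tmul, gnsRep_toCSUq_coordVec]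

theorem Rep.inner_vec_tmul (ζ ζ' : r.H) (w w' : Coord q) :
    ⟪r.vec (ζ ⊗ₜ w), r.vec (ζ' ⊗ₜ w')⟫_ℂ =
      ⟪ζ, ζ'⟫_ℂ * haar q (star (Coord.toCSUq q w) * Coord.toCSUq q w') := by
  rw [r.vec_tmul, r.vec_tmul, LinearIsometry.inner_map_map, TensorProduct.inner_tmul,
    coordVec_apply, coordVec_apply, inner_gnsVec]

theorem dense_coordVec (q : ℝ) : DenseRange (coordVec q) := by
  have h1 : DenseRange (gnsVec q) := UniformSpace.Completion.denseRange_coe.comp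
    (haar q).toPreGNS.surjective.denseRange (UniformSpace.Completion.continuous_coe _)
  have h2 : DenseRange (Coord.toCSUq q) := dense_coord
  exact h1.comp h2 (gnsVec_continuous q)

theorem Rep.dense_vec : DenseRange r.vec := by
  let S : Submodule ℂ (HTensor r.H (L2 q)) := r.vec.range.topologicalClosure
  have hS : IsClosed (S : Set (HTensor r.H (L2 q))) := Submodule.isClosed_topologicalClosure _
  have key : ∀ v : HTensor r.H (L2 q), v ∈ S := fun v => by
    refine HTensor.induction v hS fun v => ?_
    induction v with
    | zero => rw [map_zero]; exact zero_mem S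
    | add v v' hv hv' => rw [map_add]; exact add_mem hv hv'
    | tmul ζ u =>
      refine (dense_coordVec q).induction_on (p := fun u => insertL ζ u ∈ S) u
        (hS.preimage (insertL ζ).continuous) fun w => ?_
      exact Submodule.le_topologicalClosure _ ⟨ζ ⊗ₜ w, rfl⟩
  exact key

end RegularRepresentation

/-! ### `W` as an isometry implementing the comultiplication. -/

section CoactionUnitary

variable {q : Set.Ioc (0 : ℝ) 1} (r : Rep q)

theorem Rep.inner_regular_one (ζ ζ' : r.H) (s : Coord q ⊗[ℂ] Coord q) :
    ⟪r.vec (ζ ⊗ₜ 1), r.regular s (r.vec (ζ' ⊗ₜ 1))⟫_ℂ =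
      ⟪ζ, r.coord (TensorProduct.rid ℂ (Coord q) (LinearMap.lTensor (Coord q) (haarCoord q) s))
        ζ'⟫_ℂ := by
  induction s with
  | zero => simp
  | add s s' hs hs' => simp only [map_add, add_apply, inner_add_right, hs, hs']
  | tmul x y =>
    rw [← r.vec_act, r.act_tmul, r.inner_vec_tmul, mul_one, map_one, star_one, one_mul,
      LinearMap.lTensor_tmul, TensorProduct.rid_tmul, map_smul, smul_apply, inner_smul_right,
      mul_comm, haarCoord_apply]

/-- The inner product of `Δ(w)(ζ ⊗ 1)` and `Δ(w')(ζ' ⊗ 1)` is `⟪ζ, (1 ⊗ h)Δ(w*w') ζ'⟫`, which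
invariance reduces to `h(w*w')⟪ζ, ζ'⟫`. -/
theorem Rep.inner_vec_coaction (t t' : r.H ⊗[ℂ] Coord q) :
    ⟪r.vec (r.coaction t), r.vec (r.coaction t')⟫_ℂ = ⟪r.vec t, r.vec t'⟫_ℂ := by
  induction t with
  | zero => simp
  | add t s ht hs => simp only [map_add, inner_add_left, ht, hs]
  | tmul ζ w =>
    induction t' with
    | zero => simp
    | add t s ht hs => simp only [map_add, inner_add_right, ht, hs]
    | tmul ζ' w' =>
      -- `u` stands for `w*`, simultaneously in `C(SU_q(2))` and after applying `Δ`.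
      obtain ⟨u, hu, hu'⟩ := Coord.exists_star_of_gen (Coord.toCSUq q)
        (r.regular.comp (Coord.comul q)) (toCSUq_starGen q) r.regular_comul_starGen w
      rw [AlgHom.comp_apply, AlgHom.comp_apply] at hu'
      rw [r.coaction_tmul, r.coaction_tmul, r.vec_act, r.vec_act,
        ← ContinuousLinearMap.adjoint_inner_right, ← ContinuousLinearMap.star_eq_adjoint, ← hu',
        ← mul_apply_eq_comp, ← map_mul, ← map_mul, r.inner_regular_one, r.inner_vec_tmul, ← hu,
        ← map_mul, ← leftAction_apply, leftAction_haarCoord, map_smul, map_one, smul_apply,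
        inner_smul_right, haarCoord_apply, mul_comm]
      rfl

theorem Rep.norm_vec_coaction (t : r.H ⊗[ℂ] Coord q) :
    ‖r.vec (r.coaction t)‖ = ‖r.vec t‖ := by
  have h := congrArg Complex.re (r.inner_vec_coaction t t)
  have h1 : ∀ v : HTensor r.H (L2 q), (inner ℂ v v).re = ‖v‖ ^ 2 := fun v =>
    inner_self_eq_norm_sq (𝕜 := ℂ) v
  rw [h1, h1] at h
  exact (sq_eq_sq₀ (norm_nonneg _) (norm_nonneg _)).1 h

/-- The isometry `ζ ⊗ Λ(w) ↦ (1 ⊗ Λ)(Δ(w)(ζ ⊗ 1))` of `H_r ⊗ L²(SU_q(2))`. -/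
def Rep.isometry : HTensor r.H (L2 q) →L[ℂ] HTensor r.H (L2 q) :=
  (r.vec ∘ₗ r.coaction).extendOfNorm r.vec

theorem Rep.isometry_vec (t : r.H ⊗[ℂ] Coord q) : r.isometry (r.vec t) = r.vec (r.coaction t) :=
  LinearMap.extendOfNorm_eq r.dense_vec ⟨1, fun t => by
    rw [one_mul]; exact (r.norm_vec_coaction t).le⟩ t

theorem Rep.norm_isometry_le : ‖r.isometry‖ ≤ 1 :=
  LinearMap.opNorm_extendOfNorm_le r.dense_vec zero_le_one fun t => by
    rw [one_mul]; exact (r.norm_vec_coaction t).le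

/-- The compression of the isometry by a vector `ξ`. -/
def Rep.compress (ξ : r.H) : HTensor r.H (L2 q) →L[ℂ] L2 q :=
  (ContinuousLinearMap.adjoint (insertL ξ)).comp r.isometry

theorem Rep.norm_compress_le (ξ : r.H) : ‖r.compress ξ‖ ≤ ‖ξ‖ := by
  have h1 : ‖ContinuousLinearMap.adjoint (insertL ξ : L2 q →L[ℂ] HTensor r.H (L2 q))‖ ≤ ‖ξ‖ := by
    rw [LinearIsometryEquiv.norm_map]; exact norm_insertL_le ξ
  calc ‖r.compress ξ‖ ≤ _ := ContinuousLinearMap.opNorm_comp_le _ _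
    _ ≤ ‖ξ‖ * 1 := mul_le_mul h1 r.norm_isometry_le (norm_nonneg _) (norm_nonneg _)
    _ = ‖ξ‖ := mul_one _

theorem adjoint_insertL_incl {H K : Type*} [NormedAddCommGroup H] [InnerProductSpace ℂ H]
    [NormedAddCommGroup K] [InnerProductSpace ℂ K] [CompleteSpace K] (ξ ζ : H) (v : K) :
    ContinuousLinearMap.adjoint (insertL ξ : K →L[ℂ] HTensor H K) (HTensor.incl (ζ ⊗ₜ v)) =
      ⟪ξ, ζ⟫_ℂ • v := by
  refine ext_inner_left ℂ fun w => ?_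
  rw [ContinuousLinearMap.adjoint_inner_right, insertL_apply, LinearIsometry.inner_map_map,
    TensorProduct.inner_tmul, inner_smul_right]

theorem Rep.adjoint_insertL_act (ξ ζ : r.H) (s : Coord q ⊗[ℂ] Coord q) (w : Coord q) :
    ContinuousLinearMap.adjoint (insertL ξ : L2 q →L[ℂ] HTensor r.H (L2 q))
      (r.vec (r.act s (ζ ⊗ₜ w))) =
      coordVec q (TensorProduct.lid ℂ (Coord q)
        (LinearMap.rTensor (Coord q) (onCoord (vecFun r ξ ζ)) s) * w) := by
  induction s with
  | zero => simp
  | add s s' hs hs' => simp only [map_add, LinearMap.add_apply, add_mul, hs, hs']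
  | tmul x y =>
    rw [r.act_tmul, r.vec_tmul, adjoint_insertL_incl, LinearMap.rTensor_tmul,
      TensorProduct.lid_tmul, onCoord_apply, vecFun_apply, eval_toCSUq, smul_mul_assoc, map_smul]

/-- Compressing `W` by `ξ` and `ζ` gives a right action. Right actions commute with `∂_η` and
preserve degree, so these bounded operators map the closed graphs into themselves
(`compress_mem_ladderGraph`). -/
theorem Rep.compress_vec_tmul (ξ ζ : r.H) (w : Coord q) :
    r.compress ξ (r.vec (ζ ⊗ₜ w)) = coordVec q (rightAction (onCoord (vecFun r ξ ζ)) w) := by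
  have h : r.compress ξ (r.vec (ζ ⊗ₜ w)) = _ :=
    congrArg (ContinuousLinearMap.adjoint (insertL ξ)) (r.isometry_vec (ζ ⊗ₜ w))
  rw [h, r.coaction_tmul, r.adjoint_insertL_act, mul_one, rightAction_apply]

/-- The compression of `1 ⊗ x` by the isometry is the slice of `Δ(x)`. -/
theorem Rep.compress_opTensor {t : r.H ⊗[ℂ] Coord q} {ζ : r.H} {w : Coord q}
    (ht : r.coaction t = ζ ⊗ₜ w) (ξ : r.H) (x : CSUq q) :
    r.compress ξ (opTensor 1 (gnsRep q x) (r.vec t)) =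
      gnsRep q (vecSlice r ξ ζ (comul q x)) (coordVec q w) := by
  let L : CSUq q →ₗ[ℂ] (HTensor r.H (L2 q) →L[ℂ] HTensor r.H (L2 q)) :=
    opTensorₗ 1 ∘ₗ (gnsRep q).toAlgHom.toLinearMap
  have hL : Continuous L := (L.mkContinuous (‖(1 : r.H →L[ℂ] r.H)‖) fun x =>
    (norm_opTensor_le _ _).trans (mul_le_mul_of_nonneg_left
      (NonUnitalStarAlgHom.norm_apply_le (gnsRep q) x) (norm_nonneg _))).continuous
  refine ext_toCSUq (f := fun x => r.compress ξ (L x (r.vec t)))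
    (g := fun x => gnsRep q (vecSliceL r ξ ζ (comulL q x)) (coordVec q w)) ?_ ?_ (fun x => ?_) x
  · exact (r.compress ξ).continuous.comp (hL.clm_apply continuous_const)
  · have h := (gnsVec_continuous q).comp (((vecSliceL r ξ ζ).continuous.comp
      (comulL q).continuous).mul_const (Coord.toCSUq q w))
    refine h.congr fun x => (gnsRep_coordVec _ _).symm
  · have h1 : L (Coord.toCSUq q x) = r.regular (1 ⊗ₜ x) := by
      rw [r.regular_tmul, map_one]; rfl
    have h2 : r.compress ξ (r.vec (r.act (1 ⊗ₜ x) t)) = _ :=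
      congrArg (ContinuousLinearMap.adjoint (insertL ξ)) (r.isometry_vec _)
    rw [h1, ← r.vec_act, h2, r.coaction_act, ht, r.adjoint_insertL_act, ← rightAction_apply,
      comulL_apply, vecSliceL_apply, vecSlice_comul_toCSUq, gnsRep_toCSUq_coordVec]

end CoactionUnitary

/-! ### Commutator bounds pass from `x` to slices of `Δ(x)`. -/

section BlockTransfer

/-- The circle action is itself a left action, so it commutes with right actions. -/
theorem rightAction_mem_spectral {q : Set.Ioc (0 : ℝ) 1} (ψ : Coord q →ₗ[ℂ] ℂ) {n : ℤ}
    {x : Coord q} (hx : x ∈ spectral q n) : rightAction ψ x ∈ spectral q n :=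
  mem_spectral_of_scale fun z => by
    have h : ∀ y, scale q z z y = leftAction (torusChar q z).toLinearMap y := fun y => by
      rw [leftAction_torusChar]; rfl
    rw [h, ← rightAction_leftAction, ← h, scale_of_mem_spectral hx, map_smul]

/-- The map `Λ` from `𝒜_n` to `H_n`. -/
def specVec (q : ℝ) (n : ℤ) : spectral q n →ₗ[ℂ] Hspec q n :=
  LinearMap.codRestrict (Hspec q n) (coordVec q ∘ₗ (spectral q n).subtype) fun x =>
    coordVec_mem x.2

theorem dense_specVec (q : ℝ) (n : ℤ) : DenseRange (specVec q n) := fun v => by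
  rw [closure_subtype]
  refine closure_mono ?_ v.2
  rintro _ ⟨x, hx, rfl⟩
  exact ⟨specVec q n ⟨x, hx⟩, ⟨_, rfl⟩, rfl⟩

instance (q : ℝ) (n : ℤ) : CompleteSpace (Hspec q n) := (isClosed_Hspec q n).completeSpace_coe

/-- `x` preserves the domain of the closure of `T`, with commutator given by the operator `B`. -/
def IsBlock (q : ℝ) (n : ℤ) (T : Coord q →ₗ[ℂ] Coord q) (x : CSUq q) (B : L2 q →L[ℂ] L2 q) : Prop :=
  ∀ p ∈ ladderGraph q n T, (gnsRep q x p.1, B p.1 + gnsRep q x p.2) ∈ ladderGraph q n T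

variable {q : Set.Ioc (0 : ℝ) 1}

theorem isClosed_ladderGraph (q : ℝ) (n : ℤ) (T : Coord q →ₗ[ℂ] Coord q) :
    IsClosed (ladderGraph q n T : Set (L2 q × L2 q)) := Submodule.isClosed_topologicalClosure _

theorem IsSkew.ladderGraph_unique {η : Coord q →ₗ[ℂ] ℂ} (hη : IsSkew q η) {n m : ℤ}
    (hT : ∀ x ∈ spectral q n, leftAction η x ∈ spectral q m) {u v v' : L2 q}
    (hv : (u, v) ∈ ladderGraph q n (leftAction η))
    (hv' : (u, v') ∈ ladderGraph q n (leftAction η)) : v = v' := by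
  have h := sub_mem hv hv'
  rw [Prod.mk_sub_mk, sub_self] at h
  exact sub_eq_zero.1 (hη.eq_zero_of_mem_ladderGraph hT h)

theorem compress_mem_ladderGraph (r : Rep q) (ξ ζ : r.H) (η : Coord q →ₗ[ℂ] ℂ) {n : ℤ}
    {p : L2 q × L2 q} (hp : p ∈ ladderGraph q n (leftAction η)) :
    (r.compress ξ (insertL ζ p.1), r.compress ξ (insertL ζ p.2)) ∈
      ladderGraph q n (leftAction η) := by
  refine ladderGraph_induction (s := {p : L2 q × L2 q | (r.compress ξ (insertL ζ p.1),
    r.compress ξ (insertL ζ p.2)) ∈ ladderGraph q n (leftAction η)}) ?_ (fun x hx => ?_) hp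
  · exact (isClosed_ladderGraph q n _).preimage (by fun_prop)
  · have h1 : ∀ y, r.compress ξ (insertL ζ (coordVec q y)) = _ := r.compress_vec_tmul ξ ζ
    rw [Set.mem_ofPred_eq, h1, h1, rightAction_leftAction]
    exact mem_ladderGraph _ (rightAction_mem_spectral _ hx)

/-- The commutation relation of `x` with `∂_η`, amplified to `H_r ⊗ 𝒜_n` and compressed by `W`.
Linearity in `t` reduces it to elementary tensors. -/
theorem IsBlock.compress_mem {n : ℤ} {η : Coord q →ₗ[ℂ] ℂ} {x : CSUq q} {B : L2 q →L[ℂ] L2 q}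
    (hB : IsBlock q n (leftAction η) x B) (r : Rep q) (ξ : r.H) {t : r.H ⊗[ℂ] Coord q}
    (ht : t ∈ r.gradedTensor n) :
    (r.compress ξ (opTensor 1 (gnsRep q x) (r.vec t)), r.compress ξ (opTensor 1 B (r.vec t)) +
      r.compress ξ (opTensor 1 (gnsRep q x) (r.vec (LinearMap.lTensor r.H (leftAction η) t)))) ∈
      ladderGraph q n (leftAction η) := by
  induction ht using Submodule.span_induction with
  | mem t ht =>
    obtain ⟨ζ, w, hw, rfl⟩ := ht
    have h := compress_mem_ladderGraph r ξ ζ η (hB _ (mem_ladderGraph (leftAction η) hw))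
    rw [map_add, map_add] at h
    rw [LinearMap.lTensor_tmul, r.vec_tmul, r.vec_tmul, opTensor_incl, opTensor_incl, opTensor_incl,
      TensorProduct.mapL_tmul, TensorProduct.mapL_tmul, TensorProduct.mapL_tmul]
    exact h
  | zero =>
    simp only [map_zero, add_zero]
    exact zero_mem _
  | add s t _ _ hs ht =>
    simp only [map_add]
    rw [add_add_add_comm]
    exact add_mem hs ht
  | smul c t _ ht =>
    simp only [map_smul]
    rw [← smul_add]
    exact Submodule.smul_mem _ c ht

/-- Write `ζ ⊗ w = W t` with `t ∈ H_r ⊗ 𝒜_n`. The commutator of `∂_η` with the slice at `Λ(w)` is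
then the `ξ`-component of `W(1 ⊗ B)t`, and `‖t‖ = ‖ζ‖ ‖Λ(w)‖` because `W` is isometric. -/
theorem IsBlock.exists_vecSlice {n : ℤ} {η : Coord q →ₗ[ℂ] ℂ} {x : CSUq q} {B : L2 q →L[ℂ] L2 q}
    (hB : IsBlock q n (leftAction η) x B) (r : Rep q) (ξ ζ : r.H) {w : Coord q}
    (hw : w ∈ spectral q n) :
    ∃ f : L2 q, ‖f‖ ≤ ‖ξ‖ * ‖ζ‖ * ‖B‖ * ‖coordVec q w‖ ∧
      (gnsRep q (vecSlice r ξ ζ (comul q x)) (coordVec q w),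
        f + gnsRep q (vecSlice r ξ ζ (comul q x)) (coordVec q (leftAction η w))) ∈
          ladderGraph q n (leftAction η) := by
  obtain ⟨t, ht, htw⟩ := spectral_le_covered (r := r) hw ζ
  have ht' : r.coaction (LinearMap.lTensor r.H (leftAction η) t) = ζ ⊗ₜ leftAction η w := by
    rw [r.coaction_leftAction, htw, LinearMap.lTensor_tmul]
  refine ⟨r.compress ξ (opTensor 1 B (r.vec t)), ?_, ?_⟩
  · have h1 : ‖r.vec t‖ = ‖ζ‖ * ‖coordVec q w‖ := by
      rw [← r.norm_vec_coaction, htw, r.vec_tmul, LinearIsometry.norm_map, TensorProduct.norm_tmul]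
    have h2 : ‖opTensor (1 : r.H →L[ℂ] r.H) B‖ ≤ ‖B‖ :=
      (norm_opTensor_le _ _).trans (mul_le_of_le_one_left (norm_nonneg _)
        ContinuousLinearMap.norm_id_le)
    calc _ ≤ ‖ξ‖ * ‖opTensor 1 B (r.vec t)‖ :=
          ContinuousLinearMap.le_of_opNorm_le _ (r.norm_compress_le ξ) _
      _ ≤ ‖ξ‖ * (‖B‖ * ‖r.vec t‖) := by
          gcongr; exact ContinuousLinearMap.le_of_opNorm_le _ h2 _
      _ = _ := by rw [h1]; ring
  · have h := hB.compress_mem r ξ ht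
    rwa [r.compress_opTensor htw, r.compress_opTensor ht'] at h

/-- Slices of `Δ(x)` inherit a commutator bound from `x`. -/
theorem IsBlock.vecSlice {n m : ℤ} {η : Coord q →ₗ[ℂ] ℂ} (hη : IsSkew q η)
    (hT : ∀ x ∈ spectral q n, leftAction η x ∈ spectral q m) {x : CSUq q} {B : L2 q →L[ℂ] L2 q}
    (hB : IsBlock q n (leftAction η) x B) (r : Rep q) (ξ ζ : r.H) :
    ∃ B', IsBlock q n (leftAction η) (vecSlice r ξ ζ (comul q x)) B' ∧
      ‖B'‖ ≤ ‖ξ‖ * ‖ζ‖ * ‖B‖ := by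
  choose f hf hfG using fun w : spectral q n => hB.exists_vecSlice r ξ ζ w.2
  set y := QuantumSU2.vecSlice r ξ ζ (comul q x) with hy
  -- The chosen vectors depend linearly on `w` because the closed graph is single-valued: sums and
  -- multiples have only one possible commutator.
  let F : spectral q n →ₗ[ℂ] L2 q :=
    { toFun := f
      map_add' := fun w w' => by
        have h1 := hfG (w + w')
        have h2 := add_mem (hfG w) (hfG w')
        rw [Prod.mk_add_mk, ← map_add, ← map_add, add_add_add_comm, ← map_add, ← map_add,
          ← map_add] at h2
        exact add_right_cancel (hη.ladderGraph_unique hT h1 h2)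
      map_smul' := fun c w => by
        have h1 := hfG (c • w)
        have h2 := Submodule.smul_mem _ c (hfG w)
        rw [Prod.smul_mk, smul_add, ← map_smul, ← map_smul, ← map_smul, ← map_smul,
          ← map_smul] at h2
        exact add_right_cancel (hη.ladderGraph_unique hT h1 h2) }
  have hF : ∀ w, ‖F w‖ ≤ ‖ξ‖ * ‖ζ‖ * ‖B‖ * ‖specVec q n w‖ := hf
  have hC : 0 ≤ ‖ξ‖ * ‖ζ‖ * ‖B‖ := by positivity
  -- `IsBlock` asks for an operator on all of `L²`, so the extension to `H_n` is composed with the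
  -- projection.
  let P : L2 q →L[ℂ] Hspec q n := (Hspec q n).orthogonalProjectionOnto
  have hP : ‖P‖ ≤ 1 := Submodule.orthogonalProjectionOnto_norm_le _
  refine ⟨(F.extendOfNorm (specVec q n)).comp P, fun p hp => ?_, ?_⟩
  · refine ladderGraph_induction (s := {p : L2 q × L2 q | (gnsRep q y p.1,
      (F.extendOfNorm (specVec q n)).comp P p.1 + gnsRep q y p.2) ∈
        ladderGraph q n (leftAction η)}) ?_ (fun w hw => ?_) hp
    · exact (isClosed_ladderGraph q n _).preimage (by fun_prop)
    · have h1 : P (coordVec q w) = specVec q n ⟨w, hw⟩ :=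
        Submodule.orthogonalProjectionOnto_mem_subspace_eq_self (specVec q n ⟨w, hw⟩)
      rw [Set.mem_ofPred_eq, ContinuousLinearMap.comp_apply, h1,
        LinearMap.extendOfNorm_eq (dense_specVec q n) ⟨_, hF⟩]
      exact hfG ⟨w, hw⟩
  · calc _ ≤ _ := ContinuousLinearMap.opNorm_comp_le _ _
      _ ≤ (‖ξ‖ * ‖ζ‖ * ‖B‖) * 1 := mul_le_mul
        (LinearMap.opNorm_extendOfNorm_le (dense_specVec q n) hC hF) hP (norm_nonneg _) hC
      _ = _ := mul_one _

theorem circleAction_vecSlice (r : Rep q) (ξ ζ : r.H) (z : Circle) (x : CSUq q) :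
    circleAction q z (vecSlice r ξ ζ (comul q x)) =
      vecSlice r ξ ζ (comul q (circleAction q z x)) := by
  have hc : Continuous (circleAction q z) := map_continuous (circleAction q z)
  have hs : Continuous fun x : CSUq q => vecSlice r ξ ζ (comul q x) :=
    (vecSliceL r ξ ζ).continuous.comp (comulL q).continuous
  refine ext_toCSUq (f := fun x => circleAction q z (vecSlice r ξ ζ (comul q x)))
    (g := fun x => vecSlice r ξ ζ (comul q (circleAction q z x))) (hc.comp hs) (hs.comp hc)
    (fun x => ?_) x
  have h : ∀ y, scale q (Circle.toUnits z) (Circle.toUnits z) y =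
      leftAction (torusChar q (Circle.toUnits z)).toLinearMap y := fun y => by
    rw [leftAction_torusChar]; rfl
  simp only [vecSlice_comul_toCSUq, circleAction_toCSUq]
  rw [h, h, rightAction_leftAction]

theorem vecSlice_mem_sphere (r : Rep q) (ξ ζ : r.H) (x : sphere q) :
    vecSlice r ξ ζ (comul q (x : CSUq q)) ∈ sphere q := by
  refine StarSubalgebra.mem_iInf.2 fun z => ?_
  have hx : circleAction q z x = x := (StarSubalgebra.mem_iInf.1 x.2 z : _)
  exact (circleAction_vecSlice r ξ ζ z x).trans (by rw [hx]; rfl)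

end BlockTransfer

/-! ### From blocks to the Dirac operator and the Lipschitz seminorm. -/

section Commutators

variable {q : Set.Ioc (0 : ℝ) 1}

theorem leftAction_pairE_spectral : ∀ x ∈ spectral q 1, leftAction (pairE q) x ∈ spectral q (-1) :=
  fun _ hx => leftAction_pairE_mem hx

theorem leftAction_pairF_spectral : ∀ x ∈ spectral q (-1), leftAction (pairF q) x ∈ spectral q 1 :=
  fun _ hx => leftAction_pairF_mem hx

theorem mem_graph_opE (p : Hspec q 1 × Hspec q (-1)) : p ∈ (opE q).graph ↔
    ((p.1 : L2 q), (p.2 : L2 q)) ∈ ladderGraph q 1 (leftAction (pairE q)) :=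
  (isSkew_pairE q).ladder_closure_graph leftAction_pairE_spectral p

theorem mem_graph_opF (p : Hspec q (-1) × Hspec q 1) : p ∈ (opF q).graph ↔
    ((p.1 : L2 q), (p.2 : L2 q)) ∈ ladderGraph q (-1) (leftAction (pairF q)) :=
  (isSkew_pairF q).ladder_closure_graph leftAction_pairF_spectral p

/-- A spinor with given components. -/
def spinor (v : Hspec q 1) (w : Hspec q (-1)) : Spinor q := WithLp.toLp 2 (v, w)

theorem mem_graph_dirac (p : Spinor q × Spinor q) : p ∈ (dirac q).graph ↔
    ((p.1.fst : L2 q), (p.2.snd : L2 q)) ∈ ladderGraph q 1 (leftAction (pairE q)) ∧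
      ((p.1.snd : L2 q), (p.2.fst : L2 q)) ∈ ladderGraph q (-1) (leftAction (pairF q)) := by
  rw [← mem_graph_opE (p.1.fst, p.2.snd), ← mem_graph_opF (p.1.snd, p.2.fst),
    LinearPMap.mem_graph_iff, LinearPMap.mem_graph_iff, LinearPMap.mem_graph_iff]
  constructor
  · rintro ⟨v, hv, hw⟩
    rw [← hv, ← hw]
    exact ⟨⟨⟨_, v.2.1⟩, rfl, rfl⟩, ⟨⟨_, v.2.2⟩, rfl, rfl⟩⟩
  · rintro ⟨⟨v, hv, hv'⟩, ⟨w, hw, hw'⟩⟩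
    have h1 : p.1 ∈ (dirac q).domain :=
      ⟨show p.1.fst ∈ (opE q).domain from (congrArg (· ∈ (opE q).domain) hv).mp v.2,
        show p.1.snd ∈ (opF q).domain from (congrArg (· ∈ (opF q).domain) hw).mp w.2⟩
    refine ⟨⟨p.1, h1⟩, rfl, ?_⟩
    have e1 : v = ⟨p.1.fst, h1.1⟩ := Subtype.ext hv
    have e2 : w = ⟨p.1.snd, h1.2⟩ := Subtype.ext hw
    refine (WithLp.equiv 2 _).injective (Prod.ext ?_ ?_)
    · exact (congrArg (opF q) e2.symm).trans hw'
    · exact (congrArg (opE q) e1.symm).trans hv'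

/-- In terms of the graph, preservation of the domain and the commutator formula become one
membership statement, which splits into conditions for `E` and `F`. -/
theorem isCommutator_iff (x : sphere q) (T : Spinor q →L[ℂ] Spinor q) : IsCommutator q x T ↔
    ∀ p ∈ (dirac q).graph, (spinorRep x p.1, T p.1 + spinorRep x p.2) ∈ (dirac q).graph := by
  constructor
  · intro h p hp
    obtain ⟨v, hv, hw⟩ := (LinearPMap.mem_graph_iff _).1 hp
    obtain ⟨h1, h2⟩ := h v
    refine (LinearPMap.mem_graph_iff _).2 ⟨⟨_, h1⟩, congrArg (spinorRep x) hv, ?_⟩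
    rw [← hv, h2, ← hw, sub_add_cancel]
  · intro h v
    obtain ⟨u, hu, hw⟩ := (LinearPMap.mem_graph_iff _).1 (h _ ((dirac q).mem_graph v))
    have hm : spinorRep x v ∈ (dirac q).domain :=
      (congrArg (· ∈ (dirac q).domain) hu).mp u.2
    refine ⟨hm, ?_⟩
    have e : u = ⟨spinorRep x v, hm⟩ := Subtype.ext hu
    rw [eq_sub_iff_add_eq, ← e, hw]

/-- The inclusion of `H_+`, precomposed with the projection of `L²(SU_q(2))` to `H_+`. -/
def inPlus (q : Set.Ioc (0 : ℝ) 1) : L2 q →L[ℂ] Spinor q :=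
  LinearMap.mkContinuous
    { toFun := fun v => spinor ((Hspec q 1).orthogonalProjectionOnto v) 0
      map_add' := fun v w => (WithLp.equiv 2 _).injective
        (Prod.ext (map_add (Hspec q 1).orthogonalProjectionOnto v w) (add_zero 0).symm)
      map_smul' := fun c v => (WithLp.equiv 2 _).injective
        (Prod.ext (map_smul (Hspec q 1).orthogonalProjectionOnto c v) (smul_zero c).symm) }
    1 fun v => by
      rw [one_mul]
      change ‖WithLp.toLp 2 ((Hspec q 1).orthogonalProjectionOnto v, (0 : Hspec q (-1)))‖ ≤ _
      rw [WithLp.norm_toLp_fst]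
      exact Submodule.norm_orthogonalProjectionOnto_apply_le _ _

/-- The inclusion of `H_-`, precomposed with the projection of `L²(SU_q(2))` to `H_-`. -/
def inMinus (q : Set.Ioc (0 : ℝ) 1) : L2 q →L[ℂ] Spinor q :=
  LinearMap.mkContinuous
    { toFun := fun v => spinor 0 ((Hspec q (-1)).orthogonalProjectionOnto v)
      map_add' := fun v w => (WithLp.equiv 2 _).injective
        (Prod.ext (add_zero 0).symm (map_add (Hspec q (-1)).orthogonalProjectionOnto v w))
      map_smul' := fun c v => (WithLp.equiv 2 _).injective
        (Prod.ext (smul_zero c).symm (map_smul (Hspec q (-1)).orthogonalProjectionOnto c v)) }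
    1 fun v => by
      rw [one_mul]
      change ‖WithLp.toLp 2 ((0 : Hspec q 1), (Hspec q (-1)).orthogonalProjectionOnto v)‖ ≤ _
      rw [WithLp.norm_toLp_snd]
      exact Submodule.norm_orthogonalProjectionOnto_apply_le _ _

theorem inPlus_apply (v : Hspec q 1) : inPlus q v = spinor v 0 := by
  change spinor ((Hspec q 1).orthogonalProjectionOnto v) 0 = _
  rw [Submodule.orthogonalProjectionOnto_mem_subspace_eq_self]

theorem inMinus_apply (v : Hspec q (-1)) : inMinus q v = spinor 0 v := by
  change spinor 0 ((Hspec q (-1)).orthogonalProjectionOnto v) = _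
  rw [Submodule.orthogonalProjectionOnto_mem_subspace_eq_self]

/-- The component in `H_+`, as an element of `L²(SU_q(2))`. -/
def outPlus (q : Set.Ioc (0 : ℝ) 1) : Spinor q →L[ℂ] L2 q :=
  LinearMap.mkContinuous
    { toFun := fun v => v.fst, map_add' := fun _ _ => rfl, map_smul' := fun _ _ => rfl }
    1 fun v => by rw [one_mul]; exact WithLp.norm_fst_le _ v

/-- The component in `H_-`, as an element of `L²(SU_q(2))`. -/
def outMinus (q : Set.Ioc (0 : ℝ) 1) : Spinor q →L[ℂ] L2 q :=
  LinearMap.mkContinuous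
    { toFun := fun v => v.snd, map_add' := fun _ _ => rfl, map_smul' := fun _ _ => rfl }
    1 fun v => by rw [one_mul]; exact WithLp.norm_snd_le _ v

theorem norm_comp_comp_le {E F G H : Type*} [NormedAddCommGroup E] [NormedAddCommGroup F]
    [NormedAddCommGroup G] [NormedAddCommGroup H] [NormedSpace ℂ E] [NormedSpace ℂ F]
    [NormedSpace ℂ G] [NormedSpace ℂ H] {S : G →L[ℂ] H} {R : E →L[ℂ] F} (hS : ‖S‖ ≤ 1)
    (hR : ‖R‖ ≤ 1) (T : F →L[ℂ] G) : ‖S.comp (T.comp R)‖ ≤ ‖T‖ :=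
  calc _ ≤ ‖S‖ * ‖T.comp R‖ := ContinuousLinearMap.opNorm_comp_le _ _
    _ ≤ 1 * (‖T‖ * 1) := by
      gcongr
      exact (ContinuousLinearMap.opNorm_comp_le _ _).trans (by gcongr)
    _ = ‖T‖ := by ring

theorem IsCommutator.exists_isBlock_pairE {x : sphere q} {T : Spinor q →L[ℂ] Spinor q}
    (h : IsCommutator q x T) :
    ∃ B, IsBlock q 1 (leftAction (pairE q)) x B ∧ ‖B‖ ≤ ‖T‖ := by
  refine ⟨(outMinus q).comp (T.comp (inPlus q)), fun p hp => ?_,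
    norm_comp_comp_le (LinearMap.mkContinuous_norm_le _ zero_le_one _)
      (LinearMap.mkContinuous_norm_le _ zero_le_one _) T⟩
  obtain ⟨h1, h2⟩ := ladderGraph_mem_Hspec leftAction_pairE_spectral hp
  have hm := (isCommutator_iff x T).1 h (spinor ⟨p.1, h1⟩ 0, spinor 0 ⟨p.2, h2⟩)
    ((mem_graph_dirac _).2 ⟨hp, zero_mem _⟩)
  have hm' := ((mem_graph_dirac _).1 hm).1
  have e : T (inPlus q p.1) = T (spinor ⟨p.1, h1⟩ 0) := congrArg T (inPlus_apply ⟨p.1, h1⟩)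
  change (_, ((T (inPlus q p.1)).snd : L2 q) + _) ∈ _
  rw [e]
  exact hm'

theorem IsCommutator.exists_isBlock_pairF {x : sphere q} {T : Spinor q →L[ℂ] Spinor q}
    (h : IsCommutator q x T) :
    ∃ B, IsBlock q (-1) (leftAction (pairF q)) x B ∧ ‖B‖ ≤ ‖T‖ := by
  refine ⟨(outPlus q).comp (T.comp (inMinus q)), fun p hp => ?_,
    norm_comp_comp_le (LinearMap.mkContinuous_norm_le _ zero_le_one _)
      (LinearMap.mkContinuous_norm_le _ zero_le_one _) T⟩
  obtain ⟨h1, h2⟩ := ladderGraph_mem_Hspec leftAction_pairF_spectral hp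
  have hm := (isCommutator_iff x T).1 h (spinor 0 ⟨p.1, h1⟩, spinor ⟨p.2, h2⟩ 0)
    ((mem_graph_dirac _).2 ⟨zero_mem _, hp⟩)
  have hm' := ((mem_graph_dirac _).1 hm).2
  have e : T (inMinus q p.1) = T (spinor 0 ⟨p.1, h1⟩) := congrArg T (inMinus_apply ⟨p.1, h1⟩)
  change (_, ((T (inMinus q p.1)).fst : L2 q) + _) ∈ _
  rw [e]
  exact hm'

/-- `B p.1` is the difference of a second graph component and a vector of `H_m`, so the projections
in `offDiagonal` do nothing on the domain. -/
theorem IsBlock.mem_Hspec {n m : ℤ} {T : Coord q →ₗ[ℂ] Coord q}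
    (hT : ∀ x ∈ spectral q n, T x ∈ spectral q m) {y : sphere q} {B : L2 q →L[ℂ] L2 q}
    (hB : IsBlock q n T y B) {p : L2 q × L2 q} (hp : p ∈ ladderGraph q n T) :
    B p.1 ∈ Hspec q m := by
  have h1 := (ladderGraph_mem_Hspec hT (hB p hp)).2
  have h2 := gnsRep_mem_Hspec m y (ladderGraph_mem_Hspec hT hp).2
  exact (Submodule.add_mem_iff_left _ h2).1 h1

/-- The operator `(v, w) ↦ (B' w, B v)`, with components projected to `H_+` and `H_-`. -/
def offDiagonal (B B' : L2 q →L[ℂ] L2 q) : Spinor q →L[ℂ] Spinor q :=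
  (inPlus q).comp (B'.comp (outMinus q)) + (inMinus q).comp (B.comp (outPlus q))

theorem offDiagonal_apply (B B' : L2 q →L[ℂ] L2 q) (v : Spinor q) : offDiagonal B B' v =
    spinor ((Hspec q 1).orthogonalProjectionOnto (B' v.snd))
      ((Hspec q (-1)).orthogonalProjectionOnto (B v.fst)) :=
  (WithLp.equiv 2 _).injective (Prod.ext (add_zero _) (zero_add _))

/-- The two corners have orthogonal sources and orthogonal ranges, so the norm is bounded by the
larger of the two and not by their sum. This keeps the constant in the theorem equal to `1`. -/
theorem norm_offDiagonal_le {B B' : L2 q →L[ℂ] L2 q} {C : ℝ} (hC : 0 ≤ C) (hB : ‖B‖ ≤ C)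
    (hB' : ‖B'‖ ≤ C) : ‖offDiagonal B B'‖ ≤ C := by
  refine ContinuousLinearMap.opNorm_le_bound _ hC fun v => ?_
  have h1 : ‖(Hspec q 1).orthogonalProjectionOnto (B' v.snd)‖ ≤ C * ‖v.snd‖ :=
    (Submodule.norm_orthogonalProjectionOnto_apply_le _ _).trans
      (ContinuousLinearMap.le_of_opNorm_le _ hB' _)
  have h2 : ‖(Hspec q (-1)).orthogonalProjectionOnto (B v.fst)‖ ≤ C * ‖v.fst‖ :=
    (Submodule.norm_orthogonalProjectionOnto_apply_le _ _).trans
      (ContinuousLinearMap.le_of_opNorm_le _ hB _)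
  refine le_of_sq_le_sq ?_ (by positivity)
  rw [offDiagonal_apply, mul_pow, WithLp.prod_norm_sq_eq_of_L2, WithLp.prod_norm_sq_eq_of_L2]
  have h3 := pow_le_pow_left₀ (norm_nonneg _) h1 2
  have h4 := pow_le_pow_left₀ (norm_nonneg _) h2 2
  rw [mul_pow] at h3 h4
  calc _ ≤ C ^ 2 * ‖v.snd‖ ^ 2 + C ^ 2 * ‖v.fst‖ ^ 2 := add_le_add h3 h4
    _ = _ := by ring

theorem isCommutator_offDiagonal {y : sphere q} {B B' : L2 q →L[ℂ] L2 q}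
    (hB : IsBlock q 1 (leftAction (pairE q)) y B)
    (hB' : IsBlock q (-1) (leftAction (pairF q)) y B') : IsCommutator q y (offDiagonal B B') := by
  refine (isCommutator_iff y _).2 fun p hp => ?_
  obtain ⟨hE, hF⟩ := (mem_graph_dirac p).1 hp
  have hE' := hB.mem_Hspec leftAction_pairE_spectral hE
  have hF' := hB'.mem_Hspec leftAction_pairF_spectral hF
  have e : offDiagonal B B' p.1 = spinor ⟨_, hF'⟩ ⟨_, hE'⟩ := by
    rw [offDiagonal_apply]
    congr 1
    · exact Submodule.orthogonalProjectionOnto_mem_subspace_eq_self (⟨_, hF'⟩ : Hspec q 1)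
    · exact Submodule.orthogonalProjectionOnto_mem_subspace_eq_self (⟨_, hE'⟩ : Hspec q (-1))
  rw [e]
  exact (mem_graph_dirac _).2 ⟨hB _ hE, hB' _ hF⟩

theorem spinor_specVec_mem (v : spectral q 1) (w : spectral q (-1)) :
    spinor (specVec q 1 v) (specVec q (-1) w) ∈ (dirac q).domain := by
  have h : (spinor (specVec q 1 v) (specVec q (-1) w),
      spinor (specVec q 1 ⟨_, leftAction_pairF_spectral w w.2⟩)
        (specVec q (-1) ⟨_, leftAction_pairE_spectral v v.2⟩)) ∈ (dirac q).graph :=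
    (mem_graph_dirac _).2 ⟨mem_ladderGraph _ v.2, mem_ladderGraph _ w.2⟩
  obtain ⟨u, hu, -⟩ := (LinearPMap.mem_graph_iff _).1 h
  exact (congrArg (· ∈ (dirac q).domain) hu).mp u.2

/-- The domain of `D_q` contains the dense image of `𝒜_1 ⊕ 𝒜_{-1}`. The norm of the operator picked
by choice in `derivation` can therefore be computed from any extension. -/
theorem IsCommutator.unique {x : sphere q} {T T' : Spinor q →L[ℂ] Spinor q}
    (h : IsCommutator q x T) (h' : IsCommutator q x T') : T = T' := by
  have hd : DenseRange fun p : spectral q 1 × spectral q (-1) =>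
      spinor (specVec q 1 p.1) (specVec q (-1) p.2) :=
    (WithLp.prodContinuousLinearEquiv 2 ℂ (Hspec q 1) (Hspec q (-1))).symm.surjective.denseRange.comp
      ((dense_specVec q 1).prodMap (dense_specVec q (-1)))
      (WithLp.prodContinuousLinearEquiv 2 ℂ (Hspec q 1) (Hspec q (-1))).symm.continuous
  refine ContinuousLinearMap.ext fun v => congrFun (hd.equalizer T.continuous T'.continuous
    (funext fun p => ?_)) v
  obtain ⟨_, h1⟩ := h ⟨_, spinor_specVec_mem p.1 p.2⟩
  obtain ⟨_, h2⟩ := h' ⟨_, spinor_specVec_mem p.1 p.2⟩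
  exact h1.trans h2.symm

theorem isCommutator_derivation {x : sphere q} (hx : x ∈ lipAlgebra q) :
    IsCommutator q x (derivation q x) := by
  have h : ∃ T, IsCommutator q x T := hx
  rw [derivation, dif_pos h]
  exact h.choose_spec

theorem IsCommutator.lipSeminorm_eq {x : sphere q} {T : Spinor q →L[ℂ] Spinor q}
    (h : IsCommutator q x T) : lipSeminorm q x = ‖T‖ := by
  rw [lipSeminorm, (isCommutator_derivation ⟨T, h⟩).unique h]

/-- The slice `(⟪ξ, · ζ⟫ ⊗ 1)Δ(x)` of `x ∈ C(S_q^2)`. -/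
def sphereSlice (r : Rep q) (ξ ζ : r.H) (x : sphere q) : sphere q :=
  ⟨vecSlice r ξ ζ (comul q (x : CSUq q)), vecSlice_mem_sphere r ξ ζ x⟩

/-- Slices of the coproduct preserve the Lipschitz algebra. -/
theorem sphereSlice_mem_lipAlgebra {x : sphere q} (hx : x ∈ lipAlgebra q) (r : Rep q) (ξ ζ : r.H) :
    sphereSlice r ξ ζ x ∈ lipAlgebra q ∧
      lipSeminorm q (sphereSlice r ξ ζ x) ≤ ‖ξ‖ * ‖ζ‖ * lipSeminorm q x := by
  have h := isCommutator_derivation hx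
  obtain ⟨B, hB, hBn⟩ := h.exists_isBlock_pairE
  obtain ⟨B', hB', hBn'⟩ := h.exists_isBlock_pairF
  obtain ⟨D, hD, hDn⟩ := hB.vecSlice (isSkew_pairE q) leftAction_pairE_spectral r ξ ζ
  obtain ⟨D', hD', hDn'⟩ := hB'.vecSlice (isSkew_pairF q) leftAction_pairF_spectral r ξ ζ
  have hT : IsCommutator q (sphereSlice r ξ ζ x) (offDiagonal D D') :=
    isCommutator_offDiagonal hD hD'
  refine ⟨⟨_, hT⟩, ?_⟩
  rw [hT.lipSeminorm_eq]
  have hb : ∀ b, b ≤ ‖derivation q x‖ → ‖ξ‖ * ‖ζ‖ * b ≤ ‖ξ‖ * ‖ζ‖ * lipSeminorm q x :=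
    fun b hb => mul_le_mul_of_nonneg_left hb (by positivity)
  exact norm_offDiagonal_le (mul_nonneg (by positivity) (norm_nonneg (derivation q x)))
    (hDn.trans (hb _ hBn)) (hDn'.trans (hb _ hBn'))

theorem smul_mem_lipAlgebra {x : sphere q} (hx : x ∈ lipAlgebra q) (c : ℂ) :
    c • x ∈ lipAlgebra q ∧ lipSeminorm q (c • x) ≤ ‖c‖ * lipSeminorm q x := by
  have h := isCommutator_derivation hx
  have hT : IsCommutator q (c • x) (c • derivation q x) := by
    refine (isCommutator_iff _ _).2 fun p hp => ?_
    have hs : ∀ v, spinorRep (c • x) v = c • spinorRep x v := fun v => by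
      refine (WithLp.equiv 2 _).injective (Prod.ext (Subtype.ext ?_) (Subtype.ext ?_))
      · change gnsRep q (c • (x : CSUq q)) v.fst = c • gnsRep q x v.fst
        rw [map_smul]; rfl
      · change gnsRep q (c • (x : CSUq q)) v.snd = c • gnsRep q x v.snd
        rw [map_smul]; rfl
    rw [hs, hs, smul_apply, ← smul_add]
    exact Submodule.smul_mem _ c ((isCommutator_iff x _).1 h p hp)
  exact ⟨⟨_, hT⟩, by rw [hT.lipSeminorm_eq]; exact ContinuousLinearMap.opNorm_smul_le _ _⟩

/-- Elements with vanishing Lipschitz seminorm are weakly constant. -/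
theorem isWeaklyConstant_of_lipSeminorm_eq_zero {y : sphere q} (hy : y ∈ lipAlgebra q)
    (h0 : lipSeminorm q y = 0) : IsWeaklyConstant (y : CSUq q) := by
  have h := isCommutator_derivation hy
  obtain ⟨B, hB, hBn⟩ := h.exists_isBlock_pairE
  have hB0 : B = 0 := norm_le_zero_iff.1 (hBn.trans h0.le)
  intro v hv w hw
  have hm := hB _ (mem_ladderGraph (leftAction (pairE q)) hw)
  rw [hB0, zero_apply, zero_add] at hm
  obtain ⟨u, hu⟩ := exists_star v
  obtain ⟨u', hu'⟩ := exists_star (leftAction (pairE q) v)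
  -- The adjoint relation between `∂_e(x)` and `∂_e(v)`, with factor `-q^{(1-(-1))/2} = -q`, is a
  -- closed condition, so it passes from `Λ(𝒜_1)` to the graph element `(yΛ(w), yΛ(∂_e w))`.
  have key := ladderGraph_induction (s := {p : L2 q × L2 q | ⟪coordVec q u, p.2⟫_ℂ =
    -(q : ℂ) * ⟪coordVec q u', p.1⟫_ℂ}) (isClosed_eq (continuous_const.inner continuous_snd)
      (continuous_const.mul (continuous_const.inner continuous_fst))) (fun x hx => by
    have hs := (isSkew_pairE q).haar_mul_leftAction (m := -1) (by rwa [neg_neg]) hx (u := v)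
    have hq : ((sqrtUnit q ^ ((1 : ℤ) - -1) : ℂˣ) : ℂ) = (q : ℝ) := by
      rw [← sqrtUnit_sq]; norm_cast
    rw [Set.mem_ofPred_eq, coordVec_apply, coordVec_apply, coordVec_apply, coordVec_apply,
      inner_gnsVec, inner_gnsVec, hu, hu', star_star, star_star, ← map_mul, ← map_mul,
      ← haarCoord_apply, ← haarCoord_apply, hs, hq]) hm
  rw [Set.mem_ofPred_eq, gnsRep_coordVec, gnsRep_coordVec, coordVec_apply, coordVec_apply,
    inner_gnsVec, inner_gnsVec, hu, hu', star_star, star_star, ← mul_assoc, ← mul_assoc] at key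
  exact key.symm

end Commutators

/-! ### Matrix coefficients of `x - β_N(x)` and the final estimate. -/

section BerezinEstimate

variable {q : Set.Ioc (0 : ℝ) 1}

theorem counit_toCSUq {q : ℝ} (x : Coord q) : counit q (Coord.toCSUq q x) = torusChar q 1 x := by
  have : (counit q).toAlgHom.comp (Coord.toCSUq q) = torusChar q 1 := Coord.hom_ext fun g => by
    have h : ((counit q).toAlgHom.comp (Coord.toCSUq q)) (Coord.gen q g) =
      counit q (Coord.toCSUq q (Coord.gen q g)) := rfl
    have ha : counit q (gena q) = 1 := rfl
    have hb : counit q (genb q) = 0 := rfl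
    rw [h, Coord.toCSUq_gen, torusChar, Coord.lift_gen]
    cases g <;> simp [genMap, map_star, ha, hb]
  exact congrArg (fun f => f x) this

theorem scale_one {q : ℝ} (x : Coord q) : scale q 1 1 x = x := by
  have : scale q 1 1 = AlgHom.id ℂ (Coord q) := Coord.hom_ext fun g => by
    rw [scale_gen]
    cases g <;> simp [genMap]
  exact congrArg (fun f => f x) this

/-- The counit axiom `(ω ⊗ ε)Δ = ω`: on coordinates `ε` is the torus character at `1`, whose left
action is the identity. -/
theorem counit_vecSlice (r : Rep q) (ξ ζ : r.H) (x : CSUq q) :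
    counit q (vecSlice r ξ ζ (comul q x)) = vecFun r ξ ζ x := by
  refine ext_toCSUq (f := fun x => counit q (vecSlice r ξ ζ (comul q x))) (g := vecFun r ξ ζ)
    ((map_continuous (counit q)).comp ((vecSliceL r ξ ζ).continuous.comp (comulL q).continuous))
    (vecFun r ξ ζ).continuous (fun x => ?_) x
  have h := apply_rightAction (onCoord (vecFun r ξ ζ)) (torusChar q 1).toLinearMap x
  rw [leftAction_torusChar] at h
  rw [vecSlice_comul_toCSUq, counit_toCSUq]
  refine h.trans ?_
  rw [AlgHom.toLinearMap_apply, scale_one, onCoord_apply]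

/-- For `c > 0` this is homogeneity of the supremum defining the distance. For `c = 0` the right
side is `0` even if the distance is infinite, so equality of the two states on `y` is required; it
comes from the rigidity of weakly constant elements. -/
theorem enorm_berezinState_sub_counitState_le (N : ℕ) {y : sphere q} (hy : y ∈ lipAlgebra q) {c : ℝ}
    (hc : 0 ≤ c) (hyc : lipSeminorm q y ≤ c) :
    ‖berezinState q N y - counitState q y‖ₑ ≤
      dMax q (berezinState q N) (counitState q) * ENNReal.ofReal c := by
  rcases hc.eq_or_lt with rfl | hc
  · have h0 : lipSeminorm q y = 0 := le_antisymm hyc (norm_nonneg (derivation q y))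
    have h : counitState q y = berezinState q N y :=
      (isWeaklyConstant_of_lipSeminorm_eq_zero hy h0).counit_eq y.2 N
    rw [h, sub_self, enorm_zero]
    exact zero_le
  · obtain ⟨h1, h2⟩ := smul_mem_lipAlgebra hy ((c⁻¹ : ℝ) : ℂ)
    have h3 : lipSeminorm q (((c⁻¹ : ℝ) : ℂ) • y) ≤ 1 := by
      refine h2.trans ?_
      rw [Complex.norm_real, Real.norm_of_nonneg (inv_nonneg.2 hc.le)]
      calc c⁻¹ * lipSeminorm q y ≤ c⁻¹ * c := by gcongr
        _ = 1 := inv_mul_cancel₀ hc.ne'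
    have h4 : ‖berezinState q N (((c⁻¹ : ℝ) : ℂ) • y) - counitState q (((c⁻¹ : ℝ) : ℂ) • y)‖ₑ ≤
        dMax q (berezinState q N) (counitState q) :=
      le_iSup₂ (f := fun (x : sphere q) (_ : x ∈ {x | x ∈ lipAlgebra q ∧ lipSeminorm q x ≤ 1}) =>
        ‖berezinState q N x - counitState q x‖ₑ) _ ⟨h1, h3⟩
    have h5 : berezinState q N y - counitState q y = (c : ℂ) •
        (berezinState q N (((c⁻¹ : ℝ) : ℂ) • y) - counitState q (((c⁻¹ : ℝ) : ℂ) • y)) := by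
      rw [map_smul, map_smul, ← smul_sub, smul_smul, ← Complex.ofReal_mul, mul_inv_cancel₀ hc.ne',
        Complex.ofReal_one, one_smul]
    have h6 : ‖(c : ℂ)‖ₑ = ENNReal.ofReal c := by
      rw [← ofReal_norm, Complex.norm_real, Real.norm_of_nonneg hc.le]
    rw [h5, enorm_smul, h6, mul_comm]
    gcongr

theorem vecFun_sub_berezin (N : ℕ) (x : sphere q) (r : Rep q) (ξ ζ : r.H) :
    vecFun r ξ ζ ((x : CSUq q) - berezin q N x) =
      -(berezinState q N (sphereSlice r ξ ζ x) - counitState q (sphereSlice r ξ ζ x)) := by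
  rw [map_sub, berezin, vecFun_slice, ← counit_vecSlice, neg_sub]
  rfl

theorem opNorm_le_of_inner {H : Type*} [NormedAddCommGroup H] [InnerProductSpace ℂ H]
    {T : H →L[ℂ] H} {C : ℝ} (hC : 0 ≤ C) (h : ∀ v w, ‖⟪v, T w⟫_ℂ‖ ≤ ‖v‖ * ‖w‖ * C) : ‖T‖ ≤ C := by
  refine ContinuousLinearMap.opNorm_le_bound _ hC fun w => ?_
  rcases eq_or_ne (T w) 0 with h0 | h0
  · rw [h0, norm_zero]; positivity
  refine le_of_mul_le_mul_left ?_ (norm_pos_iff.2 h0)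
  calc ‖T w‖ * ‖T w‖ = ‖⟪T w, T w⟫_ℂ‖ := by
        rw [inner_self_eq_norm_sq_to_K]; simp [sq]
    _ ≤ ‖T w‖ * ‖w‖ * C := h _ _
    _ = ‖T w‖ * (C * ‖w‖) := by ring

/-- Each matrix coefficient of `x - β_N(x)` is, up to sign, the difference of `h_N` and `ε` on a
slice whose seminorm is at most `‖ξ‖ ‖ζ‖ L(x)`. If the right side is infinite there is nothing to
prove; otherwise the estimate holds in every representation, hence for the norm. -/
theorem enorm_sub_berezin_le (N : ℕ) (x : sphere q) (hx : x ∈ lipAlgebra q) :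
    ‖(x : CSUq q) - berezin q N x‖ₑ ≤
      dMax q (berezinState q N) (counitState q) * ENNReal.ofReal (lipSeminorm q x) := by
  set M := dMax q (berezinState q N) (counitState q) * ENNReal.ofReal (lipSeminorm q x) with hM
  rcases eq_or_ne M ∞ with hM' | hM'
  · rw [hM']; exact le_top
  rw [← ENNReal.ofReal_toReal hM', ← ofReal_norm]
  refine ENNReal.ofReal_le_ofReal (OpFamily.norm_le ENNReal.toReal_nonneg fun r =>
    opNorm_le_of_inner ENNReal.toReal_nonneg fun ξ ζ => ?_)
  change ‖vecFun r ξ ζ ((x : CSUq q) - berezin q N x)‖ ≤ _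
  have hc : 0 ≤ ‖ξ‖ * ‖ζ‖ := by positivity
  obtain ⟨h1, h2⟩ := sphereSlice_mem_lipAlgebra hx r ξ ζ
  have hL : 0 ≤ lipSeminorm q x := norm_nonneg (derivation q x)
  have h3 := enorm_berezinState_sub_counitState_le N h1 (mul_nonneg hc hL) h2
  rw [ENNReal.ofReal_mul hc, mul_left_comm, ← hM, ← ofReal_norm,
    ← ENNReal.ofReal_toReal hM', ← ENNReal.ofReal_mul hc] at h3
  rw [vecFun_sub_berezin, norm_neg]
  exact (ENNReal.ofReal_le_ofReal_iff (mul_nonneg hc ENNReal.toReal_nonneg)).1 h3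

end BerezinEstimate

end QuantumSU2

end

theorem mainTheorem4 (q : Set.Ioc (0 : ℝ) 1) (N : ℕ) (x : QuantumSU2.sphere q)
    (hx : x ∈ QuantumSU2.lipAlgebra q) :
    ‖(x : QuantumSU2.CSUq q) - QuantumSU2.berezin q N x‖ₑ ≤
      QuantumSU2.dMax q (QuantumSU2.berezinState q N) (QuantumSU2.counitState q) *
        ENNReal.ofReal (QuantumSU2.lipSeminorm q x) :=
  QuantumSU2.enorm_sub_berezin_le N x hx
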